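/- **Definitions.** A *Borel foliation* of dimension $n$ is a set $X$ with a standard Borel structure and a topology (not related to the Borel structure) making it an $n$-manifold whose connected components, the *leaves*, are Hausdorff and second countable, and which is covered by the interiors of countably many closed Borel subsets, each isomorphic (Borel isomorphism and homeomorphism) to a prism $\mathbb D^n\times T_i$, with $\mathbb D^n$ the closed disc and $T_i$ a standard Borel space carrying the discrete topology. A *BT map* is a map that is both Borel and continuous. A *transversal* is a Borel set that is closed and discrete in the leaf topology; two transversals $S,T$ are equivalent if there is a Borel isomorphism $\gamma:S\to T$ with $\gamma(s)$ in the leaf of $s$ for all $s\in S$. An *invariant transverse measure* $\mu$ is a $\sigma$-additive map from transversals to $[0,+\infty]$, vanishing on $\varnothing$ and equal on equivalent transversals; $(X,\mu)$ is then a *measured foliation*. A set is *negligible* if every transversal contained in it has measure $0$; a *total part* is a saturated Borel set with negligible complement; $(X,\mu)$ is *ergodic* if every saturated Borel set is negligible or has negligible complement. An *écrasement* (collapse) $\pi:(X,\mu)\to(X',\mu')$ is a BT map $\pi:A\to A'$ between total parts $A\subset X$, $A'\subset X'$ such that: every fibre of $\pi$ is compact and contained in a single leaf; every leaf of $A$,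 and every leaf of $A'$ that meets $\pi(A)$, has exactly two ends, and $\pi$ sends the two ends of each leaf of $A$ onto the two ends of the image leaf; and $\pi_*\mu=\mu'$, i.e. $\mu'(S)=\mu(T)$ whenever $S\subset A'$ and $T\subset\pi^{-1}(S)$ are transversals and $T$ meets exactly once every nonempty fibre $\pi^{-1}(s)$, $s\in S$. **Proposition.** Let $(Y,\nu)$ and $(Y',\nu')$ be ergodic one-dimensional measured foliations and let $\pi:(Y,\nu)\to(Y',\nu')$ be an écrasement, defined between total parts $A\subset Y$ and $A'\subset Y'$. Then $\pi$ is homotopic to an isomorphism of measured foliations. That is, there are total parts $B\subset A$ of $Y$ and $B'\subset A'$ of $Y'$ with $\pi(B)\subset B'$, a bijection $\varphi:B\to B'$ such that $\varphi$ and $\varphi^{-1}$ are BT and $\nu'(\varphi(T))=\nu(T)$ for every transversal $T\subset B$ of $Y$, and a BT map $H:B\times[0,1]\to B'$ with $H(b,0)=\pi(b)$ and $H(b,1)=\varphi(b)$ for all $b\in B$. -/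

import Mathlib

open Set Topology
open scoped ENNReal

namespace MeasuredFoliation

universe u v

/-- The leaves of a Borel foliation are the connected components of its leaf topology. -/
def leaf {X : Type u} [TopologicalSpace X] (x : X) : Set X := connectedComponent x

/-- `U` is isomorphic, as a Borel foliation, to a prism `𝔻ⁿ × T`, where `𝔻ⁿ` is the closed unit
ball of `ℝⁿ` and the vertical `T` is a standard Borel space, carrying the discrete topology so that
the plaques `𝔻ⁿ × {t}` are the connected components of the prism. -/
def IsPrism (n : ℕ) {X : Type u} [TopologicalSpace X] [MeasurableSpace X] (U : Set X) : Prop :=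
  ∃ (T : Type u) (_ : TopologicalSpace T) (_ : DiscreteTopology T)
    (_ : MeasurableSpace T) (_ : StandardBorelSpace T)
    (e : U ≃ₜ Metric.closedBall (0 : EuclideanSpace ℝ (Fin n)) 1 × T),
    Measurable e ∧ Measurable e.symm

/-- A Borel foliation of dimension `n`: a set with a standard Borel structure and (unrelated to it)
the topology of an `n`-manifold, whose connected components are Hausdorff and second countable,
and which has a countable atlas of closed Borel prisms. -/
class BorelFoliation (n : ℕ) (X : Type u) [TopologicalSpace X] [MeasurableSpace X] : Prop
    extends StandardBorelSpace X where
  locallyEuclidean : ∀ x : X,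
    ∃ e : OpenPartialHomeomorph X (EuclideanSpace ℝ (Fin n)), x ∈ e.source
  t2_leaf : ∀ x : X, T2Space (leaf x)
  secondCountable_leaf : ∀ x : X, SecondCountableTopology (leaf x)
  exists_atlas : ∃ U : ℕ → Set X,
    (∀ i, IsClosed (U i) ∧ MeasurableSet (U i) ∧ IsPrism n (U i)) ∧ ⋃ i, interior (U i) = univ

section Transverse

variable {X : Type u} [TopologicalSpace X] [MeasurableSpace X]

/-- A union of leaves. -/
def IsSaturated (A : Set X) : Prop := ∀ x ∈ A, leaf x ⊆ A

/-- A transversal: a Borel set that is closed and discrete for the leaf topology. -/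
structure IsTransversal (T : Set X) : Prop where
  measurableSet : MeasurableSet T
  isClosed : IsClosed T
  discrete : DiscreteTopology T

/-- Two transversals are equivalent if some Borel isomorphism between them moves every point
inside its leaf. -/
def TransversalEquiv (S T : Set X) : Prop :=
  ∃ γ : S ≃ᵐ T, ∀ s : S, (γ s : X) ∈ leaf (s : X)

variable (X) in
/-- An invariant transverse measure. Only the values at transversals are meaningful. -/
structure InvariantTransverseMeasure where
  toFun : Set X → ℝ≥0∞
  empty : toFun ∅ = 0
  iUnion : ∀ f : ℕ → Set X, (∀ i, IsTransversal (f i)) → Pairwise (Function.onFun Disjoint f) →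
    IsTransversal (⋃ i, f i) → toFun (⋃ i, f i) = ∑' i, toFun (f i)
  invariant : ∀ S T : Set X, IsTransversal S → IsTransversal T → TransversalEquiv S T →
    toFun S = toFun T

instance : CoeFun (InvariantTransverseMeasure X) (fun _ => Set X → ℝ≥0∞) :=
  ⟨InvariantTransverseMeasure.toFun⟩

/-- A set is negligible if every transversal contained in it has measure zero. -/
def Negligible (μ : InvariantTransverseMeasure X) (B : Set X) : Prop :=
  ∀ T : Set X, IsTransversal T → T ⊆ B → μ T = 0

/-- A total part: a saturated Borel set with negligible complement. -/
structure IsTotalPart (μ : InvariantTransverseMeasure X) (A : Set X) : Prop where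
  measurableSet : MeasurableSet A
  saturated : IsSaturated A
  negligible_compl : Negligible μ Aᶜ

/-- Ergodicity: every saturated Borel set is negligible or has negligible complement. -/
def IsErgodic (μ : InvariantTransverseMeasure X) : Prop :=
  ∀ A : Set X, MeasurableSet A → IsSaturated A → Negligible μ A ∨ Negligible μ Aᶜ

end Transverse

section Ends

/-- An end of a space `L`: a choice, for every compact `K`, of a connected component of the
complement of `K`, decreasing in `K`. -/
structure SpaceEnd (L : Type u) [TopologicalSpace L] where
  comp : TopologicalSpace.Compacts L → Set L
  isComponent : ∀ K : TopologicalSpace.Compacts L, ∃ x ∈ (K : Set L)ᶜ, comp K = connectedComponentIn (K : Set L)ᶜ x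
  anti : ∀ K K' : TopologicalSpace.Compacts L, K ≤ K' → comp K' ⊆ comp K

/-- `L` has exactly two ends. -/
def TwoEnded (L : Type u) [TopologicalSpace L] : Prop := Nat.card (SpaceEnd L) = 2

/-- `f` sends the end `e` to the end `e'`: it tends to `e'` along `e`. -/
def MapsEnd {L : Type u} {L' : Type v} [TopologicalSpace L] [TopologicalSpace L']
    (f : L → L') (e : SpaceEnd L) (e' : SpaceEnd L') : Prop :=
  ∀ K' : TopologicalSpace.Compacts L', ∃ K : TopologicalSpace.Compacts L,
    MapsTo f (e.comp K) (e'.comp K')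

/-- `f` sends the ends of `L` onto the ends of `L'`. -/
def SendsEndsOnto {L : Type u} {L' : Type v} [TopologicalSpace L] [TopologicalSpace L']
    (f : L → L') : Prop :=
  (∀ e : SpaceEnd L, ∃ e' : SpaceEnd L', MapsEnd f e e') ∧
    ∀ e' : SpaceEnd L', ∃ e : SpaceEnd L, MapsEnd f e e'

end Ends

/-- The map from the leaf of `a` to the leaf of `f a` induced by a continuous map `f`. -/
def leafMap {A : Type u} {A' : Type v} [TopologicalSpace A] [TopologicalSpace A']
    (f : A → A') (hf : Continuous f) (a : A) : leaf a → leaf (f a) :=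
  MapsTo.restrict f (leaf a) (leaf (f a)) (hf.mapsTo_connectedComponent a)

section Morphisms

variable {X : Type u} {X' : Type v} [TopologicalSpace X] [MeasurableSpace X]
  [TopologicalSpace X'] [MeasurableSpace X']

/-- `π_* μ = ν`: the `ν`-measure of a transversal `S` is the `μ`-measure of any transversal `T`
contained in `π⁻¹ S` that meets exactly once every nonempty fibre of `π` over a point of `S`. -/
def IsPushforward (μ : InvariantTransverseMeasure X) (ν : InvariantTransverseMeasure X')
    {A : Set X} {A' : Set X'} (π : A → A') : Prop :=
  ∀ (S : Set X') (T : Set X), IsTransversal S → IsTransversal T → S ⊆ A' → T ⊆ A →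
    (∀ t : A, (t : X) ∈ T → (π t : X') ∈ S) →
    (∀ a : A, (π a : X') ∈ S → ∃! t : A, (t : X) ∈ T ∧ π t = π a) →
    ν S = μ T

/-- A collapse (écrasement) from a two-ended measured foliation `(X, μ)` to `(X', ν)`: a Borel and
continuous map `π` between total parts whose fibres are compact subsets of leaves, which sends the
two ends of each leaf onto the two ends of the image leaf, and such that `π_* μ = ν`. -/
structure IsCollapse (μ : InvariantTransverseMeasure X) (ν : InvariantTransverseMeasure X')
    {A : Set X} {A' : Set X'} (π : A → A') : Prop where
  total_source : IsTotalPart μ A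
  total_target : IsTotalPart ν A'
  continuous : Continuous π
  measurable : Measurable π
  isCompact_fibre : ∀ y : A', IsCompact (π ⁻¹' {y})
  fibre_in_leaf : ∀ a b : A, π a = π b → b ∈ leaf a
  twoEnded_source : ∀ a : A, TwoEnded (leaf a)
  twoEnded_target : ∀ a : A, TwoEnded (leaf (π a))
  sendsEndsOnto : ∀ a : A, SendsEndsOnto (leafMap π continuous a)
  pushforward : IsPushforward μ ν π

/-- An isomorphism of measured foliations: an isomorphism of Borel foliations between total parts
(bijective, Borel and continuous in both directions) which carries `μ` to `ν`. -/
structure IsMeasuredIso (μ : InvariantTransverseMeasure X) (ν : InvariantTransverseMeasure X')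
    {B : Set X} {B' : Set X'} (φ : B ≃ₜ B') : Prop where
  total_source : IsTotalPart μ B
  total_target : IsTotalPart ν B'
  measurable : Measurable φ
  measurable_symm : Measurable φ.symm
  measure_image : ∀ T : Set B, IsTransversal ((↑) '' T : Set X) →
    ν ((↑) '' (φ '' T) : Set X') = μ ((↑) '' T : Set X)

/-- Homotopy through Borel and continuous maps. -/
def BTHomotopic {B : Type u} {B' : Type v} [TopologicalSpace B] [MeasurableSpace B]
    [TopologicalSpace B'] [MeasurableSpace B'] (f g : B → B') : Prop :=
  ∃ H : B × unitInterval → B', Continuous H ∧ Measurable H ∧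
    (∀ b, H (b, 0) = f b) ∧ ∀ b, H (b, 1) = g b

end Morphisms

end MeasuredFoliation

open Filter MeasureTheory

set_option linter.unusedSectionVars false

namespace MeasuredFoliation

/-! On each leaf, `π` is a map between lines which tends to the two ends at the two ends, hence is
homotopic to a homeomorphism. The point is to choose that homeomorphism in a Borel way from leaf to
leaf, without choosing an origin or an orientation of the leaves.

Parametrizations. Countably many prisms, made disjoint, put a length on the leaves (`leafMeasure`):
it has no atoms, is positive on nonempty Borel open sets and finite on plaques. Two paths
parametrized by length through the same point agree up to orientation (`LengthArc.rigid`), so every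
`x` is the origin of a maximal geodesic `geo x`, defined on an interval `dom x`; when the leaf is
not compact this is a bijection of `dom x` onto the leaf. The geodesic depends on `x` in a Borel way
because it can be followed by finitely many short jumps inside boxes (`chain_eq_geo`,
`exists_valid`). A half-leaf may have finite length, so `dom x` is stretched onto the line by a
formula compatible with changes of origin and with reflection (`stretch_translate`). The outcome is
`exists_isPseudoFlow`: a Borel parametrization of the noncompact leaves by the line, in which moving
the base point amounts to an isometry `q ↦ r ± q` of the line.

Straightening. In these coordinates, and up to a sign, `π` is a continuous `f : ℝ → ℝ` tending to
`±∞` at `±∞`. The mean of `sup {f < w}` and `inf {f > w}` increases strictly with `w`. Averaging it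
over `[v - 1, v + 1]` makes it continuous, and the inverse of the resulting homeomorphism is
`straighten f`. This construction commutes with the isometries of source and target, so it does not
depend on base points: it descends to a map `straightMap` of the foliations, and linear
interpolation descends to a homotopy from `π` (`IsLineMap.chart`). Since the fibres of `π` lie in
single leaves, `straightMap` is injective; its range is that of `π`, which is saturated.

Measures. The straightening is `π ∘ τ`, where `τ` moves points inside their leaves (`straightLift`).
For a transversal `T`, the set `τ(T)` is equivalent to `T` and is a section of `π` over the image of
`T`, so `π_* ν = ν'` says that the two measures are equal (`IsCollapse.measure_image`). A
transversal of `A'` that misses the range has the empty section, so the range is total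
(`IsCollapse.isTotalPart_range`). -/

/-- A one-dimensional prism in coordinates: `s` is the coordinate in `[-1, 1]`, and `E x c` is the
point with coordinate `c` of the plaque of `x` (with `c` clipped to `[-1, 1]`). -/
structure Box (X : Type*) [TopologicalSpace X] [MeasurableSpace X] where
  U : Set X
  s : X → ℝ
  E : X → ℝ → X
  isClosed : IsClosed U
  measurableSet : MeasurableSet U
  measurable_s : Measurable s
  measurable_E : Measurable (Function.uncurry E)
  s_mem : ∀ x ∈ U, s x ∈ Icc (-1 : ℝ) 1
  E_mem : ∀ x ∈ U, ∀ c, E x c ∈ U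
  E_s : ∀ x ∈ U, E x (s x) = x
  s_E : ∀ x ∈ U, ∀ c ∈ Icc (-1 : ℝ) 1, s (E x c) = c
  E_E : ∀ x ∈ U, ∀ c c', E (E x c) c' = E x c'
  continuous_E : ∀ x ∈ U, Continuous (E x)
  continuousOn_s : ContinuousOn s U
  plaque_open : ∀ x ∈ U, ∃ O, IsOpen O ∧ x ∈ O ∧ ∀ y ∈ O, y ∈ U → E y 0 = E x 0

/-! ### Coordinates on one-dimensional prisms -/

section Box

theorem euclidean_one_eq_single (v : EuclideanSpace ℝ (Fin 1)) : EuclideanSpace.single 0 (v 0) = v := by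
  ext i
  fin_cases i
  simp

theorem euclidean_one_norm (v : EuclideanSpace ℝ (Fin 1)) : ‖v‖ = |v 0| := by
  conv_lhs => rw [← euclidean_one_eq_single v]
  simp

/-- The point of the one-dimensional closed disc with a given coordinate, after clipping. -/
noncomputable def discPoint (c : ℝ) : Metric.closedBall (0 : EuclideanSpace ℝ (Fin 1)) 1 :=
  ⟨EuclideanSpace.single 0 (max (-1) (min c 1)), by
    rw [mem_closedBall_zero_iff]
    simp [abs_le]⟩

theorem continuous_discPoint : Continuous discPoint := by
  unfold discPoint
  refine Continuous.subtype_mk ?_ _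
  have h : Continuous fun c : ℝ => max (-1) (min c 1) := by fun_prop
  have h2 : Continuous fun c : ℝ => (EuclideanSpace.single 0 c : EuclideanSpace ℝ (Fin 1)) := by
    rw [Metric.continuous_iff]
    intro b ε hε
    refine ⟨ε, hε, fun a ha => ?_⟩
    simpa [PiLp.dist_single_same] using ha
  exact h2.comp h

theorem discPoint_coord (p : Metric.closedBall (0 : EuclideanSpace ℝ (Fin 1)) 1) :
    p.1 0 ∈ Icc (-1 : ℝ) 1 := by
  have := p.2
  rw [mem_closedBall_zero_iff, euclidean_one_norm, abs_le] at this
  exact this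

theorem coord_discPoint {c : ℝ} (hc : c ∈ Icc (-1 : ℝ) 1) : (discPoint c).1 0 = c := by
  simp [discPoint, hc.1, hc.2]

theorem discPoint_eq (p : Metric.closedBall (0 : EuclideanSpace ℝ (Fin 1)) 1) :
    discPoint (p.1 0) = p := by
  apply Subtype.ext
  have := discPoint_coord p
  rw [← euclidean_one_eq_single p.1]
  simp [discPoint, this.1, this.2]

open Classical in
theorem IsPrism.exists_box {X : Type*} [TopologicalSpace X] [MeasurableSpace X] {U : Set X}
    (hU : IsPrism 1 U) (hc : IsClosed U) (hm : MeasurableSet U) : ∃ b : Box X, b.U = U := by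
  obtain ⟨T, _, _, _, _, e, he, he'⟩ := hU
  -- Off `U` the values `0` and `x` are conventions that keep both functions total and Borel.
  let s : X → ℝ := fun x => if h : x ∈ U then (e ⟨x, h⟩).1.1 0 else 0
  let E : X → ℝ → X := fun x c => if h : x ∈ U then (e.symm (discPoint c, (e ⟨x, h⟩).2) : X) else x
  have hcoord : Continuous fun p : Metric.closedBall (0 : EuclideanSpace ℝ (Fin 1)) 1 × T =>
      p.1.1 0 := by fun_prop
  have s_eq : ∀ x (h : x ∈ U), s x = (e ⟨x, h⟩).1.1 0 := fun x h => dif_pos h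
  have E_eq : ∀ x (h : x ∈ U) c, E x c = (e.symm (discPoint c, (e ⟨x, h⟩).2) : X) :=
    fun x h c => dif_pos h
  have E_mem : ∀ x ∈ U, ∀ c, E x c ∈ U := fun x h c => by
    rw [E_eq x h]; exact Subtype.coe_prop _
  have e_E : ∀ x (h : x ∈ U) c (h' : E x c ∈ U), e ⟨E x c, h'⟩ = (discPoint c, (e ⟨x, h⟩).2) := by
    intro x h c h'
    have : (⟨E x c, h'⟩ : U) = e.symm (discPoint c, (e ⟨x, h⟩).2) := Subtype.ext (E_eq x h c)
    rw [this, Homeomorph.apply_symm_apply]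
  refine ⟨⟨U, s, E, hc, hm, ?_, ?_, ?_, E_mem, ?_, ?_, ?_, ?_, ?_, ?_⟩, rfl⟩
  · have hco : Measurable fun p : Metric.closedBall (0 : EuclideanSpace ℝ (Fin 1)) 1 × T =>
      p.1.1 0 := by fun_prop
    exact Measurable.dite (s := U) (f := fun x => (e x).1.1 0) (g := fun _ => 0) (hco.comp he)
      measurable_const hm
  · have hmU : MeasurableSet {p : X × ℝ | p.1 ∈ U} := measurable_fst hm
    have h1 : Measurable fun p : {p : X × ℝ // p.1 ∈ U} =>
        ((e.symm (discPoint p.1.2, (e ⟨p.1.1, p.2⟩).2) : U) : X) := by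
      refine measurable_subtype_coe.comp (he'.comp ?_)
      refine Measurable.prodMk (continuous_discPoint.measurable.comp
        (measurable_snd.comp measurable_subtype_coe)) ?_
      refine measurable_snd.comp (he.comp ?_)
      exact Measurable.subtype_mk (measurable_fst.comp measurable_subtype_coe)
    exact Measurable.dite (s := {p : X × ℝ | p.1 ∈ U}) h1
      (measurable_fst.comp measurable_subtype_coe) hmU
  · intro x hx
    rw [s_eq x hx]
    exact discPoint_coord _
  · intro x hx
    rw [E_eq x hx, s_eq x hx, discPoint_eq]
    simp
  · intro x hx c hc
    rw [s_eq _ (E_mem x hx c), e_E x hx]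
    exact coord_discPoint hc
  · intro x hx c c'
    rw [E_eq _ (E_mem x hx c), e_E x hx, E_eq x hx]
  · intro x hx
    have : E x = fun c => (e.symm (discPoint c, (e ⟨x, hx⟩).2) : X) := funext (E_eq x hx)
    rw [this]
    exact continuous_subtype_val.comp (e.symm.continuous.comp
      (continuous_discPoint.prodMk continuous_const))
  · rw [continuousOn_iff_continuous_domRestrict]
    have : U.domRestrict s = fun x : U => (e x).1.1 0 := funext fun x => s_eq x x.2
    rw [this]
    exact hcoord.comp e.continuous
  · intro x hx
    -- The vertical is discrete, so the index of the plaque is locally constant.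
    have ho : IsOpen {z : U | (e z).2 = (e ⟨x, hx⟩).2} := by
      have : {z : U | (e z).2 = (e ⟨x, hx⟩).2} = (fun z => (e z).2) ⁻¹' {(e ⟨x, hx⟩).2} := rfl
      rw [this]
      exact (isOpen_discrete _).preimage (continuous_snd.comp e.continuous)
    obtain ⟨O, hO, hO'⟩ := isOpen_induced_iff.1 ho
    refine ⟨O, hO, ?_, fun y hy hyU => ?_⟩
    · have : (⟨x, hx⟩ : U) ∈ Subtype.val ⁻¹' O := by rw [hO']; rfl
      exact this
    · have : (⟨y, hyU⟩ : U) ∈ Subtype.val ⁻¹' O := hy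
      rw [hO'] at this
      rw [E_eq y hyU, E_eq x hx]
      have h2 : (e ⟨y, hyU⟩).2 = (e ⟨x, hx⟩).2 := this
      rw [h2]

variable {X : Type*} [TopologicalSpace X] [MeasurableSpace X] (b : Box X)

/-- The plaque of a point of a box. -/
def Box.plaque (x : X) : Set X := {z | z ∈ b.U ∧ b.E z 0 = b.E x 0}

variable {b}

theorem Box.E_eq_of_mem_plaque {x z : X} (hx : x ∈ b.U) (hz : z ∈ b.plaque x) : b.E z = b.E x := by
  ext c
  rw [← b.E_E z hz.1 0 c, hz.2, b.E_E x hx]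

theorem Box.E_s_of_mem_plaque {x z : X} (hx : x ∈ b.U) (hz : z ∈ b.plaque x) : b.E x (b.s z) = z := by
  rw [← b.E_eq_of_mem_plaque hx hz, b.E_s z hz.1]

theorem Box.E_mem_plaque {x : X} (hx : x ∈ b.U) (c : ℝ) : b.E x c ∈ b.plaque x :=
  ⟨b.E_mem x hx c, b.E_E x hx c 0⟩

theorem Box.self_mem_plaque {x : X} (hx : x ∈ b.U) : x ∈ b.plaque x := ⟨hx, rfl⟩

theorem Box.plaque_eq_of_mem {x z : X} (hz : z ∈ b.plaque x) : b.plaque z = b.plaque x := by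
  ext w
  simp only [Box.plaque, mem_ofPred_eq, hz.2]

theorem Box.plaque_eq_image {x : X} (hx : x ∈ b.U) : b.plaque x = b.E x '' Icc (-1) 1 := by
  ext z
  constructor
  · intro hz
    exact ⟨b.s z, b.s_mem z hz.1, Box.E_s_of_mem_plaque hx hz⟩
  · rintro ⟨c, _, rfl⟩
    exact Box.E_mem_plaque hx c

theorem Box.injOn_E {x : X} (hx : x ∈ b.U) : InjOn (b.E x) (Icc (-1) 1) := by
  intro c hc d hd h
  rw [← b.s_E x hx c hc, ← b.s_E x hx d hd, h]

theorem Box.isCompact_plaque {x : X} (hx : x ∈ b.U) : IsCompact (b.plaque x) := by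
  rw [Box.plaque_eq_image hx]
  exact isCompact_Icc.image (b.continuous_E x hx)

theorem Box.isPreconnected_plaque {x : X} (hx : x ∈ b.U) : IsPreconnected (b.plaque x) := by
  rw [Box.plaque_eq_image hx]
  exact isPreconnected_Icc.image _ (b.continuous_E x hx).continuousOn

theorem Box.plaque_subset_leaf {x : X} (hx : x ∈ b.U) : b.plaque x ⊆ leaf x :=
  (Box.isPreconnected_plaque hx).subset_connectedComponent (Box.self_mem_plaque hx)

/-- The verticals carry the discrete topology: near an interior point, a box consists of a single
plaque. -/
theorem Box.plaque_mem_nhds {x : X} (hx : x ∈ interior b.U) : b.plaque x ∈ 𝓝 x := by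
  obtain ⟨O, hO, hxO, h⟩ := b.plaque_open x (interior_subset hx)
  filter_upwards [hO.mem_nhds hxO, isOpen_interior.mem_nhds hx] with y hy hy'
  exact ⟨interior_subset hy', h y hy (interior_subset hy')⟩

theorem Box.measurable_E_apply (c : ℝ) : Measurable fun x => b.E x c :=
  b.measurable_E.comp (measurable_id.prodMk measurable_const)

theorem Box.measurable_E_left (x : X) : Measurable (b.E x) :=
  b.measurable_E.comp (measurable_const.prodMk measurable_id)

theorem Box.measurableSet_plaque [StandardBorelSpace X] (x : X) : MeasurableSet (b.plaque x) :=
  b.measurableSet.inter (measurableSet_eq_fun (b.measurable_E_apply 0) measurable_const)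

end Box

/-! ### Box atlases, openness of leaves, separation -/

section Topology

theorem mem_leaf_self {X : Type*} [TopologicalSpace X] (x : X) : x ∈ leaf x := mem_connectedComponent

theorem leaf_eq {X : Type*} [TopologicalSpace X] {x y : X} (h : y ∈ leaf x) : leaf x = leaf y := connectedComponent_eq h

theorem mem_leaf_symm {X : Type*} [TopologicalSpace X] {x y : X} (h : y ∈ leaf x) : x ∈ leaf y := by
  rw [← leaf_eq h]; exact mem_leaf_self x

/-- An atlas of boxes on a one-dimensional foliation whose leaves are Hausdorff. -/
structure BoxAtlas (X : Type*) [TopologicalSpace X] [MeasurableSpace X] where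
  box : ℕ → Box X
  cover : ∀ x, ∃ i, x ∈ interior (box i).U
  locallyEuclidean : ∀ x : X,
    ∃ e : OpenPartialHomeomorph X (EuclideanSpace ℝ (Fin 1)), x ∈ e.source

theorem BorelFoliation.exists_boxAtlas (X : Type*) [TopologicalSpace X] [MeasurableSpace X]
    [h : BorelFoliation 1 X] : Nonempty (BoxAtlas X) := by
  obtain ⟨U, hU, hc⟩ := h.exists_atlas
  choose b hb using fun i => (hU i).2.2.exists_box (hU i).1 (hU i).2.1
  refine ⟨⟨b, fun x => ?_, h.locallyEuclidean⟩⟩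
  have : x ∈ ⋃ i, interior (U i) := by rw [hc]; trivial
  obtain ⟨i, hi⟩ := mem_iUnion.1 this
  exact ⟨i, by rwa [hb]⟩

variable {X : Type*} [TopologicalSpace X] [MeasurableSpace X]

/-- Each point has a plaque as a connected neighbourhood, and this plaque stays in the leaf. -/
theorem BoxAtlas.isOpen_leaf (𝒜 : BoxAtlas X) (x : X) : IsOpen (leaf x) := by
  rw [isOpen_iff_mem_nhds]
  intro y hy
  obtain ⟨i, hi⟩ := 𝒜.cover y
  refine mem_of_superset (Box.plaque_mem_nhds hi) ?_
  have : leaf x = leaf y := connectedComponent_eq hy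
  rw [this]
  exact Box.plaque_subset_leaf (interior_subset hi)

/-- Leaves are open: two points of one leaf are separated inside it, and points of different leaves
are separated by their leaves. -/
theorem BorelFoliation.t2Space (X : Type*) [TopologicalSpace X] [MeasurableSpace X]
    [h : BorelFoliation 1 X] : T2Space X := by
  obtain ⟨𝒜⟩ := BorelFoliation.exists_boxAtlas X
  refine ⟨fun x y hxy => ?_⟩
  by_cases hy : y ∈ leaf x
  · have := h.t2_leaf x
    obtain ⟨u, v, hu, hv, hxu, hyv, huv⟩ := t2_separation
      (show (⟨x, mem_leaf_self x⟩ : leaf x) ≠ ⟨y, hy⟩ from fun h => hxy (congrArg Subtype.val h))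
    have ho := (𝒜.isOpen_leaf x).isOpenEmbedding_subtypeVal
    refine ⟨_, _, ho.isOpenMap u hu, ho.isOpenMap v hv, ⟨_, hxu, rfl⟩, ⟨_, hyv, rfl⟩, ?_⟩
    exact (disjoint_image_iff Subtype.val_injective).2 huv
  · refine ⟨leaf x, leaf y, 𝒜.isOpen_leaf x, 𝒜.isOpen_leaf y, mem_leaf_self x, mem_leaf_self y, ?_⟩
    rw [Set.disjoint_left]
    intro z hz hz'
    apply hy
    rw [leaf_eq hz, ← leaf_eq hz']
    exact mem_leaf_self y

end Topology

/-! ### Invariance of domain in dimension one -/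

section Invariance

variable {X : Type*} [TopologicalSpace X] [MeasurableSpace X]

/-- A continuous injective map from an open interval to a one-dimensional manifold is open. -/
theorem BoxAtlas.image_Ioo_mem_nhds (𝒜 : BoxAtlas X) {f : ℝ → X} {a b t : ℝ} (ht : t ∈ Ioo a b)
    (hc : ContinuousOn f (Ioo a b)) (hi : InjOn f (Ioo a b)) : f '' Ioo a b ∈ 𝓝 (f t) := by
  obtain ⟨e, he⟩ := 𝒜.locallyEuclidean (f t)
  have hq : ContinuousOn (fun z => e z 0) e.source := by
    have h0 : Continuous fun v : EuclideanSpace ℝ (Fin 1) => v 0 := by fun_prop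
    exact h0.comp_continuousOn e.continuousOn
  have hqi : InjOn (fun z => e z 0) e.source := by
    intro z hz w hw h
    apply e.injOn hz hw
    rw [← euclidean_one_eq_single (e z), ← euclidean_one_eq_single (e w)]
    exact congrArg _ h
  have hfc : ContinuousAt f t := hc.continuousAt (Ioo_mem_nhds ht.1 ht.2)
  have hn : f ⁻¹' e.source ∩ Ioo a b ∈ 𝓝 t :=
    inter_mem (hfc (e.open_source.mem_nhds he)) (Ioo_mem_nhds ht.1 ht.2)
  obtain ⟨δ, hδ, hball⟩ := Metric.nhds_basis_closedBall.mem_iff.1 hn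
  rw [Real.closedBall_eq_Icc] at hball
  -- A manifold coordinate read along `f` is continuous and injective, hence strictly monotone, and
  -- intermediate values fill a neighbourhood. Leaving `q` arbitrary lets the decreasing case follow
  -- from the increasing one by a change of sign.
  have key : ∀ q : X → ℝ, ContinuousOn q e.source → InjOn q e.source →
      StrictMonoOn (fun r => q (f r)) (Icc (t - δ) (t + δ)) → f '' Ioo a b ∈ 𝓝 (f t) := by
    intro q hq hqi hm
    have hgc : ContinuousOn (fun r => q (f r)) (Icc (t - δ) (t + δ)) :=
      hq.comp (hc.mono fun r hr => (hball hr).2) fun r hr => (hball hr).1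
    have h1 : q (f (t - δ)) < q (f t) := hm ⟨le_rfl, by linarith⟩ ⟨by linarith, by linarith⟩ (by linarith)
    have h2 : q (f t) < q (f (t + δ)) := hm ⟨by linarith, by linarith⟩ ⟨by linarith, le_rfl⟩ (by linarith)
    have hqc : ContinuousAt q (f t) := hq.continuousAt (e.open_source.mem_nhds he)
    filter_upwards [e.open_source.mem_nhds he, hqc (Ioo_mem_nhds h1 h2)] with z hz hz2
    obtain ⟨r, hr, hrz⟩ := intermediate_value_Icc (by linarith) hgc (Ioo_subset_Icc_self hz2)
    exact ⟨r, (hball hr).2, hqi (hball hr).1 hz hrz⟩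
  rcases ContinuousOn.strictMonoOn_of_injOn_Icc' (f := fun r => e (f r) 0) (a := t - δ) (b := t + δ)
    (by linarith) (hq.comp (hc.mono fun r hr => (hball hr).2) fun r hr => (hball hr).1)
    (fun r hr r' hr' h => hi (hball hr).2 (hball hr').2 (hqi (hball hr).1 (hball hr').1 h)) with h | h
  · exact key _ hq hqi h
  · exact key (fun z => -(e z 0)) hq.neg (fun z hz w hw h => hqi hz hw (neg_injective h))
      fun r hr r' hr' hrr => neg_lt_neg (h hr hr' hrr)

theorem BoxAtlas.isOpen_image_Ioo (𝒜 : BoxAtlas X) {f : ℝ → X} {a b : ℝ}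
    (hc : ContinuousOn f (Ioo a b)) (hi : InjOn f (Ioo a b)) : IsOpen (f '' Ioo a b) := by
  rw [isOpen_iff_mem_nhds]
  rintro _ ⟨t, ht, rfl⟩
  exact 𝒜.image_Ioo_mem_nhds ht hc hi

theorem BoxAtlas.exists_param (𝒜 : BoxAtlas X) (x : X) : ∃ p : ℝ → X, ∃ η > 0, p 0 = x ∧
    ContinuousOn p (Ioo (-η) η) ∧ InjOn p (Ioo (-η) η) := by
  obtain ⟨e, he⟩ := 𝒜.locallyEuclidean x
  let j : ℝ → EuclideanSpace ℝ (Fin 1) := fun t => e x + EuclideanSpace.single 0 t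
  have hj : Continuous j := by
    refine continuous_const.add ?_
    rw [Metric.continuous_iff]
    intro b ε hε
    exact ⟨ε, hε, fun a ha => by simpa [PiLp.dist_single_same] using ha⟩
  have hj0 : j 0 = e x := by simp [j]
  have hn : j ⁻¹' e.target ∈ 𝓝 0 := hj.continuousAt (by
    rw [hj0]; exact e.open_target.mem_nhds (e.map_source he))
  obtain ⟨η, hη, hb⟩ := Metric.mem_nhds_iff.1 hn
  rw [Real.ball_eq_Ioo, zero_sub, zero_add] at hb
  refine ⟨fun t => e.symm (j t), η, hη, ?_, e.symm.continuousOn.comp hj.continuousOn hb, ?_⟩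
  · simp only [hj0]
    exact e.left_inv he
  · intro t ht t' ht' h
    have := e.symm.injOn (hb ht) (hb ht') h
    simpa [j] using congrArg (fun v : EuclideanSpace ℝ (Fin 1) => v 0) this

/-- The coordinate of a point in the interior of a box is not `±1`. -/
theorem BoxAtlas.s_mem_Ioo (𝒜 : BoxAtlas X) {b : Box X} {x : X} (hx : x ∈ interior b.U) :
    b.s x ∈ Ioo (-1 : ℝ) 1 := by
  obtain ⟨p, η, hη, hp0, hpc, hpi⟩ := 𝒜.exists_param x
  have hxU := interior_subset hx
  have hpl : p ⁻¹' b.plaque x ∈ 𝓝 0 := by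
    have : ContinuousAt p 0 := hpc.continuousAt (Ioo_mem_nhds (by linarith) hη)
    apply this
    rw [hp0]
    exact Box.plaque_mem_nhds hx
  obtain ⟨δ, hδ, hball⟩ := Metric.nhds_basis_closedBall.mem_iff.1
    (inter_mem hpl (Ioo_mem_nhds (neg_lt_zero.2 hη) hη))
  rw [Real.closedBall_eq_Icc, zero_sub, zero_add] at hball
  have hsc : ContinuousOn (fun t => b.s (p t)) (Icc (-δ) δ) :=
    b.continuousOn_s.comp (hpc.mono fun t ht => (hball ht).2) fun t ht => (hball ht).1.1
  have hsi : InjOn (fun t => b.s (p t)) (Icc (-δ) δ) := by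
    intro t ht t' ht' h
    apply hpi (hball ht).2 (hball ht').2
    rw [← Box.E_s_of_mem_plaque hxU (hball ht).1, ← Box.E_s_of_mem_plaque hxU (hball ht').1]
    exact congrArg _ h
  have m1 : -δ ∈ Icc (-δ) δ := ⟨le_rfl, by linarith⟩
  have m2 : δ ∈ Icc (-δ) δ := ⟨by linarith, le_rfl⟩
  have m0 : (0 : ℝ) ∈ Icc (-δ) δ := ⟨by linarith, by linarith⟩
  have r1 := b.s_mem _ (hball m1).1.1
  have r2 := b.s_mem _ (hball m2).1.1
  -- Read along a manifold chart centred at `x`, the box coordinate is strictly monotone on a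
  -- two-sided interval, so its value at the centre is not extremal.
  rcases ContinuousOn.strictMonoOn_of_injOn_Icc' (by linarith) hsc hsi with h | h
  · have h1 : b.s (p (-δ)) < b.s (p 0) := h m1 m0 (by linarith)
    have h2 : b.s (p 0) < b.s (p δ) := h m0 m2 (by linarith)
    rw [hp0] at h1 h2
    exact ⟨r1.1.trans_lt h1, h2.trans_le r2.2⟩
  · have h1 : b.s (p 0) < b.s (p (-δ)) := h m1 m0 (by linarith)
    have h2 : b.s (p δ) < b.s (p 0) := h m0 m2 (by linarith)
    rw [hp0] at h1 h2
    exact ⟨r2.1.trans_lt h2, h1.trans_le r1.2⟩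

theorem BoxAtlas.isOpen_E_image_Ioo (𝒜 : BoxAtlas X) {b : Box X} {x : X} (hx : x ∈ b.U) {u v : ℝ}
    (hu : -1 ≤ u) (hv : v ≤ 1) : IsOpen (b.E x '' Ioo u v) :=
  𝒜.isOpen_image_Ioo (b.continuous_E x hx).continuousOn
    ((Box.injOn_E hx).mono ((Ioo_subset_Ioo hu hv).trans Ioo_subset_Icc_self))

end Invariance

/-! ### The length of the leaves and the length coordinate of a plaque -/

section LeafMeasure

variable {X : Type*} [TopologicalSpace X] [MeasurableSpace X] (𝒜 : BoxAtlas X)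

/-- The boxes of an atlas, made disjoint. -/
def BoxAtlas.piece (i : ℕ) : Set X := {x | x ∈ (𝒜.box i).U ∧ ∀ j < i, x ∉ (𝒜.box j).U}

/-- The points with coordinate zero, which index the plaques of a box. -/
def Box.center (b : Box X) : Set X := {t | t ∈ b.U ∧ b.s t = 0}

variable {𝒜}

theorem BoxAtlas.measurableSet_piece (i : ℕ) : MeasurableSet (𝒜.piece i) := by
  have : 𝒜.piece i = (𝒜.box i).U ∩ ⋂ j, ⋂ (_ : j < i), ((𝒜.box j).U)ᶜ := by
    ext x; simp [BoxAtlas.piece]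
  rw [this]
  exact (𝒜.box i).measurableSet.inter
    (MeasurableSet.iInter fun j => MeasurableSet.iInter fun _ => (𝒜.box j).measurableSet.compl)

theorem Box.E_zero_mem_center {b : Box X} {x : X} (hx : x ∈ b.U) : b.E x 0 ∈ b.center :=
  ⟨b.E_mem x hx 0, b.s_E x hx 0 ⟨by norm_num, by norm_num⟩⟩

theorem Box.E_zero_of_mem_center {b : Box X} {t : X} (ht : t ∈ b.center) : b.E t 0 = t := by
  have := b.E_s t ht.1
  rwa [ht.2] at this

variable (𝒜) in
/-- The length measure carried by the leaves. -/
noncomputable def BoxAtlas.leafMeasure : Measure X :=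
  Measure.sum fun i => Measure.sum fun t : (𝒜.box i).center =>
    ((volume.restrict (Icc (-1 : ℝ) 1)).map ((𝒜.box i).E t)).restrict (𝒜.piece i)

theorem BoxAtlas.leafMeasure_apply {S : Set X} (hS : MeasurableSet S) :
    𝒜.leafMeasure S = ∑' i, ∑' t : (𝒜.box i).center,
      volume ((𝒜.box i).E t ⁻¹' (S ∩ 𝒜.piece i) ∩ Icc (-1 : ℝ) 1) := by
  rw [BoxAtlas.leafMeasure, Measure.sum_apply _ hS]
  congr 1; ext i
  rw [Measure.sum_apply _ hS]
  congr 1; ext t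
  have hm := (𝒜.box i).measurable_E_left (t : X)
  rw [Measure.restrict_apply hS, Measure.map_apply hm (hS.inter (𝒜.measurableSet_piece i)),
    Measure.restrict_apply (hm (hS.inter (𝒜.measurableSet_piece i)))]

theorem BoxAtlas.leafMeasure_singleton [StandardBorelSpace X] (z : X) : 𝒜.leafMeasure {z} = 0 := by
  rw [BoxAtlas.leafMeasure_apply (measurableSet_singleton z)]
  simp only [ENNReal.tsum_eq_zero]
  intro i t
  refine Set.Subsingleton.measure_zero ?_ _
  intro c hc d hd
  apply Box.injOn_E t.2.1 hc.2 hd.2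
  have h1 : (𝒜.box i).E t c = z := hc.1.1
  have h2 : (𝒜.box i).E t d = z := hd.1.1
  rw [h1, h2]

instance [StandardBorelSpace X] : NullSingletonClass 𝒜.leafMeasure := ⟨BoxAtlas.leafMeasure_singleton⟩

/-- In the first box that meets `O`, no earlier box removes anything from `O`, and an open set of
coordinates has positive Lebesgue measure. -/
theorem BoxAtlas.leafMeasure_pos {O : Set X} (hO : IsOpen O) (hm : MeasurableSet O)
    (hne : O.Nonempty) : 0 < 𝒜.leafMeasure O := by
  classical
  have hex : ∃ i, (O ∩ (𝒜.box i).U).Nonempty := by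
    obtain ⟨x, hx⟩ := hne
    obtain ⟨i, hi⟩ := 𝒜.cover x
    exact ⟨i, x, hx, interior_subset hi⟩
  set i := Nat.find hex with hi
  obtain ⟨z, hzO, hzU⟩ := Nat.find_spec hex
  rw [← hi] at hzU
  rw [BoxAtlas.leafMeasure_apply hm]
  have ht := Box.E_zero_mem_center hzU
  refine lt_of_lt_of_le ?_ ((ENNReal.le_tsum (⟨_, ht⟩ : (𝒜.box i).center)).trans (ENNReal.le_tsum i))
  have hE : (𝒜.box i).E ((𝒜.box i).E z 0) = (𝒜.box i).E z := funext fun c => (𝒜.box i).E_E z hzU 0 c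
  simp only [hE]
  have hV : IsOpen ((𝒜.box i).E z ⁻¹' O) := hO.preimage ((𝒜.box i).continuous_E z hzU)
  have hsz : (𝒜.box i).s z ∈ closure (Ioo (-1 : ℝ) 1) := by
    rw [closure_Ioo (by norm_num)]
    exact (𝒜.box i).s_mem z hzU
  have hW := mem_closure_iff.1 hsz _ hV (by
    rw [mem_preimage, (𝒜.box i).E_s z hzU]; exact hzO)
  refine ((hV.inter isOpen_Ioo).measure_pos volume hW).trans_le (measure_mono ?_)
  rintro c ⟨hc, hc'⟩
  refine ⟨⟨hc, (𝒜.box i).E_mem z hzU c, fun j hj hjU => ?_⟩, Ioo_subset_Icc_self hc'⟩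
  exact Nat.find_min hex hj ⟨_, hc, hjU⟩

/-- A box is closed and its plaque index is locally constant, so a compact set meets only finitely
many plaques. -/
theorem Box.finite_image_center {b : Box X} {K : Set X} (hK : IsCompact K) :
    ((fun z => b.E z 0) '' (K ∩ b.U)).Finite := by
  have hc : IsCompact (K ∩ b.U) := hK.inter_right b.isClosed
  have := hc.induction_on (p := fun S => ((fun z => b.E z 0) '' (S ∩ b.U)).Finite) (by simp)
    (fun s t hst h => h.subset (image_mono (inter_subset_inter_left _ hst)))
    (fun s t hs ht => by rw [union_inter_distrib_right, image_union]; exact hs.union ht)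
    (fun x hx => by
      obtain ⟨O, hO, hxO, h⟩ := b.plaque_open x hx.2
      refine ⟨O, mem_nhdsWithin_of_mem_nhds (hO.mem_nhds hxO), (finite_singleton (b.E x 0)).subset ?_⟩
      rintro _ ⟨y, hy, rfl⟩
      exact h y hy.1 hy.2)
  rwa [inter_assoc, inter_self] at this

/-- The pieces of index larger than `k` avoid the box `k`, and in each of the remaining boxes the
compact plaque meets finitely many plaques, each contributing at most `2`. -/
theorem BoxAtlas.leafMeasure_plaque_lt_top [StandardBorelSpace X] {k : ℕ} {z : X}
    (hz : z ∈ (𝒜.box k).U) : 𝒜.leafMeasure ((𝒜.box k).plaque z) < ⊤ := by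
  rw [BoxAtlas.leafMeasure_apply (Box.measurableSet_plaque z)]
  rw [tsum_eq_sum (s := Finset.range (k + 1)) ?_]
  · refine ENNReal.sum_lt_top.2 fun i _ => ?_
    have hfin : {t : (𝒜.box i).center | ∃ c, (𝒜.box i).E t c ∈ (𝒜.box k).plaque z}.Finite := by
      refine Finite.of_finite_image (f := Subtype.val) ?_ Subtype.val_injective.injOn
      refine (Box.finite_image_center (b := 𝒜.box i) (Box.isCompact_plaque hz)).subset ?_
      rintro _ ⟨t, ⟨c, hc⟩, rfl⟩
      refine ⟨_, ⟨hc, (𝒜.box i).E_mem t t.2.1 c⟩, ?_⟩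
      simp only [(𝒜.box i).E_E t t.2.1]
      exact Box.E_zero_of_mem_center t.2
    rw [tsum_eq_sum (s := hfin.toFinset) ?_]
    · refine ENNReal.sum_lt_top.2 fun t _ => ?_
      exact (measure_mono inter_subset_right).trans_lt (by simp)
    · intro t ht
      have : (𝒜.box i).E t ⁻¹' ((𝒜.box k).plaque z ∩ 𝒜.piece i) ∩ Icc (-1 : ℝ) 1 = ∅ := by
        rw [eq_empty_iff_forall_notMem]
        intro c hc
        apply ht
        simp only [Finite.mem_toFinset]
        exact ⟨c, hc.1.1⟩
      rw [this, measure_empty]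
  · intro i hi
    simp only [ENNReal.tsum_eq_zero]
    intro t
    have : (𝒜.box i).E t ⁻¹' ((𝒜.box k).plaque z ∩ 𝒜.piece i) ∩ Icc (-1 : ℝ) 1 = ∅ := by
      rw [eq_empty_iff_forall_notMem]
      intro c hc
      refine hc.1.2.2 k ?_ hc.1.1.1
      simpa using hi
    rw [this, measure_empty]

variable (𝒜) in
/-- The length of the part of the plaque of `z` on which the coordinate is at most that of `z`. -/
noncomputable def BoxAtlas.coord (i : ℕ) (z : X) : ℝ :=
  (𝒜.leafMeasure {w | w ∈ (𝒜.box i).plaque z ∧ (𝒜.box i).s w ≤ (𝒜.box i).s z}).toReal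

theorem BoxAtlas.coord_eq {i : ℕ} {z w : X} (hw : w ∈ (𝒜.box i).plaque z) : 𝒜.coord i w =
    (𝒜.leafMeasure {v | v ∈ (𝒜.box i).plaque z ∧ (𝒜.box i).s v ∈ Iic ((𝒜.box i).s w)}).toReal := by
  rw [BoxAtlas.coord, Box.plaque_eq_of_mem hw]; rfl

variable [StandardBorelSpace X] {i : ℕ} {z : X}

variable (𝒜) in
theorem BoxAtlas.measurableSet_seg (i : ℕ) (z : X) {S : Set ℝ} (hS : MeasurableSet S) :
    MeasurableSet {w | w ∈ (𝒜.box i).plaque z ∧ (𝒜.box i).s w ∈ S} :=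
  (Box.measurableSet_plaque z).inter ((𝒜.box i).measurable_s hS)

theorem BoxAtlas.leafMeasure_seg_ne_top (hz : z ∈ (𝒜.box i).U) (S : Set ℝ) :
    𝒜.leafMeasure {w | w ∈ (𝒜.box i).plaque z ∧ (𝒜.box i).s w ∈ S} ≠ ⊤ :=
  ((measure_mono fun _ hw => hw.1).trans_lt (BoxAtlas.leafMeasure_plaque_lt_top hz)).ne

theorem BoxAtlas.leafMeasure_Icc (hz : z ∈ (𝒜.box i).U) {w w' : X} (hw : w ∈ (𝒜.box i).plaque z)
    (hw' : w' ∈ (𝒜.box i).plaque z) (h : (𝒜.box i).s w ≤ (𝒜.box i).s w') :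
    𝒜.leafMeasure {v | v ∈ (𝒜.box i).plaque z ∧
      (𝒜.box i).s v ∈ Icc ((𝒜.box i).s w) ((𝒜.box i).s w')} =
      ENNReal.ofReal (𝒜.coord i w' - 𝒜.coord i w) := by
  set b := 𝒜.box i
  have h0 : 𝒜.leafMeasure {v | v ∈ b.plaque z ∧ b.s v ∈ Icc (b.s w) (b.s w')} =
      𝒜.leafMeasure {v | v ∈ b.plaque z ∧ b.s v ∈ Ioc (b.s w) (b.s w')} := by
    apply le_antisymm
    · have : {v | v ∈ b.plaque z ∧ b.s v ∈ Icc (b.s w) (b.s w')} ⊆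
          {v | v ∈ b.plaque z ∧ b.s v ∈ Ioc (b.s w) (b.s w')} ∪ {w} := by
        rintro v ⟨hv, hv'⟩
        rcases eq_or_lt_of_le hv'.1 with h | h
        · right
          rw [mem_singleton_iff, ← Box.E_s_of_mem_plaque hz hv, ← h, Box.E_s_of_mem_plaque hz hw]
        · left; exact ⟨hv, h, hv'.2⟩
      refine (measure_mono this).trans ((measure_union_le _ _).trans ?_)
      rw [measure_singleton, add_zero]
    · exact measure_mono fun v hv => ⟨hv.1, Ioc_subset_Icc_self hv.2⟩
  have h1 : 𝒜.leafMeasure {v | v ∈ b.plaque z ∧ b.s v ∈ Iic (b.s w')} =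
      𝒜.leafMeasure {v | v ∈ b.plaque z ∧ b.s v ∈ Iic (b.s w)} +
      𝒜.leafMeasure {v | v ∈ b.plaque z ∧ b.s v ∈ Ioc (b.s w) (b.s w')} := by
    rw [← measure_union]
    · congr 1
      ext v
      constructor
      · rintro ⟨hv, hv'⟩
        rcases le_or_gt (b.s v) (b.s w) with h | h
        · exact Or.inl ⟨hv, h⟩
        · exact Or.inr ⟨hv, h, hv'⟩
      · rintro (⟨hv, hv'⟩ | ⟨hv, hv'⟩)
        · exact ⟨hv, le_trans hv' h⟩
        · exact ⟨hv, hv'.2⟩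
    · rw [Set.disjoint_left]
      rintro v ⟨_, hv⟩ ⟨_, hv'⟩
      exact absurd hv (not_le.2 hv'.1)
    · exact 𝒜.measurableSet_seg i z measurableSet_Ioc
  have ht := BoxAtlas.leafMeasure_seg_ne_top (𝒜 := 𝒜) hz
  rw [h0, BoxAtlas.coord_eq hw, BoxAtlas.coord_eq hw', h1, ENNReal.toReal_add (ht _) (ht _),
    add_sub_cancel_left, ENNReal.ofReal_toReal (ht _)]

/-- The open arc between the two points is open in the leaf topology, so its length is positive. -/
theorem BoxAtlas.coord_lt (hz : z ∈ (𝒜.box i).U) {w w' : X} (hw : w ∈ (𝒜.box i).plaque z)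
    (hw' : w' ∈ (𝒜.box i).plaque z) (h : (𝒜.box i).s w < (𝒜.box i).s w') :
    𝒜.coord i w < 𝒜.coord i w' := by
  set b := 𝒜.box i
  have h1 := BoxAtlas.leafMeasure_Icc hz hw hw' h.le
  rw [← sub_pos, ← ENNReal.ofReal_pos, ← h1]
  have hsw := b.s_mem w hw.1
  have hsw' := b.s_mem w' hw'.1
  have hsub : Ioo (b.s w) (b.s w') ⊆ Icc (-1) 1 :=
    (Ioo_subset_Ioo hsw.1 hsw'.2).trans Ioo_subset_Icc_self
  have hset : b.E z '' Ioo (b.s w) (b.s w') = {v | v ∈ b.plaque z ∧ b.s v ∈ Ioo (b.s w) (b.s w')} := by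
    ext v
    constructor
    · rintro ⟨c, hc, rfl⟩
      exact ⟨Box.E_mem_plaque hz c, by rwa [b.s_E z hz c (hsub hc)]⟩
    · rintro ⟨hv, hv'⟩
      exact ⟨b.s v, hv', Box.E_s_of_mem_plaque hz hv⟩
  have hpos := BoxAtlas.leafMeasure_pos (𝒜 := 𝒜) (𝒜.isOpen_E_image_Ioo hz hsw.1 hsw'.2)
    (by rw [hset]; exact 𝒜.measurableSet_seg i z measurableSet_Ioo) ((nonempty_Ioo.2 h).image _)
  rw [hset] at hpos
  exact hpos.trans_le (measure_mono fun v hv => ⟨hv.1, Ioo_subset_Icc_self hv.2⟩)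

theorem BoxAtlas.coord_lt_iff (hz : z ∈ (𝒜.box i).U) {w w' : X} (hw : w ∈ (𝒜.box i).plaque z)
    (hw' : w' ∈ (𝒜.box i).plaque z) :
    𝒜.coord i w < 𝒜.coord i w' ↔ (𝒜.box i).s w < (𝒜.box i).s w' := by
  refine ⟨fun h => ?_, BoxAtlas.coord_lt hz hw hw'⟩
  by_contra hn
  rcases eq_or_lt_of_le (not_lt.1 hn) with h' | h'
  · have : w = w' := by
      rw [← Box.E_s_of_mem_plaque hz hw, ← h', Box.E_s_of_mem_plaque hz hw']
    exact absurd h (by rw [this]; exact lt_irrefl _)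
  · exact absurd h (BoxAtlas.coord_lt hz hw' hw h').le.not_gt

theorem BoxAtlas.coord_injOn (hz : z ∈ (𝒜.box i).U) : InjOn (𝒜.coord i) ((𝒜.box i).plaque z) := by
  intro w hw w' hw' h
  have h1 := (BoxAtlas.coord_lt_iff hz hw hw').not.1 h.not_lt
  have h2 := (BoxAtlas.coord_lt_iff hz hw' hw).not.1 h.not_gt
  rw [← Box.E_s_of_mem_plaque hz hw, le_antisymm (not_lt.1 h2) (not_lt.1 h1),
    Box.E_s_of_mem_plaque hz hw']

/-- Pushing the length of the plaque to the line by `s` gives a finite measure without atoms, of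
which `coord` is the distribution function. -/
theorem BoxAtlas.continuousOn_coord_E (hz : z ∈ (𝒜.box i).U) :
    ContinuousOn (fun c => 𝒜.coord i ((𝒜.box i).E z c)) (Icc (-1) 1) := by
  set b := 𝒜.box i
  let m : Measure ℝ := (𝒜.leafMeasure.restrict (b.plaque z)).map b.s
  have hm : ∀ S, MeasurableSet S → m S = 𝒜.leafMeasure {v | v ∈ b.plaque z ∧ b.s v ∈ S} := by
    intro S hS
    rw [Measure.map_apply b.measurable_s hS, Measure.restrict_apply (b.measurable_s hS), inter_comm]
    rfl
  have hfin : IsFiniteMeasure m :=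
    ⟨by rw [hm _ MeasurableSet.univ]; exact lt_top_iff_ne_top.2 (BoxAtlas.leafMeasure_seg_ne_top hz _)⟩
  have hsing : ∀ c, {v | v ∈ b.plaque z ∧ b.s v ∈ ({c} : Set ℝ)} ⊆ {b.E z c} := by
    rintro c v ⟨hv, hv'⟩
    rw [mem_singleton_iff] at hv' ⊢
    rw [← hv', Box.E_s_of_mem_plaque hz hv]
  have hna : NullSingletonClass m := ⟨fun c => by
    rw [hm _ (measurableSet_singleton c)]
    exact measure_mono_null (hsing c) (measure_singleton _)⟩
  have hcont : Continuous fun c => ∫ _ in (-1 : ℝ)..c, (1 : ℝ) ∂m :=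
    intervalIntegral.continuous_primitive (fun _ _ => intervalIntegrable_const) _
  refine hcont.continuousOn.congr fun c hc => ?_
  simp only
  rw [BoxAtlas.coord_eq (Box.E_mem_plaque hz c), b.s_E z hz c hc, ← hm _ measurableSet_Iic,
    intervalIntegral.integral_of_le hc.1]
  simp only [integral_const, smul_eq_mul, mul_one, Measure.real,
    Measure.restrict_apply_univ]
  congr 1
  apply le_antisymm
  · have : Iic c ⊆ Iio (-1) ∪ ({-1} ∪ Ioc (-1) c) := by
      intro r hr
      rcases lt_trichotomy r (-1) with h | h | h
      · left; exact h
      · right; left; exact h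
      · right; right; exact ⟨h, hr⟩
    refine (measure_mono this).trans ((measure_union_le _ _).trans ?_)
    have h0 : m (Iio (-1)) = 0 := by
      rw [hm _ measurableSet_Iio]
      refine measure_mono_null (t := ∅) ?_ measure_empty
      rintro v ⟨hv, hv'⟩
      exact absurd (b.s_mem v hv.1).1 (not_le.2 hv')
    rw [h0, zero_add]
    refine (measure_union_le _ _).trans ?_
    rw [measure_singleton, zero_add]
  · exact measure_mono fun r hr => hr.2

end LeafMeasure

/-! ### Borel functions and Borel graphs -/

section Graph

/-- A function between standard Borel spaces is Borel if its graph is. -/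
theorem measurable_of_measurableSet_graph {Z W : Type*} [MeasurableSpace Z] [StandardBorelSpace Z]
    [MeasurableSpace W] [StandardBorelSpace W] {f : Z → W}
    (h : MeasurableSet {p : Z × W | f p.1 = p.2}) : Measurable f := by
  intro C hC
  have : f ⁻¹' C = Prod.fst '' ({p : Z × W | f p.1 = p.2} ∩ Prod.snd ⁻¹' C) := by
    ext z
    constructor
    · intro hz
      exact ⟨(z, f z), ⟨rfl, hz⟩, rfl⟩
    · rintro ⟨⟨z', w⟩, ⟨h1, h2⟩, rfl⟩
      have h1' : f z' = w := h1
      change f z' ∈ C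
      rw [h1']; exact h2
  rw [this]
  -- Lusin–Souslin: the first projection is injective on the graph.
  refine (h.inter (measurable_snd hC)).image_of_measurable_injOn measurable_fst ?_
  rintro ⟨z, w⟩ ⟨h1, _⟩ ⟨z', w'⟩ ⟨h2, _⟩ (h3 : z = z')
  have h1' : f z = w := h1
  have h2' : f z' = w' := h2
  rw [← h1', ← h2', h3]

end Graph

/-! ### Borel dependence of the length coordinate and of the length charts -/

section Coord

variable {X : Type*} [TopologicalSpace X] [MeasurableSpace X] [StandardBorelSpace X]
  {𝒜 : BoxAtlas X}

/-- `y` is a point whose plaque for `b` is not the plaque of an earlier term of the sequence. -/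
def Box.Fresh (b : Box X) (p : ℕ → X) (n : ℕ) : Prop :=
  p n ∈ b.U ∧ ∀ m < n, ¬ (p m ∈ b.U ∧ b.E (p m) 0 = b.E (p n) 0)

open Classical in
-- The set of all plaques of a box is uncountable in general, which hides the Borel dependence on
-- `z`. Only plaques sharing an open arc with the plaque of `z` contribute, and a dense sequence of
-- that plaque finds them all; each is counted at its first visit.
theorem BoxAtlas.tsum_center_eq {i j : ℕ} {z : X} (hz : z ∈ (𝒜.box i).U) {S : Set X}
    (hS : S ⊆ (𝒜.box i).plaque z) (p : ℕ → X)
    (hp : p = fun n => (𝒜.box i).E z (TopologicalSpace.denseSeq ℝ n)) :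
    ∑' t : (𝒜.box j).center, volume ((𝒜.box j).E t ⁻¹' S ∩ Icc (-1 : ℝ) 1) =
    ∑' n, if (𝒜.box j).Fresh p n then volume ((𝒜.box j).E (p n) ⁻¹' S ∩ Icc (-1 : ℝ) 1) else 0 := by
  set b := 𝒜.box j
  have key : ∀ t : b.center, volume (b.E t ⁻¹' S ∩ Icc (-1 : ℝ) 1) ≠ 0 →
      -- Two endpoints have measure zero, so a contributing plaque meets `S` at a point of its open
      -- arc, and this arc is reached by the dense sequence.
      ∃ n, p n ∈ b.U ∧ b.E (p n) 0 = t := by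
    intro t ht
    have hne : (b.E t ⁻¹' S ∩ Ioo (-1 : ℝ) 1).Nonempty := by
      by_contra hn
      rw [not_nonempty_iff_eq_empty] at hn
      apply ht
      refine measure_mono_null (t := {-1, 1}) ?_ ((Set.toFinite _).measure_zero _)
      rintro c ⟨hc, hc'⟩
      by_contra hcc
      simp only [mem_insert_iff, mem_singleton_iff, not_or] at hcc
      have : c ∈ b.E t ⁻¹' S ∩ Ioo (-1 : ℝ) 1 :=
        ⟨hc, lt_of_le_of_ne hc'.1 (Ne.symm hcc.1), lt_of_le_of_ne hc'.2 hcc.2⟩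
      rw [hn] at this
      exact this
    obtain ⟨c, hc, hc'⟩ := hne
    have hO := 𝒜.isOpen_E_image_Ioo t.2.1 (b := b) (le_refl (-1)) (le_refl 1)
    have hV := hO.preimage ((𝒜.box i).continuous_E z hz)
    obtain ⟨_, hr, n, rfl⟩ := (TopologicalSpace.denseRange_denseSeq ℝ).exists_mem_open hV
      ⟨(𝒜.box i).s (b.E t c), by
        rw [mem_preimage, Box.E_s_of_mem_plaque hz (hS hc)]; exact ⟨c, hc', rfl⟩⟩ |>.elim
        (fun n h => (⟨_, h, n, rfl⟩ : ∃ r, r ∈ (𝒜.box i).E z ⁻¹' (b.E t '' Ioo (-1) 1) ∧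
          ∃ n, TopologicalSpace.denseSeq ℝ n = r))
    obtain ⟨d, _, hd⟩ := hr
    refine ⟨n, ?_, ?_⟩
    · rw [hp]; simp only; rw [← hd]; exact b.E_mem t t.2.1 d
    · rw [hp]; simp only; rw [← hd, b.E_E t t.2.1]; exact Box.E_zero_of_mem_center t.2
  have hE : ∀ n (h : p n ∈ b.U), b.E (b.E (p n) 0) = b.E (p n) :=
    fun n h => funext fun c => b.E_E _ h 0 c
  set g : ℕ → ℝ≥0∞ := fun n =>
    if b.Fresh p n then volume (b.E (p n) ⁻¹' S ∩ Icc (-1 : ℝ) 1) else 0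
  have hg : ∀ n, n ∈ Function.support g → b.Fresh p n := by
    intro n hn
    by_contra h
    exact hn (if_neg h)
  refine tsum_eq_tsum_of_ne_zero_bij (g := g)
    (fun n => (⟨b.E (p n) 0, Box.E_zero_mem_center (hg n n.2).1⟩ : b.center)) ?_ ?_ ?_
  · intro n m h
    have h' : b.E (p n) 0 = b.E (p m) 0 := congrArg Subtype.val h
    rcases lt_trichotomy n.1 m.1 with hlt | heq | hlt
    · exact absurd ⟨(hg n n.2).1, h'⟩ ((hg m m.2).2 _ hlt)
    · exact Subtype.ext heq
    · exact absurd ⟨(hg m m.2).1, h'.symm⟩ ((hg n n.2).2 _ hlt)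
  · intro t ht
    have hex := key t ht
    obtain ⟨h1, h2⟩ := Nat.find_spec hex
    have hfresh : b.Fresh p (Nat.find hex) :=
      ⟨h1, fun m hm h => Nat.find_min hex hm ⟨h.1, h.2.trans h2⟩⟩
    refine ⟨⟨Nat.find hex, ?_⟩, Subtype.ext h2⟩
    rw [Function.mem_support]
    simp only [g, if_pos hfresh]
    rw [← hE _ h1, h2]
    exact ht
  · intro n
    simp only [g, if_pos (hg n n.2), hE _ (hg n n.2).1]

open Classical in
-- Each term of the countable sum of `tsum_center_eq` is the Lebesgue measure of a section of a
-- Borel subset of `X × ℝ`.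
theorem BoxAtlas.measurable_indicator_coord (i : ℕ) :
    Measurable ((𝒜.box i).U.indicator (𝒜.coord i)) := by
  let a := 𝒜.box i
  let p : X → ℕ → X := fun z n => a.E z (TopologicalSpace.denseSeq ℝ n)
  have hpm : ∀ n, Measurable fun z => p z n := fun n => a.measurable_E_apply _
  let S : X → Set X := fun z => {w | w ∈ a.plaque z ∧ a.s w ≤ a.s z}
  let F : X → ℝ≥0∞ := fun z => ∑' j, ∑' n, if (𝒜.box j).Fresh (p z) n then
    volume ((𝒜.box j).E (p z n) ⁻¹' (S z ∩ 𝒜.piece j) ∩ Icc (-1 : ℝ) 1) else 0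
  have hF : Measurable F := by
    refine Measurable.tsum fun j => Measurable.tsum fun n => ?_
    have hfresh : MeasurableSet {z | (𝒜.box j).Fresh (p z) n} := by
      have : {z | (𝒜.box j).Fresh (p z) n} = (fun z => p z n) ⁻¹' (𝒜.box j).U ∩
          ⋂ m, ⋂ (_ : m < n), ((fun z => p z m) ⁻¹' (𝒜.box j).U ∩
            {z | (𝒜.box j).E (p z m) 0 = (𝒜.box j).E (p z n) 0})ᶜ := by
        ext z; simp [Box.Fresh]
      rw [this]
      refine ((hpm n) (𝒜.box j).measurableSet).inter (MeasurableSet.iInter fun m =>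
        MeasurableSet.iInter fun _ => (((hpm m) (𝒜.box j).measurableSet).inter ?_).compl)
      exact measurableSet_eq_fun (((𝒜.box j).measurable_E_apply 0).comp (hpm m))
        (((𝒜.box j).measurable_E_apply 0).comp (hpm n))
    refine Measurable.ite hfresh ?_ measurable_const
    have hq : Measurable fun q : X × ℝ => (𝒜.box j).E (p q.1 n) q.2 :=
      (𝒜.box j).measurable_E.comp (((hpm n).comp measurable_fst).prodMk measurable_snd)
    have hset : MeasurableSet {q : X × ℝ | ((((𝒜.box j).E (p q.1 n) q.2 ∈ a.U ∧
        a.E ((𝒜.box j).E (p q.1 n) q.2) 0 = a.E q.1 0) ∧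
        a.s ((𝒜.box j).E (p q.1 n) q.2) ≤ a.s q.1) ∧
        (𝒜.box j).E (p q.1 n) q.2 ∈ 𝒜.piece j) ∧ q.2 ∈ Icc (-1 : ℝ) 1} := by
      refine (((MeasurableSet.inter (hq a.measurableSet) ?_).inter ?_).inter
        (hq (𝒜.measurableSet_piece j))).inter (measurable_snd measurableSet_Icc)
      · exact measurableSet_eq_fun ((a.measurable_E_apply 0).comp hq)
          ((a.measurable_E_apply 0).comp measurable_fst)
      · exact measurableSet_le (a.measurable_s.comp hq) (a.measurable_s.comp measurable_fst)
    exact measurable_measure_prodMk_left (ν := volume) hset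
  have : a.U.indicator (𝒜.coord i) = a.U.indicator fun z => (F z).toReal := by
    ext z
    by_cases hz : z ∈ a.U
    · rw [indicator_of_mem hz, indicator_of_mem hz,
        BoxAtlas.coord_eq (Box.self_mem_plaque hz),
        BoxAtlas.leafMeasure_apply (𝒜.measurableSet_seg i z measurableSet_Iic)]
      congr 2
      ext j
      exact BoxAtlas.tsum_center_eq hz (fun w hw => hw.1.1) (p z) rfl
    · rw [indicator_of_notMem hz, indicator_of_notMem hz]
  rw [this]
  exact hF.ennreal_toReal.indicator a.measurableSet

theorem BoxAtlas.coord_E_neg_one {i : ℕ} {z : X} (hz : z ∈ (𝒜.box i).U) :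
    𝒜.coord i ((𝒜.box i).E z (-1)) = 0 := by
  rw [BoxAtlas.coord_eq (Box.E_mem_plaque hz (-1)),
    (𝒜.box i).s_E z hz (-1) ⟨le_rfl, by norm_num⟩]
  rw [measure_mono_null (t := {(𝒜.box i).E z (-1)}) ?_ (measure_singleton _), ENNReal.toReal_zero]
  rintro w ⟨hw, hw'⟩
  have : (𝒜.box i).s w = -1 := le_antisymm hw' ((𝒜.box i).s_mem w hw.1).1
  rw [mem_singleton_iff, ← this, Box.E_s_of_mem_plaque hz hw]

open Classical in
variable (𝒜) in
/-- The distance of a point to the ends of its plaque. -/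
noncomputable def BoxAtlas.radius (i : ℕ) (z : X) : ℝ :=
  if z ∈ (𝒜.box i).U then
    min (𝒜.coord i z) (𝒜.coord i ((𝒜.box i).E z 1) - 𝒜.coord i z) else 0

theorem BoxAtlas.mem_of_radius_pos {i : ℕ} {z : X} (h : 0 < 𝒜.radius i z) : z ∈ (𝒜.box i).U := by
  by_contra hn
  rw [BoxAtlas.radius, if_neg hn] at h
  exact lt_irrefl _ h

theorem BoxAtlas.radius_eq {i : ℕ} {z : X} (hz : z ∈ (𝒜.box i).U) : 𝒜.radius i z =
    min (𝒜.coord i z) (𝒜.coord i ((𝒜.box i).E z 1) - 𝒜.coord i z) := if_pos hz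

theorem BoxAtlas.exists_radius_pos (z : X) : ∃ i, 0 < 𝒜.radius i z := by
  obtain ⟨i, hi⟩ := 𝒜.cover z
  have hz := interior_subset hi
  have hs := 𝒜.s_mem_Ioo hi
  refine ⟨i, ?_⟩
  rw [BoxAtlas.radius_eq hz, lt_min_iff, sub_pos, ← BoxAtlas.coord_E_neg_one hz]
  constructor
  · apply BoxAtlas.coord_lt hz (Box.E_mem_plaque hz _) (Box.self_mem_plaque hz)
    rw [(𝒜.box i).s_E z hz _ ⟨le_rfl, by norm_num⟩]
    exact hs.1
  · apply BoxAtlas.coord_lt hz (Box.self_mem_plaque hz) (Box.E_mem_plaque hz _)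
    rw [(𝒜.box i).s_E z hz _ ⟨by norm_num, le_rfl⟩]
    exact hs.2

theorem BoxAtlas.measurable_radius (i : ℕ) : Measurable (𝒜.radius i) := by
  have h := BoxAtlas.measurable_indicator_coord (𝒜 := 𝒜) i
  have : 𝒜.radius i = (𝒜.box i).U.indicator fun z => min ((𝒜.box i).U.indicator (𝒜.coord i) z)
      ((𝒜.box i).U.indicator (𝒜.coord i) ((𝒜.box i).E z 1) -
        (𝒜.box i).U.indicator (𝒜.coord i) z) := by
    ext z
    by_cases hz : z ∈ (𝒜.box i).U
    · rw [BoxAtlas.radius_eq hz, indicator_of_mem hz, indicator_of_mem hz,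
        indicator_of_mem ((𝒜.box i).E_mem z hz 1)]
    · rw [BoxAtlas.radius, if_neg hz, indicator_of_notMem hz]
  rw [this]
  refine Measurable.indicator ?_ (𝒜.box i).measurableSet
  exact h.min ((h.comp ((𝒜.box i).measurable_E_apply 1)).sub h)

theorem BoxAtlas.exists_chart {i : ℕ} {z : X} {τ : ℝ} (h : |τ| < 𝒜.radius i z) :
    ∃ w ∈ (𝒜.box i).plaque z, 𝒜.coord i w = 𝒜.coord i z + τ := by
  have hz := BoxAtlas.mem_of_radius_pos ((abs_nonneg τ).trans_lt h)
  rw [BoxAtlas.radius_eq hz, lt_min_iff, abs_lt, abs_lt] at h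
  obtain ⟨c, hc, hc'⟩ := intermediate_value_Icc (by norm_num : (-1 : ℝ) ≤ 1)
    (BoxAtlas.continuousOn_coord_E hz)
    (show 𝒜.coord i z + τ ∈ _ by
      rw [BoxAtlas.coord_E_neg_one hz]
      exact ⟨by linarith [h.1.1], by linarith [h.2.2]⟩)
  exact ⟨_, Box.E_mem_plaque hz c, hc'⟩

open Classical in
variable (𝒜) in
/-- The parametrization by length of the plaque of `z`, starting at `z`. -/
noncomputable def BoxAtlas.chart (i : ℕ) (z : X) (τ : ℝ) : X :=
  if h : |τ| < 𝒜.radius i z then (BoxAtlas.exists_chart h).choose else z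

theorem BoxAtlas.chart_mem {i : ℕ} {z : X} {τ : ℝ} (h : |τ| < 𝒜.radius i z) :
    𝒜.chart i z τ ∈ (𝒜.box i).plaque z := by
  rw [BoxAtlas.chart, dif_pos h]
  exact (BoxAtlas.exists_chart h).choose_spec.1

theorem BoxAtlas.coord_chart {i : ℕ} {z : X} {τ : ℝ} (h : |τ| < 𝒜.radius i z) :
    𝒜.coord i (𝒜.chart i z τ) = 𝒜.coord i z + τ := by
  rw [BoxAtlas.chart, dif_pos h]
  exact (BoxAtlas.exists_chart h).choose_spec.2

theorem BoxAtlas.chart_eq {i : ℕ} {z w : X} {τ : ℝ} (h : |τ| < 𝒜.radius i z)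
    (hw : w ∈ (𝒜.box i).plaque z) (hτ : 𝒜.coord i w = 𝒜.coord i z + τ) : 𝒜.chart i z τ = w :=
  BoxAtlas.coord_injOn (BoxAtlas.mem_of_radius_pos ((abs_nonneg τ).trans_lt h))
    (BoxAtlas.chart_mem h) hw ((BoxAtlas.coord_chart h).trans hτ.symm)

/-- The choice in `chart` does no harm: length determines a point of a plaque, so the graph is cut
out by Borel conditions. -/
theorem BoxAtlas.measurable_chart (i : ℕ) : Measurable fun p : X × ℝ => 𝒜.chart i p.1 p.2 := by
  apply measurable_of_measurableSet_graph
  have hc := BoxAtlas.measurable_indicator_coord (𝒜 := 𝒜) i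
  have : {p : (X × ℝ) × X | 𝒜.chart i p.1.1 p.1.2 = p.2} =
      ({p : (X × ℝ) × X | |p.1.2| < 𝒜.radius i p.1.1} ∩ {p | p.2 ∈ (𝒜.box i).U ∧
        (𝒜.box i).E p.2 0 = (𝒜.box i).E p.1.1 0} ∩
        {p | (𝒜.box i).U.indicator (𝒜.coord i) p.2 =
          (𝒜.box i).U.indicator (𝒜.coord i) p.1.1 + p.1.2}) ∪
      ({p : (X × ℝ) × X | |p.1.2| < 𝒜.radius i p.1.1}ᶜ ∩ {p | p.1.1 = p.2}) := by
    ext ⟨⟨z, τ⟩, w⟩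
    simp only [mem_ofPred_eq, mem_union, mem_inter_iff, mem_compl_iff]
    by_cases h : |τ| < 𝒜.radius i z
    · have hz := BoxAtlas.mem_of_radius_pos ((abs_nonneg τ).trans_lt h)
      simp only [h, not_true, false_and, or_false, true_and]
      constructor
      · rintro rfl
        have := BoxAtlas.chart_mem h
        refine ⟨this, ?_⟩
        rw [indicator_of_mem this.1, indicator_of_mem hz, BoxAtlas.coord_chart h]
      · rintro ⟨h1, h2⟩
        rw [indicator_of_mem h1.1, indicator_of_mem hz] at h2
        exact BoxAtlas.chart_eq h h1 h2
    · simp only [h, not_false_eq_true, false_and, false_or, true_and]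
      rw [BoxAtlas.chart, dif_neg h]
  rw [this]
  have hz : Measurable fun p : (X × ℝ) × X => p.1.1 := measurable_fst.comp measurable_fst
  have hτ : Measurable fun p : (X × ℝ) × X => p.1.2 := measurable_snd.comp measurable_fst
  have hw : Measurable fun p : (X × ℝ) × X => p.2 := measurable_snd
  have h1 : MeasurableSet {p : (X × ℝ) × X | |p.1.2| < 𝒜.radius i p.1.1} :=
    measurableSet_lt (continuous_abs.measurable.comp hτ) ((BoxAtlas.measurable_radius i).comp hz)
  refine MeasurableSet.union ((h1.inter (MeasurableSet.inter (hw (𝒜.box i).measurableSet) ?_)).inter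
    ?_) (h1.compl.inter (measurableSet_eq_fun hz hw))
  · exact measurableSet_eq_fun (((𝒜.box i).measurable_E_apply 0).comp hw)
      (((𝒜.box i).measurable_E_apply 0).comp hz)
  · exact measurableSet_eq_fun (hc.comp hw) ((hc.comp hz).add hτ)

end Coord

/-! ### Paths parametrized by length and their rigidity -/

section LengthArc

variable {X : Type*} [TopologicalSpace X] [MeasurableSpace X] {𝒜 : BoxAtlas X}

variable (𝒜) in
/-- An injective path, defined on `(a, b)` and parametrized by length. -/
structure BoxAtlas.LengthArc (f : ℝ → X) (a b : ℝ) : Prop where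
  continuousOn : ContinuousOn f (Ioo a b)
  injOn : InjOn f (Ioo a b)
  length : ∀ u ∈ Ioo a b, ∀ v ∈ Ioo a b, u ≤ v →
    𝒜.leafMeasure (f '' Icc u v) = ENNReal.ofReal (v - u)

namespace BoxAtlas.LengthArc

variable {f g : ℝ → X} {a b : ℝ}

theorem mono (hf : 𝒜.LengthArc f a b) {c d : ℝ} (h : Ioo c d ⊆ Ioo a b) : 𝒜.LengthArc f c d :=
  ⟨hf.continuousOn.mono h, hf.injOn.mono h, fun u hu v hv => hf.length u (h hu) v (h hv)⟩

theorem comp_add (hf : 𝒜.LengthArc f a b) (t : ℝ) :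
    𝒜.LengthArc (fun τ => f (t + τ)) (a - t) (b - t) := by
  have hm : ∀ τ ∈ Ioo (a - t) (b - t), t + τ ∈ Ioo a b := fun τ hτ =>
    ⟨by linarith [hτ.1], by linarith [hτ.2]⟩
  refine ⟨hf.continuousOn.comp (by fun_prop) hm,
    fun u hu v hv h => add_left_cancel (hf.injOn (hm u hu) (hm v hv) h), fun u hu v hv h => ?_⟩
  rw [show (fun τ => f (t + τ)) '' Icc u v = f '' Icc (t + u) (t + v) by
    rw [← Set.image_const_add_Icc, image_image],
    hf.length _ (hm u hu) _ (hm v hv) (by linarith)]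
  congr 1; ring

theorem comp_neg (hf : 𝒜.LengthArc f a b) : 𝒜.LengthArc (fun τ => f (-τ)) (-b) (-a) := by
  have hm : ∀ τ ∈ Ioo (-b) (-a), -τ ∈ Ioo a b := fun τ hτ =>
    ⟨by linarith [hτ.2], by linarith [hτ.1]⟩
  refine ⟨hf.continuousOn.comp (by fun_prop) hm,
    fun u hu v hv h => neg_injective (hf.injOn (hm u hu) (hm v hv) h), fun u hu v hv h => ?_⟩
  rw [show (fun τ => f (-τ)) '' Icc u v = f '' Icc (-v) (-u) by
    rw [← Set.image_neg_Icc, image_image],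
    hf.length _ (hm v hv) _ (hm u hu) (by linarith)]
  congr 1; ring

theorem isOpen_image (hf : 𝒜.LengthArc f a b) {c d : ℝ} (h : Ioo c d ⊆ Ioo a b) :
    IsOpen (f '' Ioo c d) :=
  𝒜.isOpen_image_Ioo (hf.continuousOn.mono h) (hf.injOn.mono h)

/-- The length of the image of `[u, v]`, computed along `g` and along `f`, gives `θ v - θ u = v -
u`; since `θ` fixes `0`, it is the identity. -/
theorem eq_of_strictMonoOn {ε δ : ℝ} (hδε : δ ≤ ε) (hδ : 0 < δ) (hf : 𝒜.LengthArc f (-ε) ε)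
    (hg : 𝒜.LengthArc g (-ε) ε) {θ : ℝ → ℝ} (hθ : ∀ τ ∈ Ioo (-δ) δ, θ τ ∈ Ioo (-ε) ε)
    (hθ' : ∀ τ ∈ Ioo (-δ) δ, g τ = f (θ τ)) (hc : ContinuousOn θ (Ioo (-δ) δ)) (h0 : θ 0 = 0)
    (hm : StrictMonoOn θ (Ioo (-δ) δ)) : ∀ τ ∈ Ioo (-δ) δ, g τ = f τ := by
  have hδmem : Ioo (-δ) δ ⊆ Ioo (-ε) ε := Ioo_subset_Ioo (by linarith) hδε
  have m0 : (0 : ℝ) ∈ Ioo (-δ) δ := ⟨by linarith, hδ⟩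
  intro τ hτ
  rw [hθ' τ hτ]
  congr 1
  have key : ∀ u ∈ Ioo (-δ) δ, ∀ v ∈ Ioo (-δ) δ, u ≤ v → θ v - θ u = v - u := by
    intro u hu v hv huv
    have hI : Icc u v ⊆ Ioo (-δ) δ := fun r hr => ⟨hu.1.trans_le hr.1, hr.2.trans_lt hv.2⟩
    have him := (hc.mono hI).image_Icc_of_monotoneOn huv (hm.monotoneOn.mono hI)
    have hmon : θ u ≤ θ v := hm.monotoneOn hu hv huv
    have h1 : g '' Icc u v = f '' Icc (θ u) (θ v) := by
      rw [← him, image_image]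
      exact image_congr fun r hr => hθ' r (hI hr)
    have h2 := hg.length u (hδmem hu) v (hδmem hv) huv
    rw [h1, hf.length _ (hθ u hu) _ (hθ v hv) hmon] at h2
    exact (ENNReal.ofReal_eq_ofReal_iff (by linarith) (by linarith)).1 h2
  rcases le_total 0 τ with h | h
  · have := key 0 m0 τ hτ h
    rw [h0] at this; linarith
  · have := key τ hτ 0 m0 h
    rw [h0] at this; linarith

/-- Two paths parametrized by length through the same point agree up to orientation. -/
theorem rigid {ε : ℝ} (hε : 0 < ε) (hf : 𝒜.LengthArc f (-ε) ε) (hg : 𝒜.LengthArc g (-ε) ε)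
    (h0 : f 0 = g 0) : ∃ σ : ℝ, (σ = 1 ∨ σ = -1) ∧ ∀ᶠ τ in 𝓝 0, g τ = f (σ * τ) := by
  have m0 : (0 : ℝ) ∈ Ioo (-ε) ε := ⟨by linarith, hε⟩
  have hN := (hf.isOpen_image (Subset.refl _)).mem_nhds ⟨0, m0, rfl⟩
  have hgc : ContinuousAt g 0 := hg.continuousOn.continuousAt (Ioo_mem_nhds m0.1 m0.2)
  rw [h0] at hN
  obtain ⟨δ', hδ', hb⟩ := Metric.mem_nhds_iff.1 (hgc hN)
  rw [Real.ball_eq_Ioo, zero_sub, zero_add] at hb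
  set δ := min δ' ε
  have hδ : 0 < δ := lt_min hδ' hε
  have hδε : δ ≤ ε := min_le_right _ _
  have hsub : Ioo (-δ) δ ⊆ Ioo (-δ') δ' :=
    Ioo_subset_Ioo (neg_le_neg (min_le_left _ _)) (min_le_left _ _)
  have hsub' : Ioo (-δ) δ ⊆ Ioo (-ε) ε := Ioo_subset_Ioo (neg_le_neg hδε) hδε
  -- The image of `f` is a neighbourhood of `g 0`, so `θ = f⁻¹ ∘ g` makes sense near `0`. It is
  -- continuous and injective, hence monotone; the decreasing case is treated by reversing `f`.
  choose! θ hθ hθ' using fun τ (hτ : τ ∈ Ioo (-δ) δ) => hb (hsub hτ)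
  have hδ0 : (0 : ℝ) ∈ Ioo (-δ) δ := ⟨by linarith, hδ⟩
  have hθ0 : θ 0 = 0 := hf.injOn (hθ 0 hδ0) m0 ((hθ' 0 hδ0).trans h0.symm)
  have hθc : ContinuousOn θ (Ioo (-δ) δ) := by
    intro τ hτ
    apply ContinuousAt.continuousWithinAt
    rw [Metric.continuousAt_iff']
    intro η hη
    have hW : IsOpen (f '' Ioo (max (-ε) (θ τ - η)) (min ε (θ τ + η))) :=
      hf.isOpen_image (Ioo_subset_Ioo (le_max_left _ _) (min_le_left _ _))
    have hmem : g τ ∈ f '' Ioo (max (-ε) (θ τ - η)) (min ε (θ τ + η)) :=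
      ⟨θ τ, ⟨max_lt (hθ τ hτ).1 (by linarith), lt_min (hθ τ hτ).2 (by linarith)⟩, hθ' τ hτ⟩
    have hcτ : ContinuousAt g τ :=
      hg.continuousOn.continuousAt (Ioo_mem_nhds (hsub' hτ).1 (hsub' hτ).2)
    filter_upwards [hcτ (hW.mem_nhds hmem), Ioo_mem_nhds hτ.1 hτ.2] with r hr hr'
    obtain ⟨q, hq, hq'⟩ := hr
    have hqε : q ∈ Ioo (-ε) ε := ⟨(le_max_left _ _).trans_lt hq.1, hq.2.trans_le (min_le_left _ _)⟩
    have : θ r = q := hf.injOn (hθ r hr') hqε ((hθ' r hr').trans hq'.symm)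
    rw [this, Real.dist_eq, abs_lt]
    exact ⟨by linarith [(le_max_right (-ε) (θ τ - η)).trans_lt hq.1],
      by linarith [hq.2.trans_le (min_le_right ε (θ τ + η))]⟩
  have hθi : InjOn θ (Ioo (-δ) δ) := fun u hu v hv h =>
    hg.injOn (hsub' hu) (hsub' hv) (by rw [← hθ' u hu, ← hθ' v hv, h])
  have hnhds : Ioo (-δ) δ ∈ 𝓝 (0 : ℝ) := Ioo_mem_nhds hδ0.1 hδ0.2
  rcases ContinuousOn.strictMonoOn_of_injOn_Ioo (by linarith) hθc hθi with h | h
  · refine ⟨1, Or.inl rfl, ?_⟩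
    filter_upwards [hnhds] with τ hτ
    rw [one_mul]
    exact eq_of_strictMonoOn hδε hδ hf hg hθ (fun τ hτ => (hθ' τ hτ).symm) hθc hθ0 h τ hτ
  · refine ⟨-1, Or.inr rfl, ?_⟩
    filter_upwards [hnhds] with τ hτ
    rw [neg_one_mul]
    have hf' : 𝒜.LengthArc (fun τ => f (-τ)) (-ε) ε := by simpa using hf.comp_neg
    refine eq_of_strictMonoOn (f := fun τ => f (-τ)) (θ := fun τ => -θ τ) hδε hδ hf' hg
      (fun τ hτ => ⟨by linarith [(hθ τ hτ).2], by linarith [(hθ τ hτ).1]⟩)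
      (fun τ hτ => by simp only [neg_neg]; exact (hθ' τ hτ).symm) hθc.neg (by simp [hθ0])
      (fun u hu v hv huv => neg_lt_neg (h hu hv huv)) τ hτ

end BoxAtlas.LengthArc

variable [StandardBorelSpace X]

theorem BoxAtlas.chart_zero {i : ℕ} {z : X} (h : 0 < 𝒜.radius i z) : 𝒜.chart i z 0 = z :=
  BoxAtlas.chart_eq (by rwa [abs_zero]) (Box.self_mem_plaque (BoxAtlas.mem_of_radius_pos h))
    (by rw [add_zero])

/-- On a plaque, `coord` is a strictly increasing function of the box coordinate. Hence small
coordinate intervals trap the chart, which gives continuity, and the length of an arc is the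
difference of the values of `coord` at its ends. -/
theorem BoxAtlas.lengthArc_chart {i : ℕ} {z : X} (h : 0 < 𝒜.radius i z) :
    𝒜.LengthArc (𝒜.chart i z) (-𝒜.radius i z) (𝒜.radius i z) := by
  have hz := BoxAtlas.mem_of_radius_pos h
  set b := 𝒜.box i
  set ε := 𝒜.radius i z
  have habs : ∀ {τ}, τ ∈ Ioo (-ε) ε → |τ| < ε := fun hτ => abs_lt.2 hτ
  have hlt : ∀ {u v}, u ∈ Ioo (-ε) ε → v ∈ Ioo (-ε) ε → u < v →
      b.s (𝒜.chart i z u) < b.s (𝒜.chart i z v) := by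
    intro u v hu hv huv
    rw [← BoxAtlas.coord_lt_iff hz (BoxAtlas.chart_mem (habs hu)) (BoxAtlas.chart_mem (habs hv)),
      BoxAtlas.coord_chart (habs hu), BoxAtlas.coord_chart (habs hv)]
    linarith
  have hle : ∀ {u v}, u ∈ Ioo (-ε) ε → v ∈ Ioo (-ε) ε → u ≤ v →
      b.s (𝒜.chart i z u) ≤ b.s (𝒜.chart i z v) := by
    intro u v hu hv huv
    rcases eq_or_lt_of_le huv with rfl | h
    · exact le_rfl
    · exact (hlt hu hv h).le
  refine ⟨?_, ?_, ?_⟩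
  · intro τ hτ
    apply ContinuousAt.continuousWithinAt
    intro O hO
    have hw := BoxAtlas.chart_mem (habs hτ)
    set w := 𝒜.chart i z τ
    have hEw := Box.E_s_of_mem_plaque hz hw
    -- the coordinate of `w` is not an end of the plaque
    obtain ⟨τ₁, h1, h1'⟩ := exists_between hτ.1
    obtain ⟨τ₂, h2, h2'⟩ := exists_between hτ.2
    have hs1 : b.s (𝒜.chart i z τ₁) < b.s w := hlt ⟨h1, h1'.trans hτ.2⟩ hτ h1'
    have hs2 : b.s w < b.s (𝒜.chart i z τ₂) := hlt hτ ⟨hτ.1.trans h2, h2'⟩ h2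
    have hm1 := b.s_mem _ (BoxAtlas.chart_mem (habs (⟨h1, h1'.trans hτ.2⟩ : τ₁ ∈ Ioo (-ε) ε))).1
    have hm2 := b.s_mem _ (BoxAtlas.chart_mem (habs (⟨hτ.1.trans h2, h2'⟩ : τ₂ ∈ Ioo (-ε) ε))).1
    have hpre : b.E z ⁻¹' O ∈ 𝓝 (b.s w) := by
      apply (b.continuous_E z hz).continuousAt
      rwa [hEw]
    obtain ⟨η, hη, hball⟩ := Metric.nhds_basis_closedBall.mem_iff.1 (inter_mem hpre
      (Ioo_mem_nhds (hm1.1.trans_lt hs1) (hs2.trans_le hm2.2)))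
    rw [Real.closedBall_eq_Icc] at hball
    have k1 : b.s w - η ∈ Icc (-1 : ℝ) 1 := Ioo_subset_Icc_self (hball ⟨le_rfl, by linarith⟩).2
    have k2 : b.s w + η ∈ Icc (-1 : ℝ) 1 := Ioo_subset_Icc_self (hball ⟨by linarith, le_rfl⟩).2
    have p1 := Box.E_mem_plaque hz (b.s w - η)
    have p2 := Box.E_mem_plaque hz (b.s w + η)
    have c1 : 𝒜.coord i (b.E z (b.s w - η)) < 𝒜.coord i z + τ := by
      rw [← BoxAtlas.coord_chart (habs hτ)]
      exact BoxAtlas.coord_lt hz p1 hw (by rw [b.s_E z hz _ k1]; linarith)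
    have c2 : 𝒜.coord i z + τ < 𝒜.coord i (b.E z (b.s w + η)) := by
      rw [← BoxAtlas.coord_chart (habs hτ)]
      exact BoxAtlas.coord_lt hz hw p2 (by rw [b.s_E z hz _ k2]; linarith)
    rw [mem_map]
    filter_upwards [Ioo_mem_nhds hτ.1 hτ.2, Ioo_mem_nhds
      (show 𝒜.coord i (b.E z (b.s w - η)) - 𝒜.coord i z < τ by linarith)
      (show τ < 𝒜.coord i (b.E z (b.s w + η)) - 𝒜.coord i z by linarith)] with r hr hr'
    have hwr := BoxAtlas.chart_mem (habs hr)
    have q1 : b.s w - η < b.s (𝒜.chart i z r) := by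
      rw [← b.s_E z hz _ k1, ← BoxAtlas.coord_lt_iff hz p1 hwr, BoxAtlas.coord_chart (habs hr)]
      linarith [hr'.1]
    have q2 : b.s (𝒜.chart i z r) < b.s w + η := by
      rw [← b.s_E z hz _ k2, ← BoxAtlas.coord_lt_iff hz hwr p2, BoxAtlas.coord_chart (habs hr)]
      linarith [hr'.2]
    have := (hball ⟨q1.le, q2.le⟩).1
    rw [mem_preimage, Box.E_s_of_mem_plaque hz hwr] at this
    exact this
  · intro u hu v hv huv
    have := BoxAtlas.coord_chart (habs hu)
    rw [huv, BoxAtlas.coord_chart (habs hv)] at this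
    linarith
  · intro u hu v hv huv
    have hwu := BoxAtlas.chart_mem (habs hu)
    have hwv := BoxAtlas.chart_mem (habs hv)
    have hset : 𝒜.chart i z '' Icc u v = {w | w ∈ b.plaque z ∧
        b.s w ∈ Icc (b.s (𝒜.chart i z u)) (b.s (𝒜.chart i z v))} := by
      ext w
      constructor
      · rintro ⟨r, hr, rfl⟩
        have hrε : r ∈ Ioo (-ε) ε := ⟨hu.1.trans_le hr.1, hr.2.trans_lt hv.2⟩
        exact ⟨BoxAtlas.chart_mem (habs hrε), hle hu hrε hr.1, hle hrε hv hr.2⟩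
      · rintro ⟨hw, hw1, hw2⟩
        have e1 : 𝒜.coord i z + u ≤ 𝒜.coord i w := by
          rw [← BoxAtlas.coord_chart (habs hu), ← not_lt, BoxAtlas.coord_lt_iff hz hw hwu]
          exact not_lt.2 hw1
        have e2 : 𝒜.coord i w ≤ 𝒜.coord i z + v := by
          rw [← BoxAtlas.coord_chart (habs hv), ← not_lt, BoxAtlas.coord_lt_iff hz hwv hw]
          exact not_lt.2 hw2
        have hr : 𝒜.coord i w - 𝒜.coord i z ∈ Icc u v := ⟨by linarith, by linarith⟩
        exact ⟨_, hr, BoxAtlas.chart_eq (habs ⟨hu.1.trans_le hr.1, hr.2.trans_lt hv.2⟩) hw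
          (by ring)⟩
    rw [hset, BoxAtlas.leafMeasure_Icc hz hwu hwv (hle hu hv huv), BoxAtlas.coord_chart (habs hu),
      BoxAtlas.coord_chart (habs hv)]
    congr 1; ring

end LengthArc

/-! ### Maximal geodesics on the leaves -/

section Geodesic

variable {X : Type*} [TopologicalSpace X] [MeasurableSpace X] {𝒜 : BoxAtlas X}

variable (𝒜) in
/-- The path `f` is, near `t`, injective and parametrized by length. -/
def BoxAtlas.UnitSpeedAt (f : ℝ → X) (t : ℝ) : Prop :=
  ∃ ε > 0, 𝒜.LengthArc (fun τ => f (t + τ)) (-ε) ε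

theorem BoxAtlas.LengthArc.unitSpeedAt {f : ℝ → X} {a b t : ℝ} (hf : 𝒜.LengthArc f a b)
    (ht : t ∈ Ioo a b) : 𝒜.UnitSpeedAt f t := by
  refine ⟨min (t - a) (b - t), lt_min (by linarith [ht.1]) (by linarith [ht.2]),
    (hf.comp_add t).mono (Ioo_subset_Ioo ?_ ?_)⟩
  · linarith [min_le_left (t - a) (b - t)]
  · linarith [min_le_right (t - a) (b - t)]

namespace BoxAtlas.UnitSpeedAt

variable {f g : ℝ → X} {t t' : ℝ}

theorem continuousAt (h : 𝒜.UnitSpeedAt f t) : ContinuousAt f t := by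
  obtain ⟨ε, hε, ha⟩ := h
  have h1 : ContinuousAt (fun τ => f (t + τ)) 0 :=
    ha.continuousOn.continuousAt (Ioo_mem_nhds (by linarith) hε)
  have h2 : ContinuousAt (fun r => f (t + (r - t))) t := by
    refine ContinuousAt.comp (f := fun r => r - t) (g := fun τ => f (t + τ)) ?_ (by fun_prop)
    simpa using h1
  simpa using h2

theorem congr (h : 𝒜.UnitSpeedAt f t) (hfg : f =ᶠ[𝓝 t] g) : 𝒜.UnitSpeedAt g t := by
  obtain ⟨ε, hε, ha⟩ := h
  obtain ⟨δ, hδ, hb⟩ := Metric.eventually_nhds_iff_ball.1 hfg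
  have hη : 0 < min ε δ := lt_min hε hδ
  have heq : ∀ τ ∈ Ioo (-min ε δ) (min ε δ), f (t + τ) = g (t + τ) := by
    intro τ hτ
    apply hb
    rw [Real.ball_eq_Ioo]
    constructor <;> linarith [hτ.1, hτ.2, min_le_right ε δ]
  have hm := ha.mono (c := -min ε δ) (d := min ε δ)
    (Ioo_subset_Ioo (neg_le_neg (min_le_left _ _)) (min_le_left _ _))
  refine ⟨min ε δ, hη, ⟨?_, ?_, ?_⟩⟩
  · exact hm.continuousOn.congr fun τ hτ => (heq τ hτ).symm
  · exact hm.injOn.congr heq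
  · intro u hu v hv huv
    rw [← hm.length u hu v hv huv]
    congr 1
    exact image_congr fun r hr => (heq r ⟨hu.1.trans_le hr.1, hr.2.trans_lt hv.2⟩).symm

theorem comp_add {c : ℝ} (h : 𝒜.UnitSpeedAt f (t + c)) : 𝒜.UnitSpeedAt (fun r => f (r + c)) t := by
  obtain ⟨ε, hε, ha⟩ := h
  refine ⟨ε, hε, ?_⟩
  have : (fun τ => f (t + τ + c)) = fun τ => f (t + c + τ) := by
    ext τ; congr 1; ring
  simpa only [this] using ha

theorem comp_sub {c : ℝ} (h : 𝒜.UnitSpeedAt f (c - t)) : 𝒜.UnitSpeedAt (fun r => f (c - r)) t := by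
  obtain ⟨ε, hε, ha⟩ := h
  refine ⟨ε, hε, ?_⟩
  have := ha.comp_neg
  rw [neg_neg] at this
  have h2 : (fun τ => f (c - (t + τ))) = fun τ => f (c - t + -τ) := by
    ext τ; congr 1; ring
  simpa only [h2] using this

theorem rigid (hf : 𝒜.UnitSpeedAt f t) (hg : 𝒜.UnitSpeedAt g t') (h : f t = g t') :
    ∃ σ : ℝ, (σ = 1 ∨ σ = -1) ∧ ∀ᶠ τ in 𝓝 0, g (t' + τ) = f (t + σ * τ) := by
  obtain ⟨ε, hε, ha⟩ := hf
  obtain ⟨δ, hδ, hb⟩ := hg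
  have hs1 : Ioo (-min ε δ) (min ε δ) ⊆ Ioo (-ε) ε :=
    Ioo_subset_Ioo (neg_le_neg (min_le_left _ _)) (min_le_left _ _)
  have hs2 : Ioo (-min ε δ) (min ε δ) ⊆ Ioo (-δ) δ :=
    Ioo_subset_Ioo (neg_le_neg (min_le_right _ _)) (min_le_right _ _)
  exact BoxAtlas.LengthArc.rigid (lt_min hε hδ) (ha.mono hs1) (hb.mono hs2) (by simpa using h)

/-- A unit speed path is locally injective, so it cannot fold at `t`. This is what excludes the sign
`-1` in later uses of rigidity. -/
theorem not_eventually_reflect (hf : 𝒜.UnitSpeedAt f t) :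
    ¬ ∃ᶠ τ in 𝓝[≠] (0 : ℝ), f (t + τ) = f (t - τ) := by
  obtain ⟨ε, hε, ha⟩ := hf
  rw [not_frequently]
  filter_upwards [mem_nhdsWithin_of_mem_nhds (Ioo_mem_nhds (neg_lt_zero.2 hε) hε),
    self_mem_nhdsWithin] with τ hτ hτ0 h
  have := ha.injOn hτ (show -τ ∈ Ioo (-ε) ε from ⟨by linarith [hτ.2], by linarith [hτ.1]⟩)
    (by simpa [sub_eq_add_neg] using h)
  exact hτ0 (by simp only [mem_singleton_iff]; linarith)

theorem image_mem_nhds (hf : 𝒜.UnitSpeedAt f t) {I : Set ℝ} (hI : I ∈ 𝓝 t) : f '' I ∈ 𝓝 (f t) := by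
  obtain ⟨ε, hε, ha⟩ := hf
  obtain ⟨δ, hδ, hb⟩ := Metric.mem_nhds_iff.1 hI
  rw [Real.ball_eq_Ioo] at hb
  have hη : 0 < min ε δ := lt_min hε hδ
  have ho := ha.isOpen_image (c := -min ε δ) (d := min ε δ)
    (Ioo_subset_Ioo (neg_le_neg (min_le_left _ _)) (min_le_left _ _))
  refine mem_of_superset (ho.mem_nhds ⟨0, ⟨by linarith, hη⟩, by simp⟩) ?_
  rintro _ ⟨τ, hτ, rfl⟩
  refine ⟨t + τ, hb ⟨?_, ?_⟩, rfl⟩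
  · linarith [hτ.1, min_le_right ε δ]
  · linarith [hτ.2, min_le_right ε δ]

end BoxAtlas.UnitSpeedAt

/-- The times where the germs agree form an open set, which is also closed in `I`: at a limit time
the values agree because `X` is Hausdorff, and rigidity gives equal germs or a reflection. -/
theorem BoxAtlas.eqOn_of_unitSpeedAt [T2Space X] {f g : ℝ → X} {I : Set ℝ}
    (hc : IsPreconnected I) (hf : ∀ t ∈ I, 𝒜.UnitSpeedAt f t) (hg : ∀ t ∈ I, 𝒜.UnitSpeedAt g t)
    {t₀ : ℝ} (ht₀ : t₀ ∈ I) (h : f =ᶠ[𝓝 t₀] g) : EqOn f g I := by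
  have hfc : ContinuousOn f I := fun t ht => (hf t ht).continuousAt.continuousWithinAt
  have hgc : ContinuousOn g I := fun t ht => (hg t ht).continuousAt.continuousWithinAt
  suffices hS : I ⊆ {t | f =ᶠ[𝓝 t] g} from fun t ht => (hS ht).self_of_nhds
  refine hc.subset_of_closure_inter_subset isOpen_setOfPred_eventually_nhds ⟨t₀, ht₀, h⟩ ?_
  rintro t ⟨htS, htI⟩
  rw [mem_ofPred_eq]
  have hfreq : ∃ᶠ r in 𝓝 t, f =ᶠ[𝓝 r] g := mem_closure_iff_frequently.1 htS
  have heq : f t = g t := by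
    by_contra hne
    obtain ⟨U, V, hU, hV, hfU, hgV, hUV⟩ := t2_separation hne
    obtain ⟨r, hr, hr1, hr2⟩ := (hfreq.and_eventually
      (((hf t htI).continuousAt.eventually_mem (hU.mem_nhds hfU)).and
        ((hg t htI).continuousAt.eventually_mem (hV.mem_nhds hgV)))).exists
    have hr1' : f r ∈ U := hr1
    have hr2' : g r ∈ V := hr2
    exact Set.disjoint_left.1 hUV hr1' (by rw [hr.self_of_nhds]; exact hr2')
  obtain ⟨σ, hσ, hev⟩ := (hf t htI).rigid (hg t htI) heq
  have hev' : ∀ᶠ r in 𝓝 t, g r = f (t + σ * (r - t)) := by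
    have : Tendsto (fun r => r - t) (𝓝 t) (𝓝 0) := by
      have : Continuous fun r : ℝ => r - t := by fun_prop
      simpa using this.tendsto t
    filter_upwards [this.eventually hev] with r hr
    simpa using hr
  rcases hσ with rfl | rfl
  · filter_upwards [hev'] with r hr
    rw [hr]; congr 1; ring
  -- With the sign `-1`, times `r` close to `t` at which the germs agree satisfy `f r = f (2t - r)`:
  -- the path would fold at `t`.
  · by_cases htn : f =ᶠ[𝓝 t] g
    · exact htn
    · exfalso
      apply (hf t htI).not_eventually_reflect
      have hfr : ∃ᶠ r in 𝓝[≠] t, f r = f (t - (r - t)) := by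
        rw [frequently_nhdsWithin_iff]
        refine (hfreq.and_eventually hev').mono ?_
        rintro r ⟨hr1, hr2⟩
        refine ⟨?_, ?_⟩
        · rw [hr1.self_of_nhds, hr2]; congr 1; ring
        · rintro rfl; exact htn hr1
      have hmap : Tendsto (fun r => r - t) (𝓝[≠] t) (𝓝[≠] 0) := by
        refine tendsto_nhdsWithin_of_tendsto_nhds_of_eventually_within _ ?_ ?_
        · have : Continuous fun r : ℝ => r - t := by fun_prop
          simpa using (this.tendsto t).mono_left nhdsWithin_le_nhds
        · filter_upwards [self_mem_nhdsWithin] with r hr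
          simpa [sub_eq_zero] using hr
      refine hmap.frequently (hfr.mono fun r hr => ?_)
      simpa using hr

variable [StandardBorelSpace X]

open Classical in
variable (𝒜) in
/-- The first box which contains `x` in its interior. -/
noncomputable def BoxAtlas.index (x : X) : ℕ := Nat.find (𝒜.exists_radius_pos x)

theorem BoxAtlas.radius_index_pos (x : X) : 0 < 𝒜.radius (𝒜.index x) x := by
  classical
  exact Nat.find_spec (𝒜.exists_radius_pos x)

variable (𝒜) in
/-- A path of unit speed, starting at `x` in the direction of the chart at `x`. -/
structure BoxAtlas.IsGeodesic (x : X) (I : Set ℝ) (f : ℝ → X) : Prop where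
  isOpen : IsOpen I
  isPreconnected : IsPreconnected I
  zero_mem : (0 : ℝ) ∈ I
  unitSpeedAt : ∀ t ∈ I, 𝒜.UnitSpeedAt f t
  eventuallyEq : f =ᶠ[𝓝 0] 𝒜.chart (𝒜.index x) x

variable (𝒜) in
/-- The maximal interval on which the geodesic starting at `x` is defined. -/
def BoxAtlas.dom (x : X) : Set ℝ := {t | ∃ I f, 𝒜.IsGeodesic x I f ∧ t ∈ I}

open Classical in
variable (𝒜) in
/-- The maximal geodesic starting at `x`. -/
noncomputable def BoxAtlas.geo (x : X) (t : ℝ) : X :=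
  if h : ∃ I f, 𝒜.IsGeodesic x I f ∧ t ∈ I then h.choose_spec.choose t else x

variable [T2Space X] {x : X}

theorem BoxAtlas.IsGeodesic.eqOn {I J : Set ℝ} {f g : ℝ → X} (hf : 𝒜.IsGeodesic x I f)
    (hg : 𝒜.IsGeodesic x J g) : EqOn f g (I ∩ J) :=
  𝒜.eqOn_of_unitSpeedAt
    (isPreconnected_iff_ordConnected.2
      ((isPreconnected_iff_ordConnected.1 hf.isPreconnected).inter
        (isPreconnected_iff_ordConnected.1 hg.isPreconnected)))
    (fun t ht => hf.unitSpeedAt t ht.1) (fun t ht => hg.unitSpeedAt t ht.2)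
    ⟨hf.zero_mem, hg.zero_mem⟩ (hf.eventuallyEq.trans hg.eventuallyEq.symm)

theorem BoxAtlas.IsGeodesic.geo_eq {I : Set ℝ} {f : ℝ → X} (hf : 𝒜.IsGeodesic x I f) {t : ℝ}
    (ht : t ∈ I) : 𝒜.geo x t = f t := by
  have h : ∃ I f, 𝒜.IsGeodesic x I f ∧ t ∈ I := ⟨I, f, hf, ht⟩
  rw [BoxAtlas.geo, dif_pos h]
  have hs := h.choose_spec.choose_spec
  exact hs.1.eqOn hf ⟨hs.2, ht⟩

variable (𝒜) in
theorem BoxAtlas.isGeodesic_chart (x : X) : 𝒜.IsGeodesic x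
    (Ioo (-𝒜.radius (𝒜.index x) x) (𝒜.radius (𝒜.index x) x)) (𝒜.chart (𝒜.index x) x) :=
  ⟨isOpen_Ioo, isPreconnected_Ioo, ⟨neg_lt_zero.2 (𝒜.radius_index_pos x), 𝒜.radius_index_pos x⟩,
    fun _ ht => (BoxAtlas.lengthArc_chart (𝒜.radius_index_pos x)).unitSpeedAt ht,
    EventuallyEq.rfl⟩

variable (𝒜) in
-- All geodesics from `x` agree on the intersections of their intervals, so they glue on the union,
-- an interval since all contain `0`.
theorem BoxAtlas.isGeodesic_geo (x : X) : 𝒜.IsGeodesic x (𝒜.dom x) (𝒜.geo x) := by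
  have hseed := 𝒜.isGeodesic_chart x
  have hopen : IsOpen (𝒜.dom x) := by
    rw [isOpen_iff_mem_nhds]
    rintro t ⟨I, f, hf, ht⟩
    exact mem_of_superset (hf.isOpen.mem_nhds ht) fun r hr => ⟨I, f, hf, hr⟩
  have hev : ∀ {I f}, 𝒜.IsGeodesic x I f → ∀ t ∈ I, f =ᶠ[𝓝 t] 𝒜.geo x := fun hf t ht => by
    filter_upwards [hf.isOpen.mem_nhds ht] with r hr
    exact (hf.geo_eq hr).symm
  refine ⟨hopen, ?_, ⟨_, _, hseed, hseed.zero_mem⟩, ?_, ?_⟩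
  · have : 𝒜.dom x = ⋃₀ {I | ∃ f, 𝒜.IsGeodesic x I f} := by
      ext t
      constructor
      · rintro ⟨I, f, hf, ht⟩; exact ⟨I, ⟨f, hf⟩, ht⟩
      · rintro ⟨I, ⟨f, hf⟩, ht⟩; exact ⟨I, f, hf, ht⟩
    rw [this]
    exact isPreconnected_sUnion 0 _ (fun I ⟨f, hf⟩ => hf.zero_mem)
      (fun I ⟨f, hf⟩ => hf.isPreconnected)
  · rintro t ⟨I, f, hf, ht⟩
    exact (hf.unitSpeedAt t ht).congr (hev hf t ht)
  · exact ((hev hseed 0 hseed.zero_mem).symm)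

theorem BoxAtlas.zero_mem_dom : (0 : ℝ) ∈ 𝒜.dom x := (𝒜.isGeodesic_geo x).zero_mem

variable (𝒜 x) in
theorem BoxAtlas.geo_zero : 𝒜.geo x 0 = x :=
  (𝒜.isGeodesic_geo x).eventuallyEq.self_of_nhds.trans (𝒜.chart_zero (𝒜.radius_index_pos x))

theorem BoxAtlas.ordConnected_dom : (𝒜.dom x).OrdConnected :=
  isPreconnected_iff_ordConnected.1 (𝒜.isGeodesic_geo x).isPreconnected

/-- A path of unit speed which agrees with the geodesic near some time is part of it. -/
theorem BoxAtlas.geo_extend {J : Set ℝ} {f : ℝ → X} (hJ : IsOpen J) (hJc : IsPreconnected J)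
    (hf : ∀ t ∈ J, 𝒜.UnitSpeedAt f t) {t : ℝ} (htJ : t ∈ J) (htI : t ∈ 𝒜.dom x)
    (h : f =ᶠ[𝓝 t] 𝒜.geo x) : J ⊆ 𝒜.dom x ∧ EqOn f (𝒜.geo x) J := by
  classical
  have hG := 𝒜.isGeodesic_geo x
  have hag : EqOn f (𝒜.geo x) (J ∩ 𝒜.dom x) :=
    𝒜.eqOn_of_unitSpeedAt
      (isPreconnected_iff_ordConnected.2
        ((isPreconnected_iff_ordConnected.1 hJc).inter 𝒜.ordConnected_dom))
      (fun t ht => hf t ht.1) (fun t ht => hG.unitSpeedAt t ht.2) ⟨htJ, htI⟩ h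
  let F : ℝ → X := fun r => if r ∈ 𝒜.dom x then 𝒜.geo x r else f r
  have hF1 : ∀ r ∈ 𝒜.dom x, 𝒜.geo x =ᶠ[𝓝 r] F := fun r hr => by
    filter_upwards [hG.isOpen.mem_nhds hr] with q hq
    exact (if_pos hq).symm
  have hF2 : ∀ r ∈ J, f =ᶠ[𝓝 r] F := fun r hr => by
    filter_upwards [hJ.mem_nhds hr] with q hq
    by_cases hqd : q ∈ 𝒜.dom x
    · simp only [F, if_pos hqd]; exact hag ⟨hq, hqd⟩
    · simp only [F, if_neg hqd]
  have hgeo : 𝒜.IsGeodesic x (𝒜.dom x ∪ J) F := by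
    refine ⟨hG.isOpen.union hJ, hG.isPreconnected.union t htI htJ hJc, Or.inl hG.zero_mem, ?_, ?_⟩
    · rintro r (hr | hr)
      · exact (hG.unitSpeedAt r hr).congr (hF1 r hr)
      · exact (hf r hr).congr (hF2 r hr)
    · exact (hF1 0 hG.zero_mem).symm.trans hG.eventuallyEq
  have hsub : J ⊆ 𝒜.dom x := fun r hr => ⟨_, F, hgeo, Or.inr hr⟩
  exact ⟨hsub, fun r hr => hag ⟨hr, hsub hr⟩⟩

/-- A path of unit speed which passes through a point of the geodesic is part of it, up to a
change of parameter. -/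
theorem BoxAtlas.geo_extend_affine {f : ℝ → X} {I : Set ℝ} (hI : IsOpen I) (hIc : IsPreconnected I)
    (hf : ∀ t ∈ I, 𝒜.UnitSpeedAt f t)
    {u t : ℝ} (hu : u ∈ I) (ht : t ∈ 𝒜.dom x) (h : 𝒜.geo x t = f u) :
    ∃ σ : ℝ, (σ = 1 ∨ σ = -1) ∧ ∀ τ ∈ I, t + σ * (τ - u) ∈ 𝒜.dom x ∧
      𝒜.geo x (t + σ * (τ - u)) = f τ := by
  obtain ⟨σ, hσ, hev⟩ := (hf u hu).rigid ((𝒜.isGeodesic_geo x).unitSpeedAt t ht) h.symm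
  refine ⟨σ, hσ, ?_⟩
  have hσ2 : σ * σ = 1 := by rcases hσ with rfl | rfl <;> norm_num
  set J : Set ℝ := {r | u + σ * (r - t) ∈ I}
  have hcont : Continuous fun r : ℝ => u + σ * (r - t) := by fun_prop
  have hJ : IsOpen J := hI.preimage hcont
  have hJc : IsPreconnected J := by
    have : J = (fun τ => t + σ * (τ - u)) '' I := by
      ext r
      constructor
      · intro hr
        refine ⟨_, hr, ?_⟩
        linear_combination (r - t) * hσ2
      · rintro ⟨τ, hτ, rfl⟩
        change u + σ * (t + σ * (τ - u) - t) ∈ I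
        convert hτ using 1
        linear_combination (τ - u) * hσ2
    rw [this]
    exact hIc.image _ (by fun_prop)
  have hus : ∀ r ∈ J, 𝒜.UnitSpeedAt (fun r => f (u + σ * (r - t))) r := by
    intro r hr
    have hr' : u + σ * (r - t) ∈ I := hr
    rcases hσ with rfl | rfl
    · have e : (fun r => f (u + 1 * (r - t))) = fun r => f (r + (u - t)) := by
        ext r; congr 1; ring
      rw [e]
      refine BoxAtlas.UnitSpeedAt.comp_add (hf _ ?_)
      convert hr' using 1; ring
    · have e : (fun r => f (u + -1 * (r - t))) = fun r => f ((u + t) - r) := by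
        ext r; congr 1; ring
      rw [e]
      refine BoxAtlas.UnitSpeedAt.comp_sub (hf _ ?_)
      convert hr' using 1; ring
  have htJ : t ∈ J := by
    change u + σ * (t - t) ∈ I
    rwa [sub_self, mul_zero, add_zero]
  have hee : (fun r => f (u + σ * (r - t))) =ᶠ[𝓝 t] 𝒜.geo x := by
    have : Tendsto (fun r => r - t) (𝓝 t) (𝓝 0) := by
      have : Continuous fun r : ℝ => r - t := by fun_prop
      simpa using this.tendsto t
    filter_upwards [this.eventually hev] with r hr
    rw [← hr]; congr 1; ring
  obtain ⟨h1, h2⟩ := 𝒜.geo_extend hJ hJc hus htJ ht hee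
  intro τ hτ
  have hmem : t + σ * (τ - u) ∈ J := by
    change u + σ * (t + σ * (τ - u) - t) ∈ I
    convert hτ using 1
    linear_combination (τ - u) * hσ2
  refine ⟨h1 hmem, ?_⟩
  rw [← h2 hmem]
  simp only
  congr 1
  linear_combination (τ - u) * hσ2

theorem BoxAtlas.geo_extend_of_eq {f : ℝ → X} {ε : ℝ} (hf : 𝒜.LengthArc f (-ε) ε)
    {u t : ℝ} (hu : u ∈ Ioo (-ε) ε) (ht : t ∈ 𝒜.dom x) (h : 𝒜.geo x t = f u) :
    ∃ σ : ℝ, (σ = 1 ∨ σ = -1) ∧ ∀ τ ∈ Ioo (-ε) ε, t + σ * (τ - u) ∈ 𝒜.dom x ∧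
      𝒜.geo x (t + σ * (τ - u)) = f τ :=
  𝒜.geo_extend_affine isOpen_Ioo isPreconnected_Ioo (fun _ hτ => hf.unitSpeedAt hτ) hu ht h

/-- The image is open by invariance of domain. It is closed in the leaf: the chart at a limit point
meets the image, so by maximality the geodesic runs through the whole chart. -/
theorem BoxAtlas.geo_image_dom : 𝒜.geo x '' 𝒜.dom x = leaf x := by
  have hG := 𝒜.isGeodesic_geo x
  have hcont : ContinuousOn (𝒜.geo x) (𝒜.dom x) :=
    fun t ht => (hG.unitSpeedAt t ht).continuousAt.continuousWithinAt
  have hx : x ∈ 𝒜.geo x '' 𝒜.dom x := ⟨0, hG.zero_mem, 𝒜.geo_zero x⟩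
  have hopen : IsOpen (𝒜.geo x '' 𝒜.dom x) := by
    rw [isOpen_iff_mem_nhds]
    rintro _ ⟨t, ht, rfl⟩
    exact (hG.unitSpeedAt t ht).image_mem_nhds (hG.isOpen.mem_nhds ht)
  apply Subset.antisymm
  · exact (hG.isPreconnected.image _ hcont).subset_connectedComponent hx
  · refine (isPreconnected_connectedComponent (x := x)).subset_of_closure_inter_subset hopen
      ⟨x, mem_leaf_self x, hx⟩ ?_
    rintro y ⟨hy, _⟩
    set ε := 𝒜.radius (𝒜.index y) y
    have hε : 0 < ε := 𝒜.radius_index_pos y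
    have harc := 𝒜.lengthArc_chart hε
    have hy0 : 𝒜.chart (𝒜.index y) y 0 = y := 𝒜.chart_zero hε
    obtain ⟨_, ⟨u, hu, rfl⟩, ⟨t, ht, htu⟩⟩ := mem_closure_iff.1 hy _
      (harc.isOpen_image (Subset.refl _)) ⟨0, ⟨neg_lt_zero.2 hε, hε⟩, hy0⟩
    obtain ⟨σ, _, hσ⟩ := 𝒜.geo_extend_of_eq harc hu ht htu
    obtain ⟨h1, h2⟩ := hσ 0 ⟨neg_lt_zero.2 hε, hε⟩
    exact ⟨_, h1, h2.trans hy0⟩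

/-- If two times give the same point, rigidity makes the geodesic either periodic, so that its
image, the leaf, is compact, or symmetric about the midpoint of the two times, where it would fold.
-/
theorem BoxAtlas.injOn_geo (hx : ¬ IsCompact (leaf x)) : InjOn (𝒜.geo x) (𝒜.dom x) := by
  have hG := 𝒜.isGeodesic_geo x
  suffices H : ∀ s ∈ 𝒜.dom x, ∀ t ∈ 𝒜.dom x, s < t → 𝒜.geo x s ≠ 𝒜.geo x t by
    intro s hs t ht h
    rcases lt_trichotomy s t with hst | hst | hst
    · exact absurd h (H s hs t ht hst)
    · exact hst
    · exact absurd h.symm (H t ht s hs hst)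
  intro s hs t ht hst heq
  have hpre : ∀ (φ : ℝ → ℝ), Continuous φ → (∀ r, φ (φ r) = r) →
      IsPreconnected (φ ⁻¹' 𝒜.dom x) := by
    intro φ hφ hφφ
    have : φ ⁻¹' 𝒜.dom x = φ '' 𝒜.dom x := by
      ext r
      exact ⟨fun h => ⟨φ r, h, hφφ r⟩, fun ⟨q, hq, hqr⟩ => by
        rw [mem_preimage, ← hqr, hφφ]; exact hq⟩
    rw [this]
    exact hG.isPreconnected.image _ hφ.continuousOn
  have hpre' : ∀ c : ℝ, IsPreconnected ((fun r => r + c) ⁻¹' 𝒜.dom x) := by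
    intro c
    have : (fun r => r + c) ⁻¹' 𝒜.dom x = (fun r => r - c) '' 𝒜.dom x := by
      ext r
      exact ⟨fun h => ⟨r + c, h, by ring⟩, fun ⟨q, hq, hqr⟩ => by
        rw [mem_preimage, ← hqr, sub_add_cancel]; exact hq⟩
    rw [this]
    exact hG.isPreconnected.image _ (by fun_prop)
  have htend : ∀ c : ℝ, Tendsto (fun r => r - c) (𝓝 c) (𝓝 0) := fun c => by
    have : Continuous fun r : ℝ => r - c := by fun_prop
    simpa using this.tendsto c
  obtain ⟨σ, hσ, hev⟩ := (hG.unitSpeedAt t ht).rigid (hG.unitSpeedAt s hs) heq.symm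
  set p := t - s
  have hp : 0 < p := sub_pos.2 hst
  rcases hσ with rfl | rfl
  · -- the geodesic is periodic
    obtain ⟨h1, h2⟩ := 𝒜.geo_extend (x := x) (J := (fun r => r + -p) ⁻¹' 𝒜.dom x)
      (f := fun r => 𝒜.geo x (r + -p)) (t := t) (hG.isOpen.preimage (by fun_prop)) (hpre' _)
      (fun r hr => BoxAtlas.UnitSpeedAt.comp_add (hG.unitSpeedAt _ hr))
      (by rw [mem_preimage]; convert hs using 1; simp only [p]; ring) ht (by
        filter_upwards [(htend t).eventually hev] with r hr
        rw [one_mul] at hr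
        refine Eq.trans ?_ (hr.trans ?_)
        · congr 1; simp only [p]; ring
        · congr 1; ring)
    obtain ⟨h3, h4⟩ := 𝒜.geo_extend (x := x) (J := (fun r => r + p) ⁻¹' 𝒜.dom x)
      (f := fun r => 𝒜.geo x (r + p)) (t := s) (hG.isOpen.preimage (by fun_prop)) (hpre' _)
      (fun r hr => BoxAtlas.UnitSpeedAt.comp_add (hG.unitSpeedAt _ hr))
      (by rw [mem_preimage]; convert ht using 1; simp only [p]; ring) hs (by
        filter_upwards [(htend s).eventually hev] with r hr
        rw [one_mul] at hr
        refine Eq.trans ?_ (hr.symm.trans ?_)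
        · congr 1; simp only [p]; ring
        · congr 1; ring)
    have hup : ∀ r ∈ 𝒜.dom x, r + p ∈ 𝒜.dom x := fun r hr => h1 (by
      rw [mem_preimage, add_neg_cancel_right]; exact hr)
    have hdn : ∀ r ∈ 𝒜.dom x, r - p ∈ 𝒜.dom x := fun r hr => h3 (by
      rw [mem_preimage, sub_add_cancel]; exact hr)
    have hnp : ∀ n : ℕ, (n * p : ℝ) ∈ 𝒜.dom x ∧ (-(n * p) : ℝ) ∈ 𝒜.dom x := by
      intro n
      induction n with
      | zero => simpa using hG.zero_mem
      | succ n ih =>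
        push_cast
        constructor
        · convert hup _ ih.1 using 1; ring
        · convert hdn _ ih.2 using 1; ring
    have huniv : 𝒜.dom x = univ := by
      rw [eq_univ_iff_forall]
      intro r
      obtain ⟨n, hn⟩ := exists_nat_gt (|r| / p)
      rw [div_lt_iff₀ hp] at hn
      exact 𝒜.ordConnected_dom.out (hnp n).2 (hnp n).1
        ⟨by linarith [neg_abs_le r], by linarith [le_abs_self r]⟩
    have hper : Function.Periodic (𝒜.geo x) p := by
      intro r
      have := h4 (x := r) (by rw [mem_preimage, huniv]; trivial)
      exact this
    apply hx
    rw [← 𝒜.geo_image_dom, huniv, image_univ, ← hper.image_Icc hp 0]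
    refine isCompact_Icc.image ?_
    rw [continuous_iff_continuousAt]
    exact fun r => (hG.unitSpeedAt r (by rw [huniv]; trivial)).continuousAt
  · -- the geodesic turns back
    obtain ⟨h1, h2⟩ := 𝒜.geo_extend (x := x) (J := (fun r => (s + t) - r) ⁻¹' 𝒜.dom x)
      (f := fun r => 𝒜.geo x ((s + t) - r)) (t := s) (hG.isOpen.preimage (by fun_prop))
      (hpre _ (by fun_prop) (fun r => by ring))
      (fun r hr => BoxAtlas.UnitSpeedAt.comp_sub (hG.unitSpeedAt _ hr))
      (by rw [mem_preimage]; convert ht using 1; ring) hs (by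
        filter_upwards [(htend s).eventually hev] with r hr
        refine Eq.trans ?_ (hr.symm.trans ?_)
        · congr 1; ring
        · congr 1; ring)
    have hm : (s + t) / 2 ∈ 𝒜.dom x := 𝒜.ordConnected_dom.out hs ht ⟨by linarith, by linarith⟩
    apply (hG.unitSpeedAt _ hm).not_eventually_reflect
    apply Eventually.frequently
    have hnear : ∀ᶠ τ in 𝓝 (0 : ℝ), (s + t) / 2 + τ ∈ 𝒜.dom x ∧ (s + t) / 2 - τ ∈ 𝒜.dom x := by
      have c1 : Continuous fun τ : ℝ => (s + t) / 2 + τ := by fun_prop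
      have c2 : Continuous fun τ : ℝ => (s + t) / 2 - τ := by fun_prop
      refine (c1.continuousAt.eventually_mem ?_).and (c2.continuousAt.eventually_mem ?_)
      · rw [add_zero]; exact hG.isOpen.mem_nhds hm
      · rw [sub_zero]; exact hG.isOpen.mem_nhds hm
    filter_upwards [mem_nhdsWithin_of_mem_nhds hnear] with τ hτ
    have := h2 (x := (s + t) / 2 + τ) (by
      rw [mem_preimage]; convert hτ.2 using 1; ring)
    rw [← this]
    simp only
    congr 1; ring

end Geodesic

/-! ### Following the geodesics in a Borel way -/

section BorelGeodesic

variable {X : Type*} [TopologicalSpace X] [MeasurableSpace X] [StandardBorelSpace X]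
  {𝒜 : BoxAtlas X}

theorem measurable_nat_index {Z W : Type*} [MeasurableSpace Z] [MeasurableSpace W] {f : ℕ → Z → W}
    {N : Z → ℕ} (hN : Measurable N) (hf : ∀ n, Measurable (f n)) : Measurable fun z => f (N z) z :=
  (measurable_from_prod_countable_left (f := fun p : Z × ℕ => f p.2 p.1) hf).comp
    (measurable_id.prodMk hN)

open Classical in
variable (𝒜) in
/-- The first box in which `y` is at distance more than `ρ` from the ends of its plaque, if any. -/
noncomputable def BoxAtlas.jumpIndex (y : X) (ρ : ℝ) : ℕ :=
  if h : ∃ i, ρ < 𝒜.radius i y then Nat.find h else 0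

theorem BoxAtlas.jumpIndex_spec {y : X} {ρ : ℝ} (h : ∃ i, ρ < 𝒜.radius i y) :
    ρ < 𝒜.radius (𝒜.jumpIndex y ρ) y := by
  classical
  rw [BoxAtlas.jumpIndex, dif_pos h]
  exact Nat.find_spec h

theorem BoxAtlas.measurable_jumpIndex : Measurable fun p : X × ℝ => 𝒜.jumpIndex p.1 p.2 := by
  classical
  have hm : ∀ i, MeasurableSet {p : X × ℝ | p.2 < 𝒜.radius i p.1} := fun i =>
    measurableSet_lt measurable_snd ((BoxAtlas.measurable_radius i).comp measurable_fst)
  refine measurable_to_nat fun p₀ => ?_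
  by_cases h0 : 𝒜.jumpIndex p₀.1 p₀.2 = 0
  · have : (fun p : X × ℝ => 𝒜.jumpIndex p.1 p.2) ⁻¹' {𝒜.jumpIndex p₀.1 p₀.2} =
        {p | p.2 < 𝒜.radius 0 p.1} ∪ (⋃ i, {p : X × ℝ | p.2 < 𝒜.radius i p.1})ᶜ := by
      ext p
      simp only [mem_preimage, h0, mem_singleton_iff, mem_union, mem_compl_iff, mem_iUnion]
      by_cases h : ∃ i, p.2 < 𝒜.radius i p.1
      · rw [BoxAtlas.jumpIndex, dif_pos h, Nat.find_eq_zero]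
        simp only [mem_ofPred_eq, h, not_true, or_false]
      · rw [BoxAtlas.jumpIndex, dif_neg h]
        simp only [mem_ofPred_eq, h, not_false_eq_true, or_true]
    rw [this]
    exact (hm 0).union (MeasurableSet.iUnion hm).compl
  · set n := 𝒜.jumpIndex p₀.1 p₀.2
    have : (fun p : X × ℝ => 𝒜.jumpIndex p.1 p.2) ⁻¹' {n} =
        {p | p.2 < 𝒜.radius n p.1} ∩ ⋂ m, ⋂ (_ : m < n), {p : X × ℝ | p.2 < 𝒜.radius m p.1}ᶜ := by
      ext p
      simp only [mem_preimage, mem_singleton_iff, mem_inter_iff, mem_iInter, mem_compl_iff,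
        mem_ofPred_eq]
      by_cases h : ∃ i, p.2 < 𝒜.radius i p.1
      · rw [BoxAtlas.jumpIndex, dif_pos h, Nat.find_eq_iff]
      · rw [BoxAtlas.jumpIndex, dif_neg h]
        exact ⟨fun h' => absurd h'.symm h0, fun h' => absurd ⟨_, h'.1⟩ h⟩
    rw [this]
    exact (hm n).inter (MeasurableSet.iInter fun m => MeasurableSet.iInter fun _ => (hm m).compl)

variable (𝒜) in
/-- A point at distance `|δ|` from `y`; the other one is `jump y (-δ)`. -/
noncomputable def BoxAtlas.jump (y : X) (δ : ℝ) : X := 𝒜.chart (𝒜.jumpIndex y |δ|) y δ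

theorem BoxAtlas.measurable_jump : Measurable fun p : X × ℝ => 𝒜.jump p.1 p.2 := by
  have : Measurable fun p : X × ℝ => 𝒜.jumpIndex p.1 |p.2| :=
    BoxAtlas.measurable_jumpIndex.comp
      (measurable_fst.prodMk (continuous_abs.measurable.comp measurable_snd))
  exact measurable_nat_index (f := fun n (p : X × ℝ) => 𝒜.chart n p.1 p.2) this
    𝒜.measurable_chart

theorem BoxAtlas.measurable_index : Measurable 𝒜.index := by
  classical
  exact measurable_find 𝒜.exists_radius_pos fun i =>
    measurableSet_lt measurable_const (𝒜.measurable_radius i)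

open Classical in
variable (𝒜) in
/-- Two consecutive points of the polygonal path of step `δ` starting at `x`. -/
noncomputable def BoxAtlas.chain (x : X) (δ : ℝ) : ℕ → X × X
  | 0 => (x, 𝒜.chart (𝒜.index x) x δ)
  | n + 1 => ((BoxAtlas.chain x δ n).2,
      -- The two points at distance `|δ|` are the previous and the next ones on the path, so the one
      -- that is not the previous point is taken; no orientation of the leaf is needed.
      if 𝒜.jump (BoxAtlas.chain x δ n).2 δ = (BoxAtlas.chain x δ n).1 then
        𝒜.jump (BoxAtlas.chain x δ n).2 (-δ) else 𝒜.jump (BoxAtlas.chain x δ n).2 δ)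

theorem BoxAtlas.measurable_chain (n : ℕ) : Measurable fun p : X × ℝ => 𝒜.chain p.1 p.2 n := by
  classical
  induction n with
  | zero =>
    exact measurable_fst.prodMk (measurable_nat_index (f := fun n (p : X × ℝ) => 𝒜.chart n p.1 p.2)
      (𝒜.measurable_index.comp measurable_fst) 𝒜.measurable_chart)
  | succ n ih =>
    have h1 : Measurable fun p : X × ℝ => (𝒜.chain p.1 p.2 n).1 := measurable_fst.comp ih
    have h2 : Measurable fun p : X × ℝ => (𝒜.chain p.1 p.2 n).2 := measurable_snd.comp ih
    have h3 : Measurable fun p : X × ℝ => 𝒜.jump (𝒜.chain p.1 p.2 n).2 p.2 :=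
      𝒜.measurable_jump.comp (h2.prodMk measurable_snd)
    have h4 : Measurable fun p : X × ℝ => 𝒜.jump (𝒜.chain p.1 p.2 n).2 (-p.2) :=
      𝒜.measurable_jump.comp (h2.prodMk measurable_snd.neg)
    exact h2.prodMk (Measurable.ite (measurableSet_eq_fun h3 h1) h4 h3)

variable (𝒜) in
/-- The first `n` points of the polygonal path are at distance more than `|δ|` from the ends of some
plaque. -/
def BoxAtlas.Valid (x : X) (δ : ℝ) (n : ℕ) : Prop :=
  |δ| < 𝒜.radius (𝒜.index x) x ∧ ∀ j < n, ∃ i, |δ| < 𝒜.radius i (𝒜.chain x δ j).1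

theorem BoxAtlas.measurableSet_valid (n : ℕ) : MeasurableSet {p : X × ℝ | 𝒜.Valid p.1 p.2 n} := by
  have habs : Measurable fun p : X × ℝ => |p.2| := continuous_abs.measurable.comp measurable_snd
  have : {p : X × ℝ | 𝒜.Valid p.1 p.2 n} = {p | |p.2| < 𝒜.radius (𝒜.index p.1) p.1} ∩
      ⋂ j, ⋂ (_ : j < n), ⋃ i, {p | |p.2| < 𝒜.radius i (𝒜.chain p.1 p.2 j).1} := by
    ext p; simp [BoxAtlas.Valid]
  rw [this]
  refine MeasurableSet.inter ?_ (MeasurableSet.iInter fun j => MeasurableSet.iInter fun _ =>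
    MeasurableSet.iUnion fun i => ?_)
  · exact measurableSet_lt habs (measurable_nat_index (f := fun n (p : X × ℝ) => 𝒜.radius n p.1)
      (𝒜.measurable_index.comp measurable_fst) fun n => (𝒜.measurable_radius n).comp measurable_fst)
  · exact measurableSet_lt habs ((𝒜.measurable_radius i).comp
      (measurable_fst.comp (𝒜.measurable_chain j)))

variable [T2Space X] {x : X}

/-- A chart follows the geodesic up to sign, so the two jumps from `geo x ((j + 1) δ)` are the
points at times `j δ` and `(j + 2) δ`. On a noncompact leaf the geodesic is injective, which makes
comparison with the previous point decisive. -/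
theorem BoxAtlas.chain_eq_geo (hx : ¬ IsCompact (leaf x)) {δ : ℝ} {n : ℕ} (h : 𝒜.Valid x δ n)
    {j : ℕ} (hj : j ≤ n) : j * δ ∈ 𝒜.dom x ∧ 𝒜.geo x (j * δ) = (𝒜.chain x δ j).1 := by
  classical
  -- The recursion looks two points back, so the induction carries two consecutive points.
  suffices H : ∀ j, (j ≤ n → j * δ ∈ 𝒜.dom x ∧ 𝒜.geo x (j * δ) = (𝒜.chain x δ j).1) ∧
      (j + 1 ≤ n → (j + 1 : ℕ) * δ ∈ 𝒜.dom x ∧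
        𝒜.geo x ((j + 1 : ℕ) * δ) = (𝒜.chain x δ (j + 1)).1) from (H j).1 hj
  intro j
  induction j with
  | zero =>
    refine ⟨fun _ => ?_, fun _ => ?_⟩
    · simp only [Nat.cast_zero, zero_mul]
      exact ⟨𝒜.zero_mem_dom, 𝒜.geo_zero x⟩
    · have hs := 𝒜.isGeodesic_chart x
      have hm := abs_lt.1 h.1
      simp only [zero_add, Nat.cast_one, one_mul]
      exact ⟨⟨_, _, hs, hm⟩, hs.geo_eq hm⟩
  | succ j ih =>
    refine ⟨ih.2, fun hj2 => ?_⟩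
    obtain ⟨d0, g0⟩ := ih.1 (by omega)
    obtain ⟨d1, g1⟩ := ih.2 (by omega)
    set y := (𝒜.chain x δ (j + 1)).1 with hy
    have hy2 : y = (𝒜.chain x δ j).2 := rfl
    have hrad := 𝒜.jumpIndex_spec (h.2 (j + 1) (by omega))
    rw [← hy] at hrad
    set i := 𝒜.jumpIndex y |δ| with hi
    have hpos : 0 < 𝒜.radius i y := (abs_nonneg δ).trans_lt hrad
    have m1 := abs_lt.1 hrad
    have m2 : -δ ∈ Ioo (-𝒜.radius i y) (𝒜.radius i y) := ⟨by linarith [m1.2], by linarith [m1.1]⟩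
    obtain ⟨σ, hσ, hext⟩ := 𝒜.geo_extend_of_eq (𝒜.lengthArc_chart hpos) (u := 0)
      ⟨neg_lt_zero.2 hpos, hpos⟩ d1 (g1.trans (𝒜.chart_zero hpos).symm)
    have e1 : 𝒜.jump y δ = 𝒜.chart i y δ := rfl
    have e2 : 𝒜.jump y (-δ) = 𝒜.chart i y (-δ) := by
      rw [BoxAtlas.jump, abs_neg]
    have p1 := hext δ m1
    have p2 := hext (-δ) m2
    simp only [sub_zero] at p1 p2
    rw [← e1] at p1
    rw [← e2] at p2
    have hup : ((j + 1 : ℕ) : ℝ) * δ + δ = (j + 1 + 1 : ℕ) * δ := by push_cast; ring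
    have hdn : ((j + 1 : ℕ) : ℝ) * δ - δ = j * δ := by push_cast; ring
    have hch : (𝒜.chain x δ (j + 1 + 1)).1 = (𝒜.chain x δ (j + 1)).2 := rfl
    have hch2 : (𝒜.chain x δ (j + 1)).2 = if 𝒜.jump y δ = (𝒜.chain x δ j).1 then
        𝒜.jump y (-δ) else 𝒜.jump y δ := rfl
    rw [hch, hch2]
    rcases hσ with rfl | rfl
    · rw [one_mul, hup] at p1
      refine ⟨p1.1, ?_⟩
      split_ifs with hif
      -- Here the jump in question goes forward; it can return the previous point only if `δ = 0`,
      -- when both jumps coincide.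
      · have := 𝒜.injOn_geo hx p1.1 d0 (p1.2.trans (hif.trans g0.symm))
        have hδ : δ = 0 := by push_cast at this; linarith
        rw [p1.2, hδ, neg_zero]
      · exact p1.2
    · rw [show ((j + 1 : ℕ) : ℝ) * δ + -1 * δ = (j + 1 : ℕ) * δ - δ by ring, hdn] at p1
      rw [show ((j + 1 : ℕ) : ℝ) * δ + -1 * -δ = (j + 1 : ℕ) * δ + δ by ring, hup] at p2
      rw [if_pos (p1.2.symm.trans g0)]
      exact p2

theorem BoxAtlas.radius_chart {i : ℕ} {z : X} {τ : ℝ} (h : |τ| < 𝒜.radius i z) :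
    𝒜.radius i z - |τ| ≤ 𝒜.radius i (𝒜.chart i z τ) := by
  have hz := BoxAtlas.mem_of_radius_pos ((abs_nonneg τ).trans_lt h)
  have hw := 𝒜.chart_mem h
  rw [𝒜.radius_eq hw.1, 𝒜.coord_chart h, Box.E_eq_of_mem_plaque hz hw, 𝒜.radius_eq hz]
  refine le_min ?_ ?_
  · linarith [min_le_left (𝒜.coord i z) (𝒜.coord i ((𝒜.box i).E z 1) - 𝒜.coord i z), neg_abs_le τ]
  · linarith [min_le_right (𝒜.coord i z) (𝒜.coord i ((𝒜.box i).E z 1) - 𝒜.coord i z),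
      le_abs_self τ]

/-- Along the compact arc from time `0` to time `r`, some box has radius above a uniform `η` at each
point, so every sufficiently small step is valid. -/
theorem BoxAtlas.exists_valid (hx : ¬ IsCompact (leaf x)) {r : ℝ} (hr : r ∈ 𝒜.dom x) :
    ∃ n : ℕ, 𝒜.Valid x (r / (n + 1 : ℕ)) (n + 1) := by
  have hG := 𝒜.isGeodesic_geo x
  have hsub : uIcc 0 r ⊆ 𝒜.dom x := by
    have := 𝒜.ordConnected_dom (x := x)
    exact this.uIcc_subset hG.zero_mem hr
  obtain ⟨η, hη, hηr⟩ : ∃ η > 0, ∀ u ∈ uIcc 0 r, ∃ i, η < 𝒜.radius i (𝒜.geo x u) := by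
    refine (isCompact_uIcc (a := (0 : ℝ)) (b := r)).induction_on
      (p := fun S => ∃ η > 0, ∀ u ∈ S, ∃ i, η < 𝒜.radius i (𝒜.geo x u))
      ⟨1, one_pos, by simp⟩ ?_ ?_ ?_
    · rintro s t hst ⟨η, hη, h⟩
      exact ⟨η, hη, fun u hu => h u (hst hu)⟩
    · rintro s t ⟨η, hη, h⟩ ⟨η', hη', h'⟩
      refine ⟨min η η', lt_min hη hη', ?_⟩
      rintro u (hu | hu)
      · obtain ⟨i, hi⟩ := h u hu
        exact ⟨i, (min_le_left _ _).trans_lt hi⟩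
      · obtain ⟨i, hi⟩ := h' u hu
        exact ⟨i, (min_le_right _ _).trans_lt hi⟩
    · intro u hu
      set z := 𝒜.geo x u
      obtain ⟨i, hi⟩ := 𝒜.exists_radius_pos z
      set ε := 𝒜.radius i z
      obtain ⟨σ, hσ, hext⟩ := 𝒜.geo_extend_of_eq (𝒜.lengthArc_chart hi) (u := 0)
        ⟨neg_lt_zero.2 hi, hi⟩ (hsub hu) (𝒜.chart_zero hi).symm
      have hσ2 : σ * σ = 1 := by rcases hσ with rfl | rfl <;> norm_num
      have hσa : |σ| = 1 := by rcases hσ with rfl | rfl <;> norm_num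
      -- Within distance `ε / 2` of `z` the radius of the same box stays above `ε / 2`, in
      -- particular above `ε / 4`.
      refine ⟨Ioo (u - ε / 2) (u + ε / 2), mem_nhdsWithin_of_mem_nhds
        (Ioo_mem_nhds (by linarith) (by linarith)), ε / 4, by positivity, fun v hv => ⟨i, ?_⟩⟩
      have hτ : |σ * (v - u)| < ε / 2 := by
        rw [abs_mul, hσa, one_mul, abs_lt]
        constructor <;> linarith [hv.1, hv.2]
      have hτ' : |σ * (v - u)| < ε := by linarith
      have h2 := (hext (σ * (v - u)) (abs_lt.1 hτ')).2
      rw [show u + σ * (σ * (v - u) - 0) = v by linear_combination (v - u) * hσ2] at h2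
      rw [h2]
      have := 𝒜.radius_chart hτ'
      linarith
  obtain ⟨n, hn⟩ := exists_nat_gt (|r| / min η (𝒜.radius (𝒜.index x) x))
  have hmin : 0 < min η (𝒜.radius (𝒜.index x) x) := lt_min hη (𝒜.radius_index_pos x)
  rw [div_lt_iff₀ hmin] at hn
  refine ⟨n, ?_⟩
  have hn1 : (0 : ℝ) < (n + 1 : ℕ) := by positivity
  have hδ : |r / (n + 1 : ℕ)| < min η (𝒜.radius (𝒜.index x) x) := by
    rw [abs_div, abs_of_pos hn1, div_lt_iff₀ hn1]
    push_cast
    nlinarith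
  set δ := r / (n + 1 : ℕ) with hδd
  -- The bound by `η` is known on the geodesic only: validity up to `m` places the `m`-th point of
  -- the chain on it, which gives validity up to `m + 1`.
  have H : ∀ m, m ≤ n + 1 → 𝒜.Valid x δ m := by
    intro m
    induction m with
    | zero => exact fun _ => ⟨hδ.trans_le (min_le_right _ _), fun j hj => absurd hj (by omega)⟩
    | succ m ih =>
      intro hm
      have hv := ih (by omega)
      refine ⟨hv.1, fun j hj => ?_⟩
      rcases Nat.lt_succ_iff_lt_or_eq.1 hj with h | h
      · exact hv.2 j h
      · subst h
        rw [← (𝒜.chain_eq_geo hx hv le_rfl).2]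
        obtain ⟨i, hi⟩ := hηr (j * δ) (by
          have hjn : (j : ℝ) / (n + 1 : ℕ) ≤ 1 := by
            rw [div_le_one hn1]; exact_mod_cast (by omega : j ≤ n + 1)
          have hj0 : 0 ≤ (j : ℝ) / (n + 1 : ℕ) := by positivity
          have he : (j : ℝ) * δ = (j : ℝ) / (n + 1 : ℕ) * r := by rw [hδd]; ring
          rw [he, mem_uIcc]
          rcases le_total 0 r with h0 | h0
          · left; constructor <;> nlinarith
          · right; constructor <;> nlinarith)
        exact ⟨i, (hδ.trans_le (min_le_left _ _)).trans hi⟩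
  exact H _ le_rfl

open Classical in
variable (𝒜) in
/-- A Borel function which is equal to the geodesics on the noncompact leaves. -/
noncomputable def BoxAtlas.flow (x : X) (r : ℝ) : X :=
  if h : ∃ n : ℕ, 𝒜.Valid x (r / (n + 1 : ℕ)) (n + 1) then
    (𝒜.chain x (r / (Nat.find h + 1 : ℕ)) (Nat.find h + 1)).1 else x

variable (𝒜) in
-- A Borel substitute for the set of pairs with `r ∈ dom x`; the two agree over noncompact leaves
-- (`mem_borelDom`).
def BoxAtlas.borelDom : Set (X × ℝ) := {p | ∃ n : ℕ, 𝒜.Valid p.1 (p.2 / (n + 1 : ℕ)) (n + 1)}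

theorem BoxAtlas.measurableSet_valid_div (n : ℕ) :
    MeasurableSet {p : X × ℝ | 𝒜.Valid p.1 (p.2 / (n + 1 : ℕ)) (n + 1)} := by
  have : Measurable fun p : X × ℝ => (p.1, p.2 / ((n + 1 : ℕ) : ℝ)) :=
    measurable_fst.prodMk (measurable_snd.div_const _)
  exact this (𝒜.measurableSet_valid (n + 1))

theorem BoxAtlas.measurableSet_borelDom : MeasurableSet 𝒜.borelDom := by
  have : 𝒜.borelDom = ⋃ n : ℕ, {p : X × ℝ | 𝒜.Valid p.1 (p.2 / (n + 1 : ℕ)) (n + 1)} := by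
    ext p; simp [BoxAtlas.borelDom]
  rw [this]
  exact MeasurableSet.iUnion 𝒜.measurableSet_valid_div

theorem BoxAtlas.measurable_flow : Measurable fun p : X × ℝ => 𝒜.flow p.1 p.2 := by
  classical
  let f : ℕ → X × ℝ → X := fun n p => (𝒜.chain p.1 (p.2 / (n + 1 : ℕ)) (n + 1)).1
  have hf : ∀ n, Measurable (f n) := fun n => measurable_fst.comp
    ((𝒜.measurable_chain (n + 1)).comp (measurable_fst.prodMk (measurable_snd.div_const _)))
  have h1 : Measurable fun p : 𝒜.borelDom => f (Nat.find p.2) p :=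
    Measurable.find (f := fun n (p : 𝒜.borelDom) => f n p)
      (p := fun n (p : 𝒜.borelDom) => 𝒜.Valid p.1.1 (p.1.2 / (n + 1 : ℕ)) (n + 1))
      (fun n => (hf n).comp measurable_subtype_coe)
      (fun n => measurable_subtype_coe (𝒜.measurableSet_valid_div n)) fun p => p.2
  exact Measurable.dite (s := 𝒜.borelDom) h1 (measurable_fst.comp measurable_subtype_coe)
    𝒜.measurableSet_borelDom

theorem BoxAtlas.mem_borelDom (hx : ¬ IsCompact (leaf x)) {r : ℝ} :
    (x, r) ∈ 𝒜.borelDom ↔ r ∈ 𝒜.dom x := by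
  refine ⟨fun ⟨n, hn⟩ => ?_, fun h => 𝒜.exists_valid hx h⟩
  have := (𝒜.chain_eq_geo hx hn le_rfl).1
  rwa [mul_div_cancel₀ _ (by positivity)] at this

theorem BoxAtlas.flow_eq_geo (hx : ¬ IsCompact (leaf x)) {r : ℝ} (hr : r ∈ 𝒜.dom x) :
    𝒜.flow x r = 𝒜.geo x r := by
  classical
  have h := 𝒜.exists_valid hx hr
  rw [BoxAtlas.flow, dif_pos h, ← (𝒜.chain_eq_geo hx (Nat.find_spec h) le_rfl).2,
    mul_div_cancel₀ _ (by positivity)]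

end BorelGeodesic

/-! ### Stretching an interval onto the line, equivariantly -/

section Stretch

/-- The open intervals containing zero, possibly unbounded. -/
def interval (a b : ℝ) : Set ℝ := {u | 0 < 1 + a * u ∧ 0 < 1 - b * u}

/-- An increasing bijection from `interval a b` to the line. -/
noncomputable def stretch (a b u : ℝ) : ℝ := u + Real.log (1 + a * u) - Real.log (1 - b * u)

variable {a b a' b' : ℝ}

theorem isOpen_interval : IsOpen (interval a b) :=
  show IsOpen ({u : ℝ | 0 < 1 + a * u} ∩ {u : ℝ | 0 < 1 - b * u}) from
    (isOpen_lt continuous_const (by fun_prop)).inter (isOpen_lt continuous_const (by fun_prop))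

theorem ordConnected_interval (ha : 0 ≤ a) (hb : 0 ≤ b) : (interval a b).OrdConnected := by
  refine ⟨fun u hu v hv w hw => ⟨?_, ?_⟩⟩
  · have := hu.1; have := mul_le_mul_of_nonneg_left hw.1 ha; linarith
  · have := hv.2; have := mul_le_mul_of_nonneg_left hw.2 hb; linarith

theorem zero_mem_interval : (0 : ℝ) ∈ interval a b := by simp [interval]

theorem neg_mem_interval {u : ℝ} : -u ∈ interval a b ↔ u ∈ interval b a := by
  simp only [interval, mem_ofPred_eq, mul_neg, ← sub_eq_add_neg, sub_neg_eq_add]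
  exact and_comm

theorem stretch_neg (u : ℝ) : stretch a b (-u) = -stretch b a u := by
  simp only [stretch, mul_neg, ← sub_eq_add_neg, sub_neg_eq_add]
  ring

theorem stretch_zero : stretch a b 0 = 0 := by simp [stretch]

theorem strictMonoOn_stretch (ha : 0 ≤ a) (hb : 0 ≤ b) :
    StrictMonoOn (stretch a b) (interval a b) := by
  intro u hu v hv huv
  have h1 : Real.log (1 + a * u) ≤ Real.log (1 + a * v) :=
    Real.log_le_log hu.1 (by nlinarith)
  have h2 : Real.log (1 - b * v) ≤ Real.log (1 - b * u) :=
    Real.log_le_log hv.2 (by nlinarith)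
  unfold stretch
  linarith

theorem continuousOn_stretch : ContinuousOn (stretch a b) (interval a b) := by
  unfold stretch
  refine (continuousOn_id.add (ContinuousOn.log (by fun_prop) fun u hu => hu.1.ne')).sub
    (ContinuousOn.log (by fun_prop) fun u hu => hu.2.ne')

/-- If `b = 0`, the interval is unbounded on the right and the linear term suffices. Otherwise the
witness solves `1 - b * u = exp (-r)`. -/
theorem exists_le_stretch (ha : 0 ≤ a) (hb : 0 ≤ b) {r : ℝ} (hr : 0 ≤ r) :
    ∃ u ∈ interval a b, 0 ≤ u ∧ r ≤ stretch a b u := by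
  rcases eq_or_lt_of_le hb with rfl | hb
  · refine ⟨r, ⟨by positivity, by simp⟩, hr, ?_⟩
    have : 0 ≤ Real.log (1 + a * r) := Real.log_nonneg (by nlinarith)
    simp [stretch, this]
  · have he : Real.exp (-r) ≤ 1 := Real.exp_le_one_iff.2 (by linarith)
    have hu : 0 ≤ (1 - Real.exp (-r)) / b := div_nonneg (by linarith) hb.le
    have hbu : 1 - b * ((1 - Real.exp (-r)) / b) = Real.exp (-r) := by field_simp; ring
    refine ⟨(1 - Real.exp (-r)) / b, ⟨by positivity, by rw [hbu]; exact Real.exp_pos _⟩, hu, ?_⟩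
    have : 0 ≤ Real.log (1 + a * ((1 - Real.exp (-r)) / b)) := Real.log_nonneg (by nlinarith)
    rw [stretch, hbu, Real.log_exp]
    linarith

theorem exists_stretch_eq (ha : 0 ≤ a) (hb : 0 ≤ b) (r : ℝ) : ∃ u ∈ interval a b,
    stretch a b u = r := by
  obtain ⟨v, hv, hv0, hvr⟩ := exists_le_stretch ha hb (abs_nonneg r)
  obtain ⟨w, hw, hw0, hwr⟩ := exists_le_stretch hb ha (abs_nonneg r)
  have hw' := neg_mem_interval.2 hw
  have hsub := (ordConnected_interval ha hb).out hw' hv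
  obtain ⟨u, hu, hur⟩ := intermediate_value_Icc (by linarith)
    ((continuousOn_stretch (a := a) (b := b)).mono hsub)
    (show r ∈ _ from ⟨by rw [stretch_neg]; linarith [neg_abs_le r], by linarith [le_abs_self r]⟩)
  exact ⟨u, hsub hu, hur⟩

open Classical in
/-- The inverse of `stretch a b`. -/
noncomputable def unstretch (a b r : ℝ) : ℝ :=
  if h : 0 ≤ a ∧ 0 ≤ b then (exists_stretch_eq h.1 h.2 r).choose else 0

theorem unstretch_mem (ha : 0 ≤ a) (hb : 0 ≤ b) (r : ℝ) : unstretch a b r ∈ interval a b := by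
  rw [unstretch, dif_pos ⟨ha, hb⟩]
  exact (exists_stretch_eq ha hb r).choose_spec.1

theorem stretch_unstretch (ha : 0 ≤ a) (hb : 0 ≤ b) (r : ℝ) :
    stretch a b (unstretch a b r) = r := by
  rw [unstretch, dif_pos ⟨ha, hb⟩]
  exact (exists_stretch_eq ha hb r).choose_spec.2

theorem unstretch_eq (ha : 0 ≤ a) (hb : 0 ≤ b) {r u : ℝ} (hu : u ∈ interval a b)
    (h : stretch a b u = r) : unstretch a b r = u :=
  (strictMonoOn_stretch ha hb).injOn (unstretch_mem ha hb r) hu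
    ((stretch_unstretch ha hb r).trans h.symm)

theorem continuous_unstretch (ha : 0 ≤ a) (hb : 0 ≤ b) : Continuous (unstretch a b) := by
  rw [continuous_iff_continuousAt]
  intro r
  have hu := unstretch_mem ha hb r
  rw [Metric.continuousAt_iff']
  intro η hη
  obtain ⟨δ, hδ, hball⟩ := Metric.nhds_basis_closedBall.mem_iff.1 (isOpen_interval.mem_nhds hu)
  rw [Real.closedBall_eq_Icc] at hball
  set u := unstretch a b r with hud
  set θ := min δ (η / 2)
  have hθ : 0 < θ := lt_min hδ (by linarith)
  have m1 : u - θ ∈ interval a b := hball ⟨by linarith [min_le_left δ (η / 2)], by linarith⟩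
  have m2 : u + θ ∈ interval a b := hball ⟨by linarith, by linarith [min_le_left δ (η / 2)]⟩
  have hm := strictMonoOn_stretch ha hb
  have s1 : stretch a b (u - θ) < r := by
    rw [← stretch_unstretch ha hb r]; exact hm m1 hu (by linarith)
  have s2 : r < stretch a b (u + θ) := by
    conv_lhs => rw [← stretch_unstretch ha hb r]
    exact hm hu m2 (by linarith)
  filter_upwards [Ioo_mem_nhds s1 s2] with q hq
  have hv := unstretch_mem ha hb q
  rw [← stretch_unstretch ha hb q] at hq
  have l1 := (hm.lt_iff_lt m1 hv).1 hq.1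
  have l2 := (hm.lt_iff_lt hv m2).1 hq.2
  rw [Real.dist_eq, abs_lt]
  constructor <;> linarith [min_le_right δ (η / 2)]

theorem measurable_unstretch : Measurable fun p : (ℝ × ℝ) × ℝ => unstretch p.1.1 p.1.2 p.2 := by
  apply measurable_of_measurableSet_graph
  have : {p : ((ℝ × ℝ) × ℝ) × ℝ | unstretch p.1.1.1 p.1.1.2 p.1.2 = p.2} =
      (({p | 0 ≤ p.1.1.1} ∩ {p | 0 ≤ p.1.1.2}) ∩
        (({p | 0 < 1 + p.1.1.1 * p.2} ∩ {p | 0 < 1 - p.1.1.2 * p.2}) ∩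
          {p | stretch p.1.1.1 p.1.1.2 p.2 = p.1.2})) ∪
      (({p | 0 ≤ p.1.1.1} ∩ {p | 0 ≤ p.1.1.2})ᶜ ∩ {p | 0 = p.2}) := by
    ext ⟨⟨⟨a, b⟩, r⟩, u⟩
    simp only [mem_ofPred_eq, mem_union, mem_inter_iff, mem_compl_iff]
    by_cases h : 0 ≤ a ∧ 0 ≤ b
    · simp only [h, and_self, true_and, not_true, false_and, or_false]
      constructor
      · rintro rfl
        exact ⟨unstretch_mem h.1 h.2 r, stretch_unstretch h.1 h.2 r⟩
      · rintro ⟨h1, h2⟩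
        exact unstretch_eq h.1 h.2 h1 h2
    · simp only [h, false_and, not_false_eq_true, true_and, false_or]
      rw [unstretch, dif_neg h]
  rw [this]
  have ma : Measurable fun p : ((ℝ × ℝ) × ℝ) × ℝ => p.1.1.1 := by fun_prop
  have mb : Measurable fun p : ((ℝ × ℝ) × ℝ) × ℝ => p.1.1.2 := by fun_prop
  have m0 : MeasurableSet ({p : ((ℝ × ℝ) × ℝ) × ℝ | 0 ≤ p.1.1.1} ∩ {p | 0 ≤ p.1.1.2}) :=
    (measurableSet_le measurable_const ma).inter (measurableSet_le measurable_const mb)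
  refine (m0.inter (MeasurableSet.inter ?_ ?_)).union
    (m0.compl.inter (measurableSet_eq_fun measurable_const measurable_snd))
  · exact (measurableSet_lt measurable_const (by fun_prop)).inter
      (measurableSet_lt measurable_const (by fun_prop))
  · refine measurableSet_eq_fun ?_ (by fun_prop)
    unfold stretch
    fun_prop

/-- The ends are `-1/a` and `1/b`, infinite when the slope is zero: if `b < b'`, the point `1/b'`
separates the two intervals. -/
theorem interval_injective (ha : 0 ≤ a) (hb : 0 ≤ b) (ha' : 0 ≤ a') (hb' : 0 ≤ b')
    (h : interval a b = interval a' b') : a = a' ∧ b = b' := by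
  have key : ∀ {a b a' b' : ℝ}, 0 ≤ a → 0 ≤ b → 0 ≤ b' → interval a b ⊆ interval a' b' → b' ≤ b := by
    intro a b a' b' ha hb hb' h
    by_contra hn
    push Not at hn
    have hpos : 0 < b' := hb.trans_lt hn
    have : b'⁻¹ ∈ interval a b := by
      refine ⟨by positivity, ?_⟩
      rw [← div_eq_mul_inv, sub_pos, div_lt_one hpos]
      exact hn
    have := (h this).2
    rw [mul_inv_cancel₀ hpos.ne'] at this
    linarith
  have hsw : interval b a = interval b' a' := by
    ext u
    rw [← neg_mem_interval, h, neg_mem_interval]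
  exact ⟨le_antisymm (key hb' ha' ha hsw.ge) (key hb ha ha' hsw.le),
    le_antisymm (key ha' hb' hb h.ge) (key ha hb hb' h.le)⟩

/-- Change of origin in an interval. -/
theorem stretch_translate (ha : 0 ≤ a) (hb : 0 ≤ b) (ha' : 0 ≤ a') (hb' : 0 ≤ b') {u σ : ℝ}
    (hu : u ∈ interval a b) (hσ : σ = 1 ∨ σ = -1)
    (h : ∀ q, q ∈ interval a' b' ↔ u + σ * q ∈ interval a b) {q : ℝ} (hq : q ∈ interval a' b') :
    stretch a b (u + σ * q) = stretch a b u + σ * stretch a' b' q := by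
  have hu1 := hu.1
  have hu2 := hu.2
  -- Moving the origin to `u` multiplies each affine factor by a constant, which the logarithm turns
  -- into an additive constant. This dictates the form of `stretch`.
  have f1 : ∀ t, 1 + a * (u + t) = (1 + a * u) * (1 + a / (1 + a * u) * t) := fun t => by
    field_simp; ring
  have f2 : ∀ t, 1 - b * (u + t) = (1 - b * u) * (1 - b / (1 - b * u) * t) := fun t => by
    field_simp; ring
  have ha1 : 0 ≤ a / (1 + a * u) := by positivity
  have hb1 : 0 ≤ b / (1 - b * u) := by positivity
  have hmem : ∀ t, u + t ∈ interval a b ↔ t ∈ interval (a / (1 + a * u)) (b / (1 - b * u)) := by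
    intro t
    simp only [interval, mem_ofPred_eq, f1, f2, mul_pos_iff_of_pos_left hu1,
      mul_pos_iff_of_pos_left hu2]
  have hst : ∀ t, u + t ∈ interval a b → stretch a b (u + t) =
      stretch a b u + stretch (a / (1 + a * u)) (b / (1 - b * u)) t := by
    intro t ht
    have ht' := (hmem t).1 ht
    simp only [stretch, f1, f2]
    rw [Real.log_mul hu1.ne' ht'.1.ne', Real.log_mul hu2.ne' ht'.2.ne']
    ring
  rw [hst _ ((h q).1 hq)]
  -- The new interval determines its slopes, which are exchanged by a reflection.
  rcases hσ with rfl | rfl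
  · obtain ⟨e1, e2⟩ := interval_injective ha' hb' ha1 hb1 (by
      ext t; rw [h, hmem, one_mul])
    rw [one_mul, one_mul, e1, e2]
  · obtain ⟨e1, e2⟩ := interval_injective ha' hb' hb1 ha1 (by
      ext t; rw [h, hmem, neg_one_mul, neg_mem_interval])
    rw [neg_one_mul, stretch_neg, neg_one_mul, e1, e2]

end Stretch

/-! ### The pseudo-flow of a one-dimensional foliation -/

section PseudoFlow

/-- A Borel parametrization of the noncompact leaves by the line, starting at any point, which
only depends on the starting point up to an isometry of the line. -/
structure IsPseudoFlow {X : Type*} [TopologicalSpace X] [MeasurableSpace X] (k : X → ℝ → X) :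
    Prop where
  measurable : Measurable fun p : X × ℝ => k p.1 p.2
  zero : ∀ x, ¬ IsCompact (leaf x) → k x 0 = x
  continuous : ∀ x, ¬ IsCompact (leaf x) → Continuous (k x)
  injective : ∀ x, ¬ IsCompact (leaf x) → Function.Injective (k x)
  range : ∀ x, ¬ IsCompact (leaf x) → Set.range (k x) = leaf x
  isOpenMap : ∀ x, ¬ IsCompact (leaf x) → IsOpenMap (k x)
  translate : ∀ x, ¬ IsCompact (leaf x) → ∀ r, ∃ σ : ℝ, (σ = 1 ∨ σ = -1) ∧
    ∀ q, k (k x r) q = k x (r + σ * q)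

variable {X : Type*} [TopologicalSpace X] [MeasurableSpace X] [StandardBorelSpace X] [T2Space X]
  {𝒜 : BoxAtlas X} {x : X}

open Classical in
variable (𝒜) in
/-- The inverse of the length of a half-leaf. -/
noncomputable def BoxAtlas.slope (ε : ℝ) (x : X) : ℝ :=
  (⨅ r : ℚ, if 0 < r ∧ (x, ε * (r : ℝ)) ∈ 𝒜.borelDom then ENNReal.ofReal (1 / r) else ⊤).toReal

theorem BoxAtlas.slope_nonneg (ε : ℝ) (x : X) : 0 ≤ 𝒜.slope ε x := ENNReal.toReal_nonneg

theorem BoxAtlas.measurable_slope (ε : ℝ) : Measurable (𝒜.slope ε) := by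
  classical
  refine Measurable.ennreal_toReal (Measurable.iInf fun r => ?_)
  refine Measurable.ite ?_ measurable_const measurable_const
  by_cases hr : 0 < r
  · simp only [hr, true_and]
    exact (measurable_id.prodMk measurable_const : Measurable fun x : X => (x, ε * (r : ℝ)))
      𝒜.measurableSet_borelDom
  · simp only [hr, false_and]
    exact MeasurableSet.empty

/-- The domain is an open interval, so rational times suffice to find its ends and the infimum stays
countable, hence Borel. Inverse lengths let an infinite half-leaf have slope `0`. -/
theorem BoxAtlas.slope_mul_lt_one (hx : ¬ IsCompact (leaf x)) {ε u : ℝ}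
    (hε : ε = 1 ∨ ε = -1) (hu : 0 < u) : 𝒜.slope ε x * u < 1 ↔ ε * u ∈ 𝒜.dom x := by
  classical
  have hG := 𝒜.isGeodesic_geo x
  have hop : IsOpen {r : ℝ | ε * r ∈ 𝒜.dom x} := hG.isOpen.preimage (by fun_prop)
  have h0 : (0 : ℝ) ∈ {r : ℝ | ε * r ∈ 𝒜.dom x} := by
    rw [mem_ofPred_eq, mul_zero]; exact hG.zero_mem
  have hex : ∀ v : ℝ, 0 ≤ v → ε * v ∈ 𝒜.dom x → ∃ r : ℚ, v < r ∧ ε * (r : ℝ) ∈ 𝒜.dom x := by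
    intro v _ hv
    obtain ⟨δ, hδ, hb⟩ := Metric.mem_nhds_iff.1 (hop.mem_nhds hv)
    rw [Real.ball_eq_Ioo] at hb
    obtain ⟨r, h1, h2⟩ := exists_rat_btwn (show v < v + δ by linarith)
    exact ⟨r, h1, hb ⟨by linarith, h2⟩⟩
  set β := ⨅ r : ℚ, if 0 < r ∧ (x, ε * (r : ℝ)) ∈ 𝒜.borelDom then ENNReal.ofReal (1 / r) else ⊤
    with hβ
  have hle : ∀ r : ℚ, 0 < r → ε * (r : ℝ) ∈ 𝒜.dom x → β ≤ ENNReal.ofReal (1 / r) := by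
    intro r hr hd
    refine (iInf_le _ r).trans ?_
    rw [if_pos ⟨hr, (𝒜.mem_borelDom hx).2 hd⟩]
  have htop : β ≠ ⊤ := by
    obtain ⟨r, h1, h2⟩ := hex 0 le_rfl h0
    exact ((hle r (by exact_mod_cast h1) h2).trans_lt ENNReal.ofReal_lt_top).ne
  have hsl : 𝒜.slope ε x = β.toReal := by rw [hβ]; unfold BoxAtlas.slope; congr
  rw [hsl, ← lt_div_iff₀ hu]
  constructor
  · intro h
    rw [← ENNReal.lt_ofReal_iff_toReal_lt htop] at h
    obtain ⟨r, hr⟩ := iInf_lt_iff.1 h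
    split_ifs at hr with hc
    · have hd := (𝒜.mem_borelDom hx).1 hc.2
      rw [ENNReal.ofReal_lt_ofReal_iff (by positivity)] at hr
      have hr0 : (0 : ℝ) < r := by exact_mod_cast hc.1
      have hur : u < r := (one_div_lt_one_div hr0 hu).1 hr
      have hoc := 𝒜.ordConnected_dom (x := x)
      rcases hε with rfl | rfl
      · exact hoc.out hG.zero_mem hd ⟨by linarith, by linarith⟩
      · exact hoc.out hd hG.zero_mem ⟨by linarith, by linarith⟩
    · exact absurd hr not_top_lt
  · intro h
    obtain ⟨r, h1, h2⟩ := hex u hu.le h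
    have hr0 : (0 : ℝ) < r := hu.trans h1
    have := ENNReal.toReal_mono ENNReal.ofReal_ne_top (hle r (by exact_mod_cast hr0) h2)
    rw [ENNReal.toReal_ofReal (by positivity)] at this
    exact this.trans_lt (one_div_lt_one_div_of_lt hu h1)

theorem BoxAtlas.dom_eq_interval (hx : ¬ IsCompact (leaf x)) :
    𝒜.dom x = interval (𝒜.slope (-1) x) (𝒜.slope 1 x) := by
  ext u
  have h1 := 𝒜.slope_nonneg 1 x
  have h2 := 𝒜.slope_nonneg (-1) x
  rcases lt_trichotomy u 0 with hu | rfl | hu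
  · have := 𝒜.slope_mul_lt_one hx (Or.inr rfl) (neg_pos.2 hu)
    rw [neg_one_mul, neg_neg] at this
    rw [← this]
    refine ⟨fun h => ⟨by linarith, by nlinarith⟩, fun h => by linarith [h.1]⟩
  · exact ⟨fun _ => zero_mem_interval, fun _ => 𝒜.zero_mem_dom⟩
  · have := 𝒜.slope_mul_lt_one hx (Or.inl rfl) hu
    rw [one_mul] at this
    rw [← this]
    refine ⟨fun h => ⟨by nlinarith, by linarith⟩, fun h => by linarith [h.2]⟩

theorem BoxAtlas.UnitSpeedAt.comp_affine {f : ℝ → X} {u σ q : ℝ} (hσ : σ = 1 ∨ σ = -1)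
    (h : 𝒜.UnitSpeedAt f (u + σ * q)) : 𝒜.UnitSpeedAt (fun r => f (u + σ * r)) q := by
  rcases hσ with rfl | rfl
  · have e : (fun r => f (u + 1 * r)) = fun r => f (r + u) := by
      ext r; congr 1; ring
    rw [e]
    refine BoxAtlas.UnitSpeedAt.comp_add ?_
    convert h using 1; ring
  · have e : (fun r => f (u + -1 * r)) = fun r => f (u - r) := by
      ext r; congr 1; ring
    rw [e]
    refine BoxAtlas.UnitSpeedAt.comp_sub ?_
    convert h using 1; ring

theorem isPreconnected_preimage_affine {I : Set ℝ} (hI : IsPreconnected I) {u σ : ℝ}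
    (hσ : σ = 1 ∨ σ = -1) : IsPreconnected {q | u + σ * q ∈ I} := by
  have hσ2 : σ * σ = 1 := by rcases hσ with rfl | rfl <;> norm_num
  have : {q | u + σ * q ∈ I} = (fun r => σ * (r - u)) '' I := by
    ext r
    constructor
    · intro hr
      refine ⟨_, hr, ?_⟩
      linear_combination r * hσ2
    · rintro ⟨τ, hτ, rfl⟩
      rw [mem_ofPred_eq]
      convert hτ using 1
      linear_combination (τ - u) * hσ2
  rw [this]
  exact hI.image _ (by fun_prop)

/-- By rigidity the two geodesics agree near the common point up to an isometry of time; each is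
maximal, so the isometry exchanges the whole domains. -/
theorem BoxAtlas.geo_translate {u : ℝ} (hu : u ∈ 𝒜.dom x) :
    ∃ σ : ℝ, (σ = 1 ∨ σ = -1) ∧ ∀ q, (q ∈ 𝒜.dom (𝒜.geo x u) ↔ u + σ * q ∈ 𝒜.dom x) ∧
      (q ∈ 𝒜.dom (𝒜.geo x u) → 𝒜.geo x (u + σ * q) = 𝒜.geo (𝒜.geo x u) q) := by
  have hx := 𝒜.isGeodesic_geo x
  set z := 𝒜.geo x u with hz
  have hzG := 𝒜.isGeodesic_geo z
  obtain ⟨σ, hσ, hev⟩ := (hx.unitSpeedAt u hu).rigid (hzG.unitSpeedAt 0 𝒜.zero_mem_dom)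
    (𝒜.geo_zero z).symm
  have hσ2 : σ * σ = 1 := by rcases hσ with rfl | rfl <;> norm_num
  simp only [zero_add] at hev
  obtain ⟨h1, h2⟩ := 𝒜.geo_extend (x := z) (J := {q | u + σ * q ∈ 𝒜.dom x})
    (f := fun q => 𝒜.geo x (u + σ * q)) (hx.isOpen.preimage (by fun_prop))
    (isPreconnected_preimage_affine hx.isPreconnected hσ)
    (fun q hq => (hx.unitSpeedAt _ hq).comp_affine hσ) (t := 0)
    (by rwa [mem_ofPred_eq, mul_zero, add_zero]) 𝒜.zero_mem_dom
    (hev.mono fun τ h => h.symm)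
  have haff : ∀ r, -(σ * u) + σ * r = σ * (r - u) := fun r => by ring
  obtain ⟨h3, h4⟩ := 𝒜.geo_extend (x := x) (J := {r | -(σ * u) + σ * r ∈ 𝒜.dom z})
    (f := fun r => 𝒜.geo z (-(σ * u) + σ * r)) (hzG.isOpen.preimage (by fun_prop))
    (isPreconnected_preimage_affine hzG.isPreconnected hσ)
    (fun q hq => (hzG.unitSpeedAt _ hq).comp_affine hσ) (t := u)
    (by rw [mem_ofPred_eq, haff, sub_self, mul_zero]; exact 𝒜.zero_mem_dom) hu (by
      have : Tendsto (fun r => -(σ * u) + σ * r) (𝓝 u) (𝓝 0) := by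
        have hc : Continuous fun r : ℝ => -(σ * u) + σ * r := by fun_prop
        simpa using hc.tendsto u
      filter_upwards [this.eventually hev] with r hr
      rw [hr]
      congr 1
      linear_combination (r - u) * hσ2)
  have hiff : ∀ q, q ∈ 𝒜.dom z ↔ u + σ * q ∈ 𝒜.dom x := by
    refine fun q => ⟨fun hq => h3 ?_, fun hq => h1 hq⟩
    rw [mem_ofPred_eq]
    convert hq using 1
    linear_combination q * hσ2
  exact ⟨σ, hσ, fun q => ⟨hiff q, fun hq => h2 ((hiff q).1 hq)⟩⟩

variable (𝒜) in
/-- The pseudo-flow obtained by stretching the geodesics. -/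
noncomputable def BoxAtlas.line (x : X) (r : ℝ) : X :=
  𝒜.flow x (unstretch (𝒜.slope (-1) x) (𝒜.slope 1 x) r)

theorem BoxAtlas.line_eq (hx : ¬ IsCompact (leaf x)) (r : ℝ) :
    𝒜.line x r = 𝒜.geo x (unstretch (𝒜.slope (-1) x) (𝒜.slope 1 x) r) ∧
      unstretch (𝒜.slope (-1) x) (𝒜.slope 1 x) r ∈ 𝒜.dom x := by
  have : unstretch (𝒜.slope (-1) x) (𝒜.slope 1 x) r ∈ 𝒜.dom x := by
    rw [𝒜.dom_eq_interval hx]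
    exact unstretch_mem (𝒜.slope_nonneg _ _) (𝒜.slope_nonneg _ _) r
  exact ⟨𝒜.flow_eq_geo hx this, this⟩

theorem BoxAtlas.line_stretch (hx : ¬ IsCompact (leaf x)) {u : ℝ} (hu : u ∈ 𝒜.dom x) :
    𝒜.line x (stretch (𝒜.slope (-1) x) (𝒜.slope 1 x) u) = 𝒜.geo x u := by
  rw [(𝒜.line_eq hx _).1, unstretch_eq (𝒜.slope_nonneg _ _) (𝒜.slope_nonneg _ _)
    (by rwa [← 𝒜.dom_eq_interval hx]) rfl]

theorem BoxAtlas.continuous_line (hx : ¬ IsCompact (leaf x)) : Continuous (𝒜.line x) := by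
  have h := continuous_unstretch (𝒜.slope_nonneg (-1) x) (𝒜.slope_nonneg 1 x)
  have e : 𝒜.line x = 𝒜.geo x ∘ unstretch (𝒜.slope (-1) x) (𝒜.slope 1 x) :=
    funext fun r => (𝒜.line_eq hx r).1
  rw [e, continuous_iff_continuousAt]
  exact fun r => ContinuousAt.comp
    ((𝒜.isGeodesic_geo x).unitSpeedAt _ (𝒜.line_eq hx r).2).continuousAt h.continuousAt

theorem BoxAtlas.injective_line (hx : ¬ IsCompact (leaf x)) : Function.Injective (𝒜.line x) := by
  intro r s h
  have hr := 𝒜.line_eq hx r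
  have hs := 𝒜.line_eq hx s
  have := 𝒜.injOn_geo hx hr.2 hs.2 (by rw [← hr.1, ← hs.1, h])
  rw [← stretch_unstretch (𝒜.slope_nonneg (-1) x) (𝒜.slope_nonneg 1 x) r, this,
    stretch_unstretch (𝒜.slope_nonneg (-1) x) (𝒜.slope_nonneg 1 x) s]

theorem BoxAtlas.isPseudoFlow_line : IsPseudoFlow 𝒜.line where
  measurable := by
    have h1 : Measurable fun p : X × ℝ =>
        unstretch (𝒜.slope (-1) p.1) (𝒜.slope 1 p.1) p.2 :=
      measurable_unstretch.comp ((((𝒜.measurable_slope _).comp measurable_fst).prodMk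
        ((𝒜.measurable_slope _).comp measurable_fst)).prodMk measurable_snd)
    exact 𝒜.measurable_flow.comp (measurable_fst.prodMk h1)
  zero x hx := by
    have := 𝒜.line_stretch hx 𝒜.zero_mem_dom
    rwa [stretch_zero, 𝒜.geo_zero] at this
  continuous x hx := 𝒜.continuous_line hx
  injective x hx := 𝒜.injective_line hx
  range x hx := by
    rw [← 𝒜.geo_image_dom]
    ext y
    constructor
    · rintro ⟨r, rfl⟩
      exact ⟨_, (𝒜.line_eq hx r).2, (𝒜.line_eq hx r).1.symm⟩
    · rintro ⟨u, hu, rfl⟩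
      exact ⟨_, 𝒜.line_stretch hx hu⟩
  isOpenMap x hx := by
    intro O hO
    rw [isOpen_iff_mem_nhds]
    rintro _ ⟨r, hr, rfl⟩
    obtain ⟨δ, hδ, hb⟩ := Metric.isOpen_iff.1 hO r hr
    rw [Real.ball_eq_Ioo] at hb
    exact mem_of_superset (𝒜.image_Ioo_mem_nhds ⟨by linarith, by linarith⟩
      (𝒜.continuous_line hx).continuousOn (𝒜.injective_line hx).injOn) (image_mono hb)
  -- Moving the base point changes the geodesic by an isometry of time, which `stretch_translate`
  -- carries to an isometry of the line.
  translate x hx r := by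
    obtain ⟨h1, h2⟩ := 𝒜.line_eq hx r
    set u := unstretch (𝒜.slope (-1) x) (𝒜.slope 1 x) r with hu
    obtain ⟨σ, hσ, ht⟩ := 𝒜.geo_translate h2
    have hz : ¬ IsCompact (leaf (𝒜.line x r)) := by
      have hm : 𝒜.line x r ∈ leaf x := by
        rw [← 𝒜.geo_image_dom, h1]
        exact ⟨u, h2, rfl⟩
      rwa [← leaf_eq hm]
    rw [h1] at hz ⊢
    refine ⟨σ, hσ, fun q => ?_⟩
    obtain ⟨h3, h4⟩ := 𝒜.line_eq hz q
    set w := unstretch (𝒜.slope (-1) (𝒜.geo x u)) (𝒜.slope 1 (𝒜.geo x u)) q with hw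
    rw [h3, ← (ht w).2 h4, ← 𝒜.line_stretch hx ((ht w).1.1 h4)]
    congr 1
    rw [stretch_translate (a' := 𝒜.slope (-1) (𝒜.geo x u)) (b' := 𝒜.slope 1 (𝒜.geo x u))
      (𝒜.slope_nonneg _ _) (𝒜.slope_nonneg _ _) (𝒜.slope_nonneg _ _) (𝒜.slope_nonneg _ _)
      (by rwa [← 𝒜.dom_eq_interval hx]) hσ
      (by
        rw [← 𝒜.dom_eq_interval hx, ← 𝒜.dom_eq_interval hz]
        exact fun q => (ht q).1)
      (by rwa [← 𝒜.dom_eq_interval hz]), hu, hw,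
      stretch_unstretch (𝒜.slope_nonneg _ _) (𝒜.slope_nonneg _ _),
      stretch_unstretch (𝒜.slope_nonneg _ _) (𝒜.slope_nonneg _ _)]

end PseudoFlow

theorem exists_isPseudoFlow (X : Type*) [TopologicalSpace X] [MeasurableSpace X]
    [BorelFoliation 1 X] : ∃ k : X → ℝ → X, IsPseudoFlow k := by
  obtain ⟨𝒜⟩ := BorelFoliation.exists_boxAtlas X
  have := BorelFoliation.t2Space X
  exact ⟨𝒜.line, 𝒜.isPseudoFlow_line⟩

/-! ### Ends of a line and maps preserving them -/

section LineEnds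

/-- In a compact space the whole space is an admissible `K`, whose complement has no component:
there is no end at all. -/
theorem TwoEnded.not_compactSpace {L : Type*} [TopologicalSpace L] (h : TwoEnded L) :
    ¬ CompactSpace L := by
  intro hL
  have : IsEmpty (SpaceEnd L) := ⟨fun e => by
    obtain ⟨x, hx, -⟩ := e.isComponent ⊤
    exact hx trivial⟩
  rw [TwoEnded, Nat.card_of_isEmpty] at h
  norm_num at h

variable {L L' : Type*} [TopologicalSpace L] [TopologicalSpace L']

theorem exists_forall_image_Ici_subset (H : ℝ ≃ₜ L) (K : TopologicalSpace.Compacts L) :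
    ∃ M, H '' Ici M ⊆ (K : Set L)ᶜ := by
  obtain ⟨M, hM⟩ := (H.isCompact_preimage.2 K.isCompact).bddAbove
  refine ⟨M + 1, ?_⟩
  rintro _ ⟨r, hr, rfl⟩ hK
  have h1 := hM (show r ∈ H ⁻¹' (K : Set L) from hK)
  have h2 : M + 1 ≤ r := hr
  linarith

/-- The end of a line at `+∞`. -/
theorem exists_end_top (H : ℝ ≃ₜ L) :
    ∃ e : SpaceEnd L, ∀ n : ℝ, ∃ K, e.comp K ⊆ H '' Ioi n := by
  choose M hM using exists_forall_image_Ici_subset H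
  have hcomp : ∀ K : TopologicalSpace.Compacts L,
      H '' Ici (M K) ⊆ connectedComponentIn (K : Set L)ᶜ (H (M K)) := fun K =>
    (isPreconnected_Ici.image _ H.continuous.continuousOn).subset_connectedComponentIn
      ⟨M K, self_mem_Ici, rfl⟩ (hM K)
  refine ⟨⟨fun K => connectedComponentIn (K : Set L)ᶜ (H (M K)),
    fun K => ⟨H (M K), hM K ⟨M K, self_mem_Ici, rfl⟩, rfl⟩, ?_⟩, ?_⟩
  · intro K K' hKK'
    have h1 : H (max (M K) (M K')) ∈ connectedComponentIn (K : Set L)ᶜ (H (M K)) :=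
      hcomp K ⟨_, mem_Ici.2 (le_max_left _ _), rfl⟩
    have h2 : H (max (M K) (M K')) ∈ connectedComponentIn (K' : Set L)ᶜ (H (M K')) :=
      hcomp K' ⟨_, mem_Ici.2 (le_max_right _ _), rfl⟩
    rw [connectedComponentIn_eq h1]
    exact isPreconnected_connectedComponentIn.subset_connectedComponentIn h2
      ((connectedComponentIn_subset _ _).trans (compl_subset_compl.2 hKK'))
  · intro n
    -- Removing the single point `H n` suffices: a component that contains points beyond `n` lies
    -- entirely beyond `n`.
    set K : TopologicalSpace.Compacts L := ⟨H '' Icc n n, isCompact_Icc.image H.continuous⟩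
    refine ⟨K, ?_⟩
    set C := connectedComponentIn (K : Set L)ᶜ (H (M K))
    have hpre : IsPreconnected (H ⁻¹' C) :=
      H.isPreconnected_preimage.2 isPreconnected_connectedComponentIn
    have hn : n ∉ H ⁻¹' C := fun h =>
      connectedComponentIn_subset _ _ h ⟨n, ⟨le_rfl, le_rfl⟩, rfl⟩
    have hr : max (M K) (n + 1) ∈ H ⁻¹' C := hcomp K ⟨_, mem_Ici.2 (le_max_left _ _), rfl⟩
    intro y hy
    refine ⟨H.symm y, ?_, by simp⟩
    by_contra hle
    rw [mem_Ioi, not_lt] at hle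
    have hy' : H.symm y ∈ H ⁻¹' C := by
      rw [mem_preimage, H.apply_symm_apply]; exact hy
    exact hn ((isPreconnected_iff_ordConnected.1 hpre).out hy' hr
      ⟨hle, by linarith [le_max_right (M K) (n + 1)]⟩)

/-- Enlarging `K` to a segment, the component chosen by the end contains a ray. The side cannot
depend on `K`, as `K ⊔ K'` shows. -/
theorem SpaceEnd.eq_top_or_bot (H : ℝ ≃ₜ L) (e : SpaceEnd L) :
    (∀ K, ∀ᶠ r in atTop, H r ∈ e.comp K) ∨ ∀ K, ∀ᶠ r in atBot, H r ∈ e.comp K := by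
  have key : ∀ K, (∀ᶠ r in atTop, H r ∈ e.comp K) ∨ ∀ᶠ r in atBot, H r ∈ e.comp K := by
    intro K
    obtain ⟨N, hN⟩ := (H.isCompact_preimage.2 K.isCompact).isBounded.subset_closedBall 0
    rw [Real.closedBall_eq_Icc, zero_sub, zero_add] at hN
    set K' : TopologicalSpace.Compacts L := ⟨H '' Icc (-N) N, isCompact_Icc.image H.continuous⟩
    have hK : K ≤ K' := by
      intro y hy
      exact ⟨H.symm y, hN (by rw [mem_preimage, H.apply_symm_apply]; exact hy), by simp⟩
    obtain ⟨x, hx, hC⟩ := e.isComponent K'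
    have hx' : H.symm x < -N ∨ N < H.symm x := by
      by_contra h
      push Not at h
      exact hx ⟨H.symm x, h, by simp⟩
    have hsub : ∀ S : Set ℝ, IsPreconnected S → H.symm x ∈ S → S ⊆ (Icc (-N) N)ᶜ →
        ∀ r ∈ S, H r ∈ e.comp K := by
      intro S hS hxS hSN r hr
      apply e.anti K K' hK
      rw [hC]
      refine (hS.image _ H.continuous.continuousOn).subset_connectedComponentIn
        ⟨_, hxS, by simp⟩ ?_ ⟨r, hr, rfl⟩
      rintro _ ⟨q, hq, rfl⟩ ⟨q', hq', h⟩
      rw [H.injective h] at hq'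
      exact hSN hq hq'
    rcases hx' with h | h
    · right
      filter_upwards [Iio_mem_atBot (-N)] with r hr
      exact hsub _ isPreconnected_Iio h (fun q hq hq' => absurd hq'.1 (not_le.2 hq)) r hr
    · left
      filter_upwards [Ioi_mem_atTop N] with r hr
      exact hsub _ isPreconnected_Ioi h (fun q hq hq' => absurd hq'.2 (not_le.2 hq)) r hr
  by_contra h
  rw [not_or, not_forall, not_forall] at h
  obtain ⟨⟨K, hK⟩, K', hK'⟩ := h
  rcases key (K ⊔ K') with h | h
  · exact hK (h.mono fun r hr => e.anti _ _ le_sup_left hr)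
  · exact hK' (h.mono fun r hr => e.anti _ _ le_sup_right hr)

theorem SendsEndsOnto.tendsto_atTop {f : L → L'} (hf : SendsEndsOnto f) (H : ℝ ≃ₜ L)
    (H' : ℝ ≃ₜ L') : Tendsto (fun r => H'.symm (f (H r))) atTop atTop ∨
      Tendsto (fun r => H'.symm (f (H r))) atBot atTop := by
  obtain ⟨e', he'⟩ := exists_end_top H'
  obtain ⟨e, he⟩ := hf.2 e'
  have key : ∀ l : Filter ℝ, (∀ K, ∀ᶠ r in l, H r ∈ e.comp K) →
      Tendsto (fun r => H'.symm (f (H r))) l atTop := by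
    intro l hl
    rw [Filter.tendsto_atTop]
    intro n
    obtain ⟨K', hK'⟩ := he' n
    obtain ⟨K, hK⟩ := he K'
    filter_upwards [hl K] with r hr
    obtain ⟨q, hq, h⟩ := hK' (hK hr)
    rw [← h, H'.symm_apply_apply]
    exact le_of_lt hq
  exact (e.eq_top_or_bot H).imp (key _) (key _)

/-- A map of lines which maps the ends onto the ends. -/
theorem SendsEndsOnto.tendsto {f : L → L'} (hf : SendsEndsOnto f) (H : ℝ ≃ₜ L) (H' : ℝ ≃ₜ L') :
    (Tendsto (fun r => H'.symm (f (H r))) atTop atTop ∧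
      Tendsto (fun r => H'.symm (f (H r))) atBot atBot) ∨
    (Tendsto (fun r => H'.symm (f (H r))) atTop atBot ∧
      Tendsto (fun r => H'.symm (f (H r))) atBot atTop) := by
  -- Reversing the target line gives the statement for its other end; the combinations where one
  -- filter would have both limits are absurd.
  have h2 := hf.tendsto_atTop H ((Homeomorph.neg ℝ).trans H')
  have h3 : ∀ r, ((Homeomorph.neg ℝ).trans H').symm (f (H r)) = -H'.symm (f (H r)) := fun r => rfl
  simp only [h3, tendsto_neg_atTop_iff] at h2
  rcases hf.tendsto_atTop H H' with h1 | h1 <;> rcases h2 with h2 | h2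
  · exact absurd h2 (h1.not_tendsto (disjoint_atTop_atBot))
  · exact Or.inl ⟨h1, h2⟩
  · exact Or.inr ⟨h2, h1⟩
  · exact absurd h2 (h1.not_tendsto (disjoint_atTop_atBot))

/-- Parametrization of a leaf by a line, seen as a homeomorphism. -/
theorem exists_homeomorph_leaf {A : Type*} [TopologicalSpace A] {a : A} {p : ℝ → A}
    (hp : IsEmbedding p) (hr : range p = leaf a) : ∃ H : ℝ ≃ₜ leaf a, ∀ r, (H r : A) = p r :=
  ⟨hp.toHomeomorph.trans (Homeomorph.setCongr hr), fun _ => rfl⟩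

theorem SendsEndsOnto.tendsto_of_isEmbedding {A A' : Type*} [TopologicalSpace A]
    [TopologicalSpace A'] {f : A → A'} {hf : Continuous f} {a : A}
    (h : SendsEndsOnto (leafMap f hf a)) {p : ℝ → A} {p' : ℝ → A'} (hp : IsEmbedding p)
    (hp' : IsEmbedding p') (hr : range p = leaf a) (hr' : range p' = leaf (f a)) {g : ℝ → ℝ}
    (hg : ∀ r, p' (g r) = f (p r)) :
    (Tendsto g atTop atTop ∧ Tendsto g atBot atBot) ∨
      (Tendsto g atTop atBot ∧ Tendsto g atBot atTop) := by
  obtain ⟨H, hH⟩ := exists_homeomorph_leaf hp hr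
  obtain ⟨H', hH'⟩ := exists_homeomorph_leaf hp' hr'
  have : g = fun r => H'.symm (leafMap f hf a (H r)) := by
    ext r
    rw [← H'.symm_apply_apply (g r)]
    congr 1
    apply Subtype.ext
    rw [hH', hg, ← hH]
    rfl
  rw [this]
  exact h.tendsto H H'

end LineEnds

/-! ### Leaves of a saturated subset -/

section Saturated

variable {X : Type*} [TopologicalSpace X] {A : Set X}

theorem IsSaturated.image_leaf (hA : IsSaturated A) (a : A) : (↑) '' leaf a = leaf (a : X) := by
  apply Subset.antisymm
  · exact (isPreconnected_connectedComponent.image _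
      continuous_subtype_val.continuousOn).subset_connectedComponent ⟨a, mem_leaf_self a, rfl⟩
  · have himg : ((↑) : A → X) '' ((↑) ⁻¹' leaf (a : X)) = leaf (a : X) := by
      rw [Subtype.image_preimage_coe, inter_eq_right.2 (hA a a.2)]
    have : IsPreconnected (((↑) : A → X) ⁻¹' leaf (a : X)) := by
      rw [← IsInducing.subtypeVal.isPreconnected_image, himg]
      exact isPreconnected_connectedComponent
    rw [← himg]
    exact image_mono (this.subset_connectedComponent (mem_leaf_self (a : X)))

theorem IsSaturated.mem_leaf_iff (hA : IsSaturated A) {a b : A} :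
    b ∈ leaf a ↔ (b : X) ∈ leaf (a : X) := by
  rw [← hA.image_leaf a]
  exact ⟨fun h => ⟨b, h, rfl⟩, fun ⟨c, hc, h⟩ => Subtype.ext h ▸ hc⟩

end Saturated

/-! ### Canonical straightening of a map of the line -/

section Smoothing

/-- A continuous map of the line which fixes both ends. -/
structure FixesEnds (f : ℝ → ℝ) : Prop where
  continuous : Continuous f
  top : Tendsto f atTop atTop
  bot : Tendsto f atBot atBot

/-- The conjugate of `f` by the reflection. -/
def reflect (f : ℝ → ℝ) (y : ℝ) : ℝ := -f (-y)

/-- The infimum of the points mapped above `w`. -/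
noncomputable def lower (f : ℝ → ℝ) (w : ℝ) : ℝ := sInf {y | w < f y}

/-- The mean of the extreme preimages of `w`. -/
noncomputable def middle (f : ℝ → ℝ) (w : ℝ) : ℝ := (lower f w - lower (reflect f) (-w)) / 2

/-- A continuous averaging of `middle f`. -/
noncomputable def average (f : ℝ → ℝ) (v : ℝ) : ℝ := ∫ w in (-1)..1, middle f (v + w)

/-- A homeomorphism of the line canonically attached to `f`. -/
noncomputable def straighten (f : ℝ → ℝ) (r : ℝ) : ℝ := Function.invFun (average f) (2 * r)

variable {f : ℝ → ℝ}

theorem reflect_reflect (f : ℝ → ℝ) : reflect (reflect f) = f := by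
  ext y; simp [reflect]

theorem FixesEnds.reflect (hf : FixesEnds f) : FixesEnds (reflect f) :=
  ⟨(hf.continuous.comp continuous_neg).neg,
    tendsto_neg_atBot_atTop.comp (hf.bot.comp tendsto_neg_atTop_atBot),
    tendsto_neg_atTop_atBot.comp (hf.top.comp tendsto_neg_atBot_atTop)⟩

theorem FixesEnds.comp_add_sub (hf : FixesEnds f) (r c : ℝ) : FixesEnds fun q => f (r + q) - c := by
  refine ⟨(hf.continuous.comp (by fun_prop)).sub continuous_const, ?_, ?_⟩
  · exact tendsto_atTop_add_const_right _ _ (hf.top.comp (tendsto_atTop_add_const_left _ _ tendsto_id))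
  · exact tendsto_atBot_add_const_right _ _ (hf.bot.comp (tendsto_atBot_add_const_left _ _ tendsto_id))

namespace FixesEnds

theorem bddBelow (hf : FixesEnds f) (w : ℝ) : BddBelow {y | w < f y} := by
  obtain ⟨N, hN⟩ := eventually_atBot.1 (hf.bot.eventually_le_atBot w)
  exact ⟨N, fun y hy => le_of_not_ge fun h => absurd (hN y h) (not_le.2 hy)⟩

theorem nonempty (hf : FixesEnds f) (w : ℝ) : {y | w < f y}.Nonempty :=
  (hf.top.eventually_gt_atTop w).exists

/-- The condition on `y` is open, so rational `y` will do; this is the source of the measurability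
of `lower`. -/
theorem lower_lt_iff (hf : FixesEnds f) {w c : ℝ} : lower f w < c ↔ ∃ y < c, w < f y := by
  rw [lower, csInf_lt_iff (hf.bddBelow w) (hf.nonempty w)]
  exact ⟨fun ⟨y, h1, h2⟩ => ⟨y, h2, h1⟩, fun ⟨y, h1, h2⟩ => ⟨y, h2, h1⟩⟩

theorem map_lower (hf : FixesEnds f) (w : ℝ) : f (lower f w) = w := by
  apply le_antisymm
  · by_contra h
    push Not at h
    obtain ⟨δ, hδ, hb⟩ := Metric.isOpen_iff.1 (isOpen_lt continuous_const hf.continuous) _ h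
    rw [Real.ball_eq_Ioo] at hb
    exact lt_irrefl _ (hf.lower_lt_iff.2
      ⟨lower f w - δ / 2, by linarith, hb ⟨by linarith, by linarith⟩⟩)
  · have h1 := csInf_mem_closure (hf.nonempty w) (hf.bddBelow w)
    have h2 : closure {y | w < f y} ⊆ {y | w ≤ f y} :=
      closure_minimal (fun y (hy : w < f y) => mem_ofPred_eq ▸ hy.le) (isClosed_le continuous_const hf.continuous)
    exact h2 h1

theorem strictMono_lower (hf : FixesEnds f) : StrictMono (lower f) := by
  intro w w' h
  have h1 : lower f w' ∈ {y | w < f y} := by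
    rw [mem_ofPred_eq, hf.map_lower]; exact h
  obtain ⟨δ, hδ, hb⟩ := Metric.isOpen_iff.1 (isOpen_lt continuous_const hf.continuous) _ h1
  rw [Real.ball_eq_Ioo] at hb
  exact hf.lower_lt_iff.2 ⟨lower f w' - δ / 2, by linarith, hb ⟨by linarith, by linarith⟩⟩

theorem tendsto_lower_atTop (hf : FixesEnds f) : Tendsto (lower f) atTop atTop := by
  refine tendsto_atTop_atTop_of_monotone hf.strictMono_lower.monotone fun N => ?_
  obtain ⟨M, hM⟩ := eventually_atBot.1 (hf.bot.eventually_le_atBot 0)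
  obtain ⟨C, hC⟩ := ((isCompact_Icc (a := M) (b := N)).image hf.continuous).bddAbove
  refine ⟨max 0 C, le_of_not_gt fun h => ?_⟩
  obtain ⟨y, hy, h1⟩ := hf.lower_lt_iff.1 h
  rcases le_total y M with h2 | h2
  · linarith [hM y h2, le_max_left 0 C]
  · linarith [hC ⟨y, ⟨h2, hy.le⟩, rfl⟩, le_max_right 0 C]

theorem tendsto_lower_atBot (hf : FixesEnds f) : Tendsto (lower f) atBot atBot := by
  refine tendsto_atBot_atBot_of_monotone hf.strictMono_lower.monotone fun N =>
    ⟨f N - 1, csInf_le (hf.bddBelow _) ?_⟩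
  rw [mem_ofPred_eq]; linarith

theorem strictMono_middle (hf : FixesEnds f) : StrictMono (middle f) := by
  intro w w' h
  have h1 := hf.strictMono_lower h
  have h2 := hf.reflect.strictMono_lower (neg_lt_neg h)
  unfold middle
  linarith

theorem tendsto_middle_atTop (hf : FixesEnds f) : Tendsto (middle f) atTop atTop := by
  have h : Tendsto (fun w => -lower (MeasuredFoliation.reflect f) (-w)) atTop atTop :=
    tendsto_neg_atBot_atTop.comp (hf.reflect.tendsto_lower_atBot.comp tendsto_neg_atTop_atBot)
  exact (hf.tendsto_lower_atTop.atTop_add_atTop h).atTop_div_const two_pos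

theorem tendsto_middle_atBot (hf : FixesEnds f) : Tendsto (middle f) atBot atBot := by
  have h : Tendsto (fun w => -lower (MeasuredFoliation.reflect f) (-w)) atBot atBot :=
    tendsto_neg_atTop_atBot.comp (hf.reflect.tendsto_lower_atTop.comp tendsto_neg_atBot_atTop)
  exact (hf.tendsto_lower_atBot.atBot_add_atBot h).atBot_div_const two_pos

theorem intervalIntegrable_middle (hf : FixesEnds f) (v a b : ℝ) :
    IntervalIntegrable (fun w => middle f (v + w)) volume a b :=
  Monotone.intervalIntegrable fun _ _ h => hf.strictMono_middle.monotone (by linarith)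

theorem strictMono_average (hf : FixesEnds f) : StrictMono (average f) := by
  intro v v' h
  rw [← sub_pos, average, average, ← intervalIntegral.integral_sub
    (hf.intervalIntegrable_middle _ _ _) (hf.intervalIntegrable_middle _ _ _)]
  exact intervalIntegral.intervalIntegral_pos_of_pos_on
    ((hf.intervalIntegrable_middle _ _ _).sub (hf.intervalIntegrable_middle _ _ _))
    (fun w _ => sub_pos.2 (hf.strictMono_middle (by linarith))) (by norm_num)

/-- `middle f` is monotone but may jump; a difference of two of its primitives is nevertheless
continuous. -/
theorem continuous_average (hf : FixesEnds f) : Continuous (average f) := by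
  have hi : ∀ a b, IntervalIntegrable (middle f) volume a b := fun a b =>
    hf.strictMono_middle.monotone.intervalIntegrable
  have h1 : average f = fun v => (∫ w in (0 : ℝ)..(v + 1), middle f w) -
      ∫ w in (0 : ℝ)..(v + -1), middle f w := by
    ext v
    rw [intervalIntegral.integral_interval_sub_left (hi _ _) (hi _ _), average,
      intervalIntegral.integral_comp_add_left]
  rw [h1]
  have hc := intervalIntegral.continuous_primitive hi 0
  exact (hc.comp (by fun_prop)).sub (hc.comp (by fun_prop))

theorem le_average (hf : FixesEnds f) (v : ℝ) : 2 * middle f (v - 1) ≤ average f v := by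
  have h := intervalIntegral.integral_mono_on (a := -1) (b := 1) (by norm_num)
    (intervalIntegrable_const (c := middle f (v - 1))) (hf.intervalIntegrable_middle v (-1) 1)
    fun w hw => hf.strictMono_middle.monotone (by linarith [hw.1])
  rw [intervalIntegral.integral_const, smul_eq_mul] at h
  unfold average
  linarith

theorem average_le (hf : FixesEnds f) (v : ℝ) : average f v ≤ 2 * middle f (v + 1) := by
  have h := intervalIntegral.integral_mono_on (a := -1) (b := 1) (by norm_num)
    (hf.intervalIntegrable_middle v (-1) 1) (intervalIntegrable_const (c := middle f (v + 1)))
    fun w hw => hf.strictMono_middle.monotone (by linarith [hw.2])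
  rw [intervalIntegral.integral_const, smul_eq_mul] at h
  unfold average
  linarith

theorem surjective_average (hf : FixesEnds f) : Function.Surjective (average f) := by
  refine hf.continuous_average.surjective ?_ ?_
  · refine tendsto_atTop_mono hf.le_average ((hf.tendsto_middle_atTop.comp ?_).const_mul_atTop two_pos)
    exact tendsto_atTop_add_const_right _ _ tendsto_id
  · refine tendsto_atBot_mono hf.average_le ((hf.tendsto_middle_atBot.comp ?_).const_mul_atBot two_pos)
    exact tendsto_atBot_add_const_right _ _ tendsto_id

/-- The factor `2` is the length of `[-1, 1]`: `average f` is twice a mean value. -/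
theorem average_straighten (hf : FixesEnds f) (r : ℝ) : average f (straighten f r) = 2 * r :=
  Function.invFun_eq (hf.surjective_average _)

theorem straighten_eq (hf : FixesEnds f) {r v : ℝ} (h : average f v = 2 * r) :
    straighten f r = v :=
  hf.strictMono_average.injective ((hf.average_straighten r).trans h.symm)

theorem exists_homeomorph (hf : FixesEnds f) : ∃ V : ℝ ≃ₜ ℝ, ∀ r, V r = straighten f r := by
  refine ⟨(Homeomorph.mulLeft₀ 2 two_ne_zero).trans
    (hf.strictMono_average.orderIsoOfSurjective _ hf.surjective_average).toHomeomorph.symm,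
    fun r => (hf.straighten_eq ?_).symm⟩
  exact (hf.strictMono_average.orderIsoOfSurjective _ hf.surjective_average).apply_symm_apply (2 * r)

theorem straighten_zero_lt_iff (hf : FixesEnds f) {c : ℝ} : straighten f 0 < c ↔ 0 < average f c := by
  rw [← hf.strictMono_average.lt_iff_lt, hf.average_straighten, mul_zero]

end FixesEnds

theorem lower_comp_add_sub (hf : FixesEnds f) (r c w : ℝ) :
    lower (fun q => f (r + q) - c) w = lower f (w + c) - r := by
  refine eq_of_forall_gt_iff fun d => ?_
  rw [(hf.comp_add_sub r c).lower_lt_iff, sub_lt_iff_lt_add, hf.lower_lt_iff]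
  constructor
  · rintro ⟨y, h1, h2⟩
    exact ⟨r + y, by linarith, by linarith⟩
  · rintro ⟨y, h1, h2⟩
    exact ⟨y - r, by linarith, by rw [add_sub_cancel]; linarith⟩

theorem middle_comp_add_sub (hf : FixesEnds f) (r c w : ℝ) :
    middle (fun q => f (r + q) - c) w = middle f (w + c) - r := by
  have h : reflect (fun q => f (r + q) - c) = fun q => reflect f (-r + q) - (-c) := by
    ext q
    simp only [reflect, neg_add, neg_neg]
    ring
  rw [middle, middle, h, lower_comp_add_sub hf, lower_comp_add_sub hf.reflect,
    show -w + -c = -(w + c) by ring]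
  ring

/-- Reflection exchanges the two extreme preimages; taking their mean makes the construction
independent of orientation. -/
theorem middle_reflect (f : ℝ → ℝ) (w : ℝ) : middle (reflect f) w = -middle f (-w) := by
  rw [middle, middle, reflect_reflect, neg_neg]
  ring

/-- Equivariance under translations of source and target passes from `lower` to `middle`, then
through the average to its inverse. -/
theorem straighten_comp_add_sub (hf : FixesEnds f) (r c : ℝ) :
    straighten (fun q => f (r + q) - c) 0 = straighten f r - c := by
  refine (hf.comp_add_sub r c).straighten_eq ?_
  have h := hf.average_straighten r
  unfold average at h ⊢
  have e : ∀ w, middle (fun q => f (r + q) - c) (straighten f r - c + w) =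
      middle f (straighten f r + w) - r := fun w => by
    rw [middle_comp_add_sub hf]; congr 2; ring
  simp only [e]
  rw [intervalIntegral.integral_sub (hf.intervalIntegrable_middle _ _ _) intervalIntegrable_const, h,
    intervalIntegral.integral_const, smul_eq_mul]
  ring

/-- The averaging window `[-1, 1]` is symmetric and `middle` is odd with respect to reflection. -/
theorem straighten_reflect (hf : FixesEnds f) (r : ℝ) :
    straighten (reflect f) (-r) = -straighten f r := by
  refine hf.reflect.straighten_eq ?_
  have h := hf.average_straighten r
  unfold average at h ⊢
  simp only [middle_reflect, intervalIntegral.integral_neg]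
  rw [mul_neg, neg_inj, ← h]
  have := intervalIntegral.integral_comp_neg (a := -1) (b := 1) fun w => middle f (straighten f r + w)
  rw [neg_neg] at this
  rw [← this]
  congr 1
  ext w
  congr 1
  ring

/-- Change of origin. -/
theorem straighten_translate (hf : FixesEnds f) (r : ℝ) {σ : ℝ} (hσ : σ = 1 ∨ σ = -1) :
    FixesEnds (fun q => σ * (f (r + σ * q) - f r)) ∧
      straighten (fun q => σ * (f (r + σ * q) - f r)) 0 = σ * (straighten f r - f r) := by
  rcases hσ with rfl | rfl
  · simp only [one_mul]
    exact ⟨hf.comp_add_sub _ _, straighten_comp_add_sub hf _ _⟩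
  · have : (fun q => -1 * (f (r + -1 * q) - f r)) = reflect fun q => f (r + q) - f r := by
      ext q; simp [reflect]
    rw [this, ← straighten_comp_add_sub hf, neg_one_mul,
      ← straighten_reflect (hf.comp_add_sub _ _), neg_zero]
    exact ⟨(hf.comp_add_sub _ _).reflect, rfl⟩

variable {Z : Type*} [MeasurableSpace Z] {F : Z → ℝ → ℝ}

theorem measurable_lower (hF : Measurable fun p : Z × ℝ => F p.1 p.2) (h : ∀ z, FixesEnds (F z)) :
    Measurable fun p : Z × ℝ => lower (F p.1) p.2 := by
  refine measurable_of_Iio fun c => ?_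
  have : (fun p : Z × ℝ => lower (F p.1) p.2) ⁻¹' Iio c =
      ⋃ y : ℚ, ⋃ (_ : (y : ℝ) < c), {p : Z × ℝ | p.2 < F p.1 y} := by
    ext p
    simp only [mem_preimage, mem_Iio, (h p.1).lower_lt_iff, mem_iUnion, mem_ofPred_eq, exists_prop]
    constructor
    · rintro ⟨y, h1, h2⟩
      obtain ⟨_, ⟨h3, h4⟩, q, rfl⟩ := Rat.denseRange_cast.inter_open_nonempty _
        (isOpen_Iio.inter (isOpen_lt continuous_const (h p.1).continuous)) ⟨y, h1, h2⟩
      exact ⟨q, h3, h4⟩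
    · rintro ⟨q, h1, h2⟩
      exact ⟨q, h1, h2⟩
  rw [this]
  exact MeasurableSet.iUnion fun y => MeasurableSet.iUnion fun _ =>
    measurableSet_lt measurable_snd (hF.comp (measurable_fst.prodMk measurable_const))

theorem measurable_middle (hF : Measurable fun p : Z × ℝ => F p.1 p.2) (h : ∀ z, FixesEnds (F z)) :
    Measurable fun p : Z × ℝ => middle (F p.1) p.2 := by
  have h1 : Measurable fun p : Z × ℝ => reflect (F p.1) p.2 :=
    (hF.comp (measurable_fst.prodMk measurable_snd.neg)).neg
  have h2 := measurable_lower (F := fun z => reflect (F z)) h1 fun z => (h z).reflect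
  exact ((measurable_lower hF h).sub
    (h2.comp (measurable_fst.prodMk measurable_snd.neg))).div_const 2

/-- Since `average` is strictly increasing, `straighten f 0 < c` means `0 < average f c`, a
condition on an integral with a Borel parameter. -/
theorem measurable_straighten_zero (hF : Measurable fun p : Z × ℝ => F p.1 p.2)
    (h : ∀ z, FixesEnds (F z)) : Measurable fun z => straighten (F z) 0 := by
  refine measurable_of_Iio fun c => ?_
  have : (fun z => straighten (F z) 0) ⁻¹' Iio c = {z | 0 < average (F z) c} := by
    ext z
    exact (h z).straighten_zero_lt_iff
  rw [this]
  refine measurableSet_lt measurable_const ?_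
  have hm : StronglyMeasurable (Function.uncurry fun (z : Z) (w : ℝ) => middle (F z) (c + w)) :=
    ((measurable_middle hF h).comp
      (measurable_fst.prodMk (measurable_snd.const_add c))).stronglyMeasurable
  have e : (fun z => average (F z) c) = fun z =>
      ∫ w, middle (F z) (c + w) ∂(volume.restrict (Ioc (-1 : ℝ) 1)) := by
    ext z
    rw [average, intervalIntegral.integral_of_le (by norm_num)]
  rw [e]
  exact hm.integral_prod_right.measurable

end Smoothing

/-! ### Straightening a map between foliations by lines -/

section Straightening

namespace IsPseudoFlow

variable {Z : Type*} [TopologicalSpace Z] [MeasurableSpace Z] {k : Z → ℝ → Z}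

theorem isOpenEmbedding (hk : IsPseudoFlow k) {z : Z} (hz : ¬ IsCompact (leaf z)) :
    IsOpenEmbedding (k z) :=
  .of_continuous_injective_isOpenMap (hk.continuous z hz) (hk.injective z hz) (hk.isOpenMap z hz)

theorem mem_leaf (hk : IsPseudoFlow k) {z : Z} (hz : ¬ IsCompact (leaf z)) (r : ℝ) :
    k z r ∈ leaf z :=
  hk.range z hz ▸ mem_range_self r

theorem exists_eq (hk : IsPseudoFlow k) {z w : Z} (hz : ¬ IsCompact (leaf z)) (hw : w ∈ leaf z) :
    ∃ r, k z r = w := by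
  rwa [← hk.range z hz] at hw

/-- Restriction to a saturated Borel set. -/
theorem restrict (hk : IsPseudoFlow k) {A : Set Z} (hA : IsSaturated A) (hAm : MeasurableSet A) :
    ∃ κ : A → ℝ → A, IsPseudoFlow κ := by
  classical
  -- The default `a` is never used on noncompact leaves, since `A` is saturated.
  let κ : A → ℝ → A := fun a r => if h : k a r ∈ A then ⟨k a r, h⟩ else a
  have hc : ∀ a : A, ¬ IsCompact (leaf a) → ¬ IsCompact (leaf (a : Z)) := fun a ha => by
    rwa [← hA.image_leaf a, ← IsInducing.subtypeVal.isCompact_iff]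
  have hκ : ∀ a : A, ¬ IsCompact (leaf a) → ∀ r, (κ a r : Z) = k a r := fun a ha r => by
    have h : k a r ∈ A := hA a a.2 (hk.mem_leaf (hc a ha) r)
    simp only [κ, dif_pos h]
  have hcomp : ∀ a : A, ¬ IsCompact (leaf a) → (↑) ∘ κ a = k a := fun a ha => funext (hκ a ha)
  have hemb : ∀ a : A, ¬ IsCompact (leaf a) → IsOpenEmbedding (κ a) := fun a ha => by
    have h := hk.isOpenEmbedding (hc a ha)
    rw [← hcomp a ha] at h
    refine ⟨IsEmbedding.of_comp ?_ continuous_subtype_val h.isEmbedding, ?_⟩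
    · rw [IsInducing.subtypeVal.continuous_iff]; exact h.continuous
    · rw [← preimage_image_eq (Set.range (κ a)) Subtype.val_injective, ← range_comp]
      exact h.isOpen_range.preimage continuous_subtype_val
  refine ⟨κ, ⟨?_, ?_, fun a ha => (hemb a ha).continuous, fun a ha => (hemb a ha).injective, ?_,
    fun a ha => (hemb a ha).isOpenMap, ?_⟩⟩
  · have hm : Measurable fun p : A × ℝ => k p.1 p.2 :=
      hk.measurable.comp ((measurable_subtype_coe.comp measurable_fst).prodMk measurable_snd)
    refine Measurable.dite (s := (fun p : A × ℝ => k p.1 p.2) ⁻¹' A)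
      (f := fun p => (⟨k p.1.1 p.1.2, p.2⟩ : A)) (g := fun p => p.1.1) ?_ ?_ (hm hAm)
    · exact (hm.comp measurable_subtype_coe).subtype_mk
    · exact measurable_fst.comp measurable_subtype_coe
  · exact fun a ha => Subtype.ext ((hκ a ha 0).trans (hk.zero _ (hc a ha)))
  · intro a ha
    apply image_injective.2 Subtype.val_injective
    rw [← range_comp, hcomp a ha, hk.range _ (hc a ha), hA.image_leaf]
  · intro a ha r
    obtain ⟨σ, hσ, h⟩ := hk.translate a (hc a ha) r
    refine ⟨σ, hσ, fun q => Subtype.ext ?_⟩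
    have hm : κ a r ∈ leaf a := by
      rw [hA.mem_leaf_iff, hκ a ha]; exact hk.mem_leaf (hc a ha) r
    rw [hκ _ (by rwa [← leaf_eq hm]), hκ a ha, hκ a ha, h]

end IsPseudoFlow

variable {Z Z' : Type*} [TopologicalSpace Z] [MeasurableSpace Z] [TopologicalSpace Z']
  [MeasurableSpace Z']

/-- A Borel and continuous map between foliations by lines, which is proper of degree `±1` from
leaf to leaf and injective on the set of leaves. -/
structure IsLineMap (κ : Z → ℝ → Z) (κ' : Z' → ℝ → Z') (f : Z → Z') : Prop where
  source : IsPseudoFlow κ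
  target : IsPseudoFlow κ'
  continuous : Continuous f
  measurable : Measurable f
  noncompact : ∀ z : Z, ¬ IsCompact (leaf z)
  noncompact' : ∀ z, ¬ IsCompact (leaf (f z))
  mem_leaf : ∀ z w, f z = f w → w ∈ leaf z
  sendsEndsOnto : ∀ z, SendsEndsOnto (leafMap f continuous z)

/-- The map `f` in the coordinates given by `κ` and `κ'`. -/
noncomputable def coordMap (κ : Z → ℝ → Z) (κ' : Z' → ℝ → Z') (f : Z → Z') (z : Z) (q : ℝ) : ℝ :=
  Function.invFun (κ' (f z)) (f (κ z q))

open Classical in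
/-- The sign which tells whether `f` preserves the directions of `κ` and `κ'`. -/
noncomputable def direction (κ : Z → ℝ → Z) (κ' : Z' → ℝ → Z') (f : Z → Z') (z : Z) : ℝ :=
  -- The coordinate map of a line map tends to `+∞` or `-∞`, so integer times decide which and keep
  -- the condition Borel.
  if ∀ᶠ n : ℕ in atTop, 0 < coordMap κ κ' f z n then 1 else -1

/-- The map `f` in coordinates, after a change of sign. -/
noncomputable def directedMap (κ : Z → ℝ → Z) (κ' : Z' → ℝ → Z') (f : Z → Z') (z : Z) (q : ℝ) : ℝ :=
  direction κ κ' f z * coordMap κ κ' f z q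

/-- The straightening of `f`. -/
noncomputable def straightMap (κ : Z → ℝ → Z) (κ' : Z' → ℝ → Z') (f : Z → Z') (z : Z) : Z' :=
  κ' (f z) (direction κ κ' f z * straighten (directedMap κ κ' f z) 0)

/-- The homotopy from `f` to its straightening. -/
noncomputable def straightHomotopy (κ : Z → ℝ → Z) (κ' : Z' → ℝ → Z') (f : Z → Z')
    (p : Z × unitInterval) : Z' :=
  κ' (f p.1) (p.2 * (direction κ κ' f p.1 * straighten (directedMap κ κ' f p.1) 0))

/-- A section of `f` over its straightening. -/
noncomputable def straightLift (κ : Z → ℝ → Z) (κ' : Z' → ℝ → Z') (f : Z → Z') (z : Z) : Z :=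
  κ z (lower (directedMap κ κ' f z) (straighten (directedMap κ κ' f z) 0))

theorem direction_eq (κ : Z → ℝ → Z) (κ' : Z' → ℝ → Z') (f : Z → Z') (z : Z) :
    direction κ κ' f z = 1 ∨ direction κ κ' f z = -1 := by
  unfold direction
  split_ifs <;> simp

theorem eq_of_fixesEnds_mul {g : ℝ → ℝ} {c c' : ℝ} (hc : c = 1 ∨ c = -1) (hc' : c' = 1 ∨ c' = -1)
    (h : FixesEnds fun q => c * g q) (h' : FixesEnds fun q => c' * g q) : c = c' := by
  have key : (FixesEnds fun q => 1 * g q) → (FixesEnds fun q => -1 * g q) → False := by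
    intro h1 h2
    obtain ⟨r, h3, h4⟩ := ((h1.top.eventually_gt_atTop 0).and (h2.top.eventually_gt_atTop 0)).exists
    linarith
  rcases hc with rfl | rfl <;> rcases hc' with rfl | rfl
  · rfl
  · exact (key h h').elim
  · exact (key h' h).elim
  · rfl

namespace IsLineMap

variable {κ : Z → ℝ → Z} {κ' : Z' → ℝ → Z'} {f : Z → Z'}

theorem map_coordMap (h : IsLineMap κ κ' f) (z : Z) (q : ℝ) :
    κ' (f z) (coordMap κ κ' f z q) = f (κ z q) := by
  refine Function.invFun_eq (h.target.exists_eq (h.noncompact' z) ?_)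
  exact h.continuous.mapsTo_connectedComponent z (h.source.mem_leaf (h.noncompact z) q)

theorem continuous_coordMap (h : IsLineMap κ κ' f) (z : Z) : Continuous (coordMap κ κ' f z) := by
  rw [(h.target.isOpenEmbedding (h.noncompact' z)).isInducing.continuous_iff]
  have : κ' (f z) ∘ coordMap κ κ' f z = f ∘ κ z := funext (h.map_coordMap z)
  rw [this]
  exact h.continuous.comp (h.source.continuous z (h.noncompact z))

theorem fixesEnds (h : IsLineMap κ κ' f) (z : Z) : FixesEnds (directedMap κ κ' f z) := by
  have hcont := h.continuous_coordMap z
  unfold directedMap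
  rcases (h.sendsEndsOnto z).tendsto_of_isEmbedding
    (h.source.isOpenEmbedding (h.noncompact z)).isEmbedding
    (h.target.isOpenEmbedding (h.noncompact' z)).isEmbedding
    (h.source.range z (h.noncompact z)) (h.target.range _ (h.noncompact' z))
    (h.map_coordMap z) with ⟨h1, h2⟩ | ⟨h1, h2⟩
  · have : direction κ κ' f z = 1 := if_pos
      ((h1.comp tendsto_natCast_atTop_atTop).eventually_gt_atTop 0)
    simp only [this, one_mul]
    exact ⟨hcont, h1, h2⟩
  · have : direction κ κ' f z = -1 := if_neg fun hp => by
      obtain ⟨n, h3, h4⟩ :=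
        (hp.and ((h1.comp tendsto_natCast_atTop_atTop).eventually_lt_atBot 0)).exists
      exact absurd h3 (not_lt.2 h4.le)
    simp only [this, neg_one_mul]
    exact ⟨hcont.neg, tendsto_neg_atBot_atTop.comp h1, tendsto_neg_atTop_atBot.comp h2⟩

theorem coordMap_eq (κ : Z → ℝ → Z) (κ' : Z' → ℝ → Z') (f : Z → Z') (z : Z) (q : ℝ) :
    coordMap κ κ' f z q = direction κ κ' f z * directedMap κ κ' f z q := by
  unfold directedMap
  rcases direction_eq κ κ' f z with h | h <;> rw [h] <;> ring

/-- The straightening and the homotopy in the coordinates of a given point. -/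
theorem chart (h : IsLineMap κ κ' f) (z : Z) (r u : ℝ) :
    κ' (f (κ z r)) (u * (direction κ κ' f (κ z r) * straighten (directedMap κ κ' f (κ z r)) 0)) =
      κ' (f z) (coordMap κ κ' f z r + u * (direction κ κ' f z *
        straighten (directedMap κ κ' f z) r - coordMap κ κ' f z r)) := by
  have hf := h.fixesEnds z
  have hzr : leaf z = leaf (κ z r) := leaf_eq (h.source.mem_leaf (h.noncompact z) r)
  obtain ⟨σ, hσ, h1⟩ := h.source.translate z (h.noncompact z) r
  obtain ⟨σ', hσ', h2⟩ := h.target.translate (f z) (h.noncompact' z) (coordMap κ κ' f z r)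
  rw [h.map_coordMap] at h2
  have hσσ : σ * σ = 1 := by rcases hσ with rfl | rfl <;> norm_num
  have hσσ' : σ' * σ' = 1 := by rcases hσ' with rfl | rfl <;> norm_num
  -- Changing the base point from `z` to `κ z r` composes the coordinate map with isometries, of
  -- signs `σ` at the source and `σ'` at the target.
  have hraw : ∀ q, coordMap κ κ' f z r + σ' * coordMap κ κ' f (κ z r) q =
      coordMap κ κ' f z (r + σ * q) := fun q => by
    apply h.target.injective _ (h.noncompact' z)
    rw [← h2, h.map_coordMap, h.map_coordMap, h1]
  set s := direction κ κ' f z with hs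
  have hss : s * s = 1 := by
    rcases direction_eq κ κ' f z with h | h <;> rw [hs, h] <;> norm_num
  obtain ⟨h3, h4⟩ := straighten_translate hf r hσ
  have hmap : (fun q => σ * (directedMap κ κ' f z (r + σ * q) - directedMap κ κ' f z r)) =
      fun q => (σ * s * σ') * coordMap κ κ' f (κ z r) q := by
    ext q
    simp only [directedMap, ← hs, ← hraw]
    ring
  -- Only one sign makes the coordinate map fix both ends, so the direction at the new base point is
  -- forced.
  have hdir : σ * s * σ' = direction κ κ' f (κ z r) := by
    refine eq_of_fixesEnds_mul ?_ (direction_eq _ _ _ _) (hmap ▸ h3) (h.fixesEnds (κ z r))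
    rcases hσ with rfl | rfl <;> rcases hσ' with rfl | rfl <;>
      rcases direction_eq κ κ' f z with h | h <;> rw [hs, h] <;> norm_num
  have hmap' : directedMap κ κ' f (κ z r) =
      fun q => σ * (directedMap κ κ' f z (r + σ * q) - directedMap κ κ' f z r) := by
    rw [hmap, hdir]; rfl
  rw [h2, hmap', h4, ← hdir, coordMap_eq κ κ' f z r, ← hs]
  congr 1
  linear_combination (u * s * (straighten (directedMap κ κ' f z) r - directedMap κ κ' f z r)) *
    (hσσ * σ' * σ' + hσσ')

theorem straightMap_chart (h : IsLineMap κ κ' f) (z : Z) (r : ℝ) :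
    straightMap κ κ' f (κ z r) =
      κ' (f z) (direction κ κ' f z * straighten (directedMap κ κ' f z) r) := by
  have := h.chart z r 1
  rw [one_mul, one_mul, add_sub_cancel] at this
  exact this

theorem exists_homeomorph (h : IsLineMap κ κ' f) (z : Z) :
    ∃ V : ℝ ≃ₜ ℝ, ∀ r, straightMap κ κ' f (κ z r) = κ' (f z) (V r) := by
  obtain ⟨V, hV⟩ := (h.fixesEnds z).exists_homeomorph
  simp only [h.straightMap_chart, ← hV]
  rcases direction_eq κ κ' f z with h | h
  · exact ⟨V, fun r => by rw [h, one_mul]⟩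
  · exact ⟨V.trans (Homeomorph.neg ℝ), fun r => by rw [h, neg_one_mul]; rfl⟩

theorem map_nhds_straightMap (h : IsLineMap κ κ' f) (z : Z) :
    map (straightMap κ κ' f) (𝓝 z) = 𝓝 (straightMap κ κ' f z) := by
  obtain ⟨V, hV⟩ := h.exists_homeomorph z
  have hz := h.source.isOpenEmbedding (h.noncompact z)
  have e : straightMap κ κ' f ∘ κ z = κ' (f z) ∘ V := funext hV
  have hV' := (h.target.isOpenEmbedding (h.noncompact' z)).comp V.isOpenEmbedding
  rw [← e] at hV'
  have := hV'.map_nhds_eq 0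
  rw [← map_map, hz.map_nhds_eq, Function.comp_apply, h.source.zero z (h.noncompact z)] at this
  exact this

theorem continuous_straightMap (h : IsLineMap κ κ' f) : Continuous (straightMap κ κ' f) :=
  continuous_iff_continuousAt.2 fun z => (h.map_nhds_straightMap z).le

theorem isOpenMap_straightMap (h : IsLineMap κ κ' f) : IsOpenMap (straightMap κ κ' f) :=
  isOpenMap_iff_nhds_le.2 fun z => (h.map_nhds_straightMap z).ge

/-- In coordinates the map is continuous with opposite infinite limits, hence onto the leaf. -/
theorem exists_map_eq (h : IsLineMap κ κ' f) {z : Z} {w : Z'} (hw : w ∈ leaf (f z)) :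
    ∃ q, f (κ z q) = w := by
  obtain ⟨s, rfl⟩ := h.target.exists_eq (h.noncompact' z) hw
  have hf := h.fixesEnds z
  obtain ⟨q, hq⟩ := hf.continuous.surjective hf.top hf.bot (direction κ κ' f z * s)
  refine ⟨q, ?_⟩
  rw [← h.map_coordMap, coordMap_eq, hq, ← mul_assoc]
  rcases direction_eq κ κ' f z with h | h <;> rw [h] <;> norm_num

theorem straightMap_mem (h : IsLineMap κ κ' f) (z : Z) : straightMap κ κ' f z ∈ leaf (f z) :=
  h.target.mem_leaf (h.noncompact' z) _

/-- If `z` and `w` have the same image, `f z` and `f w` share a leaf. As `f` maps the leaf of `z`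
onto it and fibres lie in single leaves, `w` is in the leaf of `z`, where the straightening is a
homeomorphism. -/
theorem injective_straightMap (h : IsLineMap κ κ' f) :
    Function.Injective (straightMap κ κ' f) := by
  intro z w hzw
  have h1 : f w ∈ leaf (f z) := by
    rw [leaf_eq (h.straightMap_mem z), hzw, ← leaf_eq (h.straightMap_mem w)]
    exact mem_leaf_self _
  obtain ⟨q, hq⟩ := h.exists_map_eq h1
  have h2 := h.mem_leaf _ _ hq
  rw [← leaf_eq (h.source.mem_leaf (h.noncompact z) q)] at h2
  obtain ⟨r, rfl⟩ := h.source.exists_eq (h.noncompact z) h2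
  obtain ⟨V, hV⟩ := h.exists_homeomorph z
  have h0 := hV 0
  rw [h.source.zero z (h.noncompact z)] at h0
  rw [h0, hV] at hzw
  rw [← V.injective (h.target.injective _ (h.noncompact' z) hzw), h.source.zero z (h.noncompact z)]

/-- Both ranges are the union of the leaves met by `f`. -/
theorem range_straightMap (h : IsLineMap κ κ' f) : range (straightMap κ κ' f) = range f := by
  apply Subset.antisymm
  · rintro _ ⟨z, rfl⟩
    obtain ⟨q, hq⟩ := h.exists_map_eq (h.straightMap_mem z)
    exact ⟨_, hq⟩
  · rintro _ ⟨z, rfl⟩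
    obtain ⟨V, hV⟩ := h.exists_homeomorph z
    refine ⟨κ z (V.symm 0), ?_⟩
    rw [hV, V.apply_symm_apply, h.target.zero _ (h.noncompact' z)]

theorem leaf_subset_range (h : IsLineMap κ κ' f) (z : Z) : leaf (f z) ⊆ range f := fun _ hw =>
  let ⟨_, hq⟩ := h.exists_map_eq hw
  ⟨_, hq⟩

theorem straightHomotopy_mem (h : IsLineMap κ κ' f) (p : Z × unitInterval) :
    straightHomotopy κ κ' f p ∈ leaf (f p.1) :=
  h.target.mem_leaf (h.noncompact' p.1) _

theorem straightHomotopy_zero (h : IsLineMap κ κ' f) (z : Z) :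
    straightHomotopy κ κ' f (z, 0) = f z := by
  simp only [straightHomotopy, Set.Icc.coe_zero, zero_mul]
  exact h.target.zero _ (h.noncompact' z)

theorem straightHomotopy_one (κ : Z → ℝ → Z) (κ' : Z' → ℝ → Z') (f : Z → Z') (z : Z) :
    straightHomotopy κ κ' f (z, 1) = straightMap κ κ' f z := by
  simp only [straightHomotopy, Set.Icc.coe_one, one_mul]
  rfl

theorem continuous_straightHomotopy (h : IsLineMap κ κ' f) :
    Continuous (straightHomotopy κ κ' f) := by
  rw [continuous_iff_continuousAt]
  rintro ⟨z, u⟩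
  obtain ⟨V, hV⟩ := (h.fixesEnds z).exists_homeomorph
  have hemb : IsOpenEmbedding (Prod.map (κ z) (id : unitInterval → unitInterval)) :=
    (h.source.isOpenEmbedding (h.noncompact z)).prodMap IsOpenEmbedding.id
  have hz : (z, u) = Prod.map (κ z) (id : unitInterval → unitInterval) (0, u) := by
    simp [h.source.zero z (h.noncompact z)]
  rw [hz, ← hemb.continuousAt_iff]
  have e : straightHomotopy κ κ' f ∘ Prod.map (κ z) (id : unitInterval → unitInterval) =
      fun p => κ' (f z) (coordMap κ κ' f z p.1 + p.2 * (direction κ κ' f z * V p.1 -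
        coordMap κ κ' f z p.1)) := by
    ext ⟨r, u⟩
    rw [hV]
    exact h.chart z r u
  rw [e]
  have hc := h.continuous_coordMap z
  have hV := V.continuous
  exact ((h.target.continuous _ (h.noncompact' z)).comp (by fun_prop)).continuousAt

theorem map_straightLift (h : IsLineMap κ κ' f) (z : Z) :
    f (straightLift κ κ' f z) = straightMap κ κ' f z := by
  rw [straightLift, ← h.map_coordMap, coordMap_eq, (h.fixesEnds z).map_lower]
  rfl

theorem straightLift_mem (h : IsLineMap κ κ' f) (z : Z) : straightLift κ κ' f z ∈ leaf z :=
  h.source.mem_leaf (h.noncompact z) _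

section Measurable

variable [StandardBorelSpace Z] [StandardBorelSpace Z']

theorem measurable_coordMap (h : IsLineMap κ κ' f) :
    Measurable fun p : Z × ℝ => coordMap κ κ' f p.1 p.2 := by
  apply measurable_of_measurableSet_graph
  have : {p : (Z × ℝ) × ℝ | coordMap κ κ' f p.1.1 p.1.2 = p.2} =
      {p | κ' (f p.1.1) p.2 = f (κ p.1.1 p.1.2)} := by
    ext p
    simp only [mem_ofPred_eq]
    rw [← h.map_coordMap, (h.target.injective _ (h.noncompact' _)).eq_iff]
    exact eq_comm
  rw [this]
  have hm := h.measurable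
  refine measurableSet_eq_fun ?_ (hm.comp (h.source.measurable.comp measurable_fst))
  exact h.target.measurable.comp
    ((hm.comp (measurable_fst.comp measurable_fst)).prodMk measurable_snd)

theorem measurable_direction (h : IsLineMap κ κ' f) : Measurable (direction κ κ' f) := by
  classical
  refine Measurable.ite ?_ measurable_const measurable_const
  simp only [eventually_atTop, ofPred_exists, ofPred_forall]
  exact MeasurableSet.iUnion fun N => MeasurableSet.iInter fun n => MeasurableSet.iInter fun _ =>
    measurableSet_lt measurable_const
      (h.measurable_coordMap.comp (measurable_id.prodMk measurable_const))

theorem measurable_directedMap (h : IsLineMap κ κ' f) :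
    Measurable fun p : Z × ℝ => directedMap κ κ' f p.1 p.2 :=
  (h.measurable_direction.comp measurable_fst).mul h.measurable_coordMap

theorem measurable_straighten (h : IsLineMap κ κ' f) :
    Measurable fun z => straighten (directedMap κ κ' f z) 0 :=
  measurable_straighten_zero h.measurable_directedMap h.fixesEnds

theorem measurable_straightHomotopy (h : IsLineMap κ κ' f) :
    Measurable (straightHomotopy κ κ' f) := by
  have h1 : Measurable fun p : Z × unitInterval => (p.2 : ℝ) :=
    measurable_subtype_coe.comp measurable_snd
  exact h.target.measurable.comp ((h.measurable.comp measurable_fst).prodMk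
    (h1.mul ((h.measurable_direction.mul h.measurable_straighten).comp measurable_fst)))

theorem measurable_straightMap (h : IsLineMap κ κ' f) : Measurable (straightMap κ κ' f) :=
  h.target.measurable.comp
    (h.measurable.prodMk (h.measurable_direction.mul h.measurable_straighten))

theorem measurable_straightLift (h : IsLineMap κ κ' f) : Measurable (straightLift κ κ' f) :=
  h.source.measurable.comp (measurable_id.prodMk
    ((measurable_lower h.measurable_directedMap h.fixesEnds).comp
      (measurable_id.prodMk h.measurable_straighten)))

end Measurable

end IsLineMap

end Straightening

/-! ### Transversals and their measures -/

section Transversal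

variable {X : Type*} [TopologicalSpace X] [MeasurableSpace X]

/-- Closed and discrete means without accumulation point, a local condition that passes to subsets.
-/
theorem isTransversal_iff {T : Set X} :
    IsTransversal T ↔ MeasurableSet T ∧ ∀ x, ∀ᶠ y in 𝓝[≠] x, y ∉ T := by
  have h := isClosed_and_discrete_iff (S := T)
  simp only [isDiscrete_iff_discreteTopology, disjoint_principal_right] at h
  exact ⟨fun hT => ⟨hT.measurableSet, h.1 ⟨hT.isClosed, hT.discrete⟩⟩,
    fun hT => ⟨hT.1, (h.2 hT.2).1, (h.2 hT.2).2⟩⟩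

theorem IsTransversal.subset {S T : Set X} (hT : IsTransversal T) (hS : MeasurableSet S)
    (hST : S ⊆ T) : IsTransversal S :=
  isTransversal_iff.2 ⟨hS, fun x => ((isTransversal_iff.1 hT).2 x).mono fun _ hy h => hy (hST h)⟩

theorem isTransversal_empty : IsTransversal (∅ : Set X) :=
  isTransversal_iff.2 ⟨MeasurableSet.empty, fun _ => by simp⟩

theorem InvariantTransverseMeasure.eq_zero_of_split (μ : InvariantTransverseMeasure X)
    {T M : Set X} (hT : IsTransversal T) (hM : MeasurableSet M) (h1 : μ (T ∩ M) = 0)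
    (h2 : μ (T \ M) = 0) : μ T = 0 := by
  -- Additivity is given for sequences, so the two pieces are padded with empty sets.
  let f : ℕ → Set X := fun i => if i = 0 then T ∩ M else if i = 1 then T \ M else ∅
  have hf : ∀ i, IsTransversal (f i) ∧ μ (f i) = 0 := by
    intro i
    simp only [f]
    split_ifs
    · exact ⟨hT.subset (hT.measurableSet.inter hM) inter_subset_left, h1⟩
    · exact ⟨hT.subset (hT.measurableSet.diff hM) sdiff_subset, h2⟩
    · exact ⟨isTransversal_empty, μ.empty⟩
  have hU : ⋃ i, f i = T := by
    apply Subset.antisymm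
    · refine iUnion_subset fun i => ?_
      simp only [f]
      split_ifs
      · exact inter_subset_left
      · exact sdiff_subset
      · exact empty_subset _
    · intro x hx
      by_cases hxM : x ∈ M
      · exact mem_iUnion.2 ⟨0, hx, hxM⟩
      · exact mem_iUnion.2 ⟨1, hx, hxM⟩
  have hd : Pairwise (Function.onFun Disjoint f) := by
    intro i j hij
    rw [Function.onFun, Set.disjoint_left]
    intro x hi hj
    simp only [f] at hi hj
    split_ifs at hi hj
    · omega
    · exact hj.2 hi.2
    · exact hj
    · exact hi.2 hj.2
    · omega
    · exact hj
    all_goals exact hi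
  have := μ.iUnion f (fun i => (hf i).1) hd (by rwa [hU])
  rw [hU] at this
  rw [this]
  simp [fun i => (hf i).2]

/-- By Lusin–Souslin an injective Borel map is a Borel isomorphism onto its Borel image. -/
theorem transversalEquiv_range [StandardBorelSpace X] {S : Set X} (hS : MeasurableSet S)
    {g : S → X} (hg : Measurable g) (hi : Function.Injective g)
    (hl : ∀ s : S, g s ∈ leaf (s : X)) :
    MeasurableSet (range g) ∧ TransversalEquiv S (range g) := by
  have := hS.standardBorel
  have he := hg.measurableEmbedding hi
  exact ⟨he.measurableSet_range, he.equivRange, fun s => by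
    rw [he.equivRange_apply]; exact hl s⟩

theorem IsSaturated.isOpen {A : Set X} (𝒜 : BoxAtlas X) (hA : IsSaturated A) : IsOpen A := by
  rw [isOpen_iff_mem_nhds]
  exact fun x hx => mem_of_superset ((𝒜.isOpen_leaf x).mem_nhds (mem_leaf_self x)) (hA x hx)

theorem IsSaturated.compl {A : Set X} (hA : IsSaturated A) : IsSaturated Aᶜ :=
  fun _ hx _ hy hyA => hx (hA _ hyA (mem_leaf_symm hy))

end Transversal

/-! ### Measures under a collapse -/

section Collapse

variable {Y Y' : Type*} [TopologicalSpace Y] [MeasurableSpace Y] [BorelFoliation 1 Y]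
  [TopologicalSpace Y'] [MeasurableSpace Y'] [BorelFoliation 1 Y']
  {ν : InvariantTransverseMeasure Y} {ν' : InvariantTransverseMeasure Y'}
  {A : Set Y} {A' : Set Y'} {π : A → A'}

theorem IsCollapse.exists_isLineMap (hπ : IsCollapse ν ν' π) :
    ∃ (κ : A → ℝ → A) (κ' : A' → ℝ → A'), IsLineMap κ κ' π := by
  obtain ⟨k, hk⟩ := exists_isPseudoFlow Y
  obtain ⟨k', hk'⟩ := exists_isPseudoFlow Y'
  obtain ⟨κ, hκ⟩ := hk.restrict hπ.total_source.saturated hπ.total_source.measurableSet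
  obtain ⟨κ', hκ'⟩ := hk'.restrict hπ.total_target.saturated hπ.total_target.measurableSet
  refine ⟨κ, κ', hκ, hκ', hπ.continuous, hπ.measurable, fun a h => ?_, fun a h => ?_,
    hπ.fibre_in_leaf, hπ.sendsEndsOnto⟩
  · exact (hπ.twoEnded_source a).not_compactSpace (isCompact_iff_compactSpace.1 h)
  · exact (hπ.twoEnded_target a).not_compactSpace (isCompact_iff_compactSpace.1 h)

theorem isSaturated_image_range (hA' : IsSaturated A') (h : ∀ a, leaf (π a) ⊆ range π) :
    IsSaturated ((↑) '' range π : Set Y') := by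
  rintro _ ⟨_, ⟨a, rfl⟩, rfl⟩
  rw [← hA'.image_leaf]
  exact image_mono (h a)

/-- The image of a collapse is total. -/
theorem IsCollapse.isTotalPart_range (hπ : IsCollapse ν ν' π)
    (hm : MeasurableSet ((↑) '' range π : Set Y')) (h : ∀ a, leaf (π a) ⊆ range π) :
    IsTotalPart ν' ((↑) '' range π : Set Y') := by
  refine ⟨hm, isSaturated_image_range hπ.total_target.saturated h, fun T hT hTB => ?_⟩
  have hA' := hπ.total_target.measurableSet
  refine ν'.eq_zero_of_split hT hA' ?_ ?_
  -- No fibre over this transversal is nonempty, so the empty set is a section over it.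
  · rw [hπ.pushforward (T ∩ A') ∅ (hT.subset (hT.measurableSet.inter hA') inter_subset_left)
      isTransversal_empty inter_subset_right (empty_subset _) (fun t ht => absurd ht (by simp))
      (fun a ha => absurd ⟨π a, mem_range_self a, rfl⟩ (hTB ha.1)), ν.empty]
  · exact hπ.total_target.negligible_compl _
      (hT.subset (hT.measurableSet.diff hA') sdiff_subset) fun x hx => hx.2

/-- A section of a collapse over a transversal computes the measure of the transversal. -/
theorem IsCollapse.measure_image (hπ : IsCollapse ν ν' π) {φ : A → A'} {τ : A → A}
    (hφ : Function.Injective φ) (hτ : Measurable τ) (hτφ : ∀ a, π (τ a) = φ a)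
    (hτl : ∀ a, τ a ∈ leaf a) {T : Set A} (hT : IsTransversal ((↑) '' T : Set Y))
    (hS : IsTransversal ((↑) '' (φ '' T) : Set Y')) :
    ν' ((↑) '' (φ '' T)) = ν ((↑) '' T) := by
  obtain ⟨𝒜⟩ := BorelFoliation.exists_boxAtlas Y
  have := BorelFoliation.t2Space Y
  have hA := hπ.total_source.saturated
  have hsub : ∀ s : ((↑) '' T : Set Y), (s : Y) ∈ A := by
    rintro ⟨_, a, -, rfl⟩; exact a.2
  let g : ((↑) '' T : Set Y) → Y := fun s => τ ⟨s, hsub s⟩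
  have hg : Measurable g :=
    measurable_subtype_coe.comp (hτ.comp (measurable_subtype_coe.subtype_mk))
  have hτi : Function.Injective τ := fun a b hab => hφ (by rw [← hτφ, ← hτφ, hab])
  have hgi : Function.Injective g := by
    intro s t hst
    have := hτi (Subtype.ext hst)
    exact Subtype.ext (congrArg (Subtype.val : A → Y) this)
  obtain ⟨hgm, hge⟩ := transversalEquiv_range hT.measurableSet hg hgi fun s =>
    hA.mem_leaf_iff.1 (hτl ⟨s, hsub s⟩)
  have hrange : range g = (↑) '' (τ '' T) := by
    ext y
    constructor
    · rintro ⟨⟨_, a, ha, rfl⟩, rfl⟩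
      exact ⟨_, ⟨a, ha, rfl⟩, rfl⟩
    · rintro ⟨_, ⟨a, ha, rfl⟩, rfl⟩
      exact ⟨⟨a, a, ha, rfl⟩, rfl⟩
  -- Near a point `y` of `A`, a point of `τ(T)` maps by `π` into `φ(T)` and close to `π y`, hence to
  -- `π y` itself because `φ(T)` has no accumulation point. As `φ` is injective, at most one point
  -- of `τ(T)` lies over `π y`.
  have hT1 : IsTransversal (range g) := by
    refine isTransversal_iff.2 ⟨hgm, fun y => ?_⟩
    rw [hrange]
    by_cases hy : y ∈ A
    · have hAo := hA.isOpen 𝒜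
      have hn : map ((↑) : A → Y) (𝓝 ⟨y, hy⟩) = 𝓝 y :=
        hAo.isOpenEmbedding_subtypeVal.map_nhds_eq ⟨y, hy⟩
      have h1 := eventually_nhdsWithin_iff.1 ((isTransversal_iff.1 hS).2 (π ⟨y, hy⟩))
      have h2 := (continuous_subtype_val.comp hπ.continuous).continuousAt.eventually h1
      have h3 : ∀ c : A, ∀ᶠ w : A in 𝓝 ⟨y, hy⟩, w = c → (w : Y) = y := by
        intro c
        by_cases hc : (c : Y) = y
        · exact Eventually.of_forall fun w hw => hw ▸ hc
        · have : ∀ᶠ w : A in 𝓝 ⟨y, hy⟩, w ≠ c :=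
            isOpen_ne.mem_nhds fun h => hc (congrArg Subtype.val h).symm
          exact this.mono fun w hw h => absurd h hw
      have h4 : ∀ᶠ w : A in 𝓝 ⟨y, hy⟩, (w : Y) ≠ y → w ∉ τ '' T := by
        by_cases hex : ∃ t ∈ T, φ t = π ⟨y, hy⟩
        · obtain ⟨t, ht, hte⟩ := hex
          filter_upwards [h2, h3 (τ t)] with w hw1 hw2 hwy
          rintro ⟨s, hs, rfl⟩
          by_cases he : π (τ s) = π ⟨y, hy⟩
          · rw [hτφ, ← hte] at he
            exact hwy (hw2 (by rw [hφ he]))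
          · exact hw1 (fun h => he (Subtype.ext h)) ⟨φ s, ⟨s, hs, rfl⟩, by
              simp only [Function.comp_apply, hτφ]⟩
        · filter_upwards [h2] with w hw1 hwy
          rintro ⟨s, hs, rfl⟩
          refine hw1 (fun h => hex ⟨s, hs, ?_⟩) ⟨φ s, ⟨s, hs, rfl⟩, by
              simp only [Function.comp_apply, hτφ]⟩
          rw [← hτφ]
          exact Subtype.ext h
      rw [eventually_nhdsWithin_iff, ← hn, eventually_map]
      refine h4.mono fun w hw hne => ?_
      rintro ⟨w', hw', h⟩
      exact hw hne (Subtype.ext h ▸ hw')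
    · refine eventually_nhdsWithin_of_eventually_nhds ?_
      filter_upwards [(hA.compl.isOpen 𝒜).mem_nhds hy] with w hw
      rintro ⟨w', -, rfl⟩
      exact hw w'.2
  -- Invariance replaces `T` by `τ(T)`, which meets every nonempty fibre over `φ(T)` exactly once.
  rw [ν.invariant _ _ hT hT1 hge]
  refine hπ.pushforward _ _ hS hT1 ?_ ?_ ?_ ?_
  · rintro _ ⟨a, -, rfl⟩; exact a.2
  · rw [hrange]; rintro _ ⟨a, -, rfl⟩; exact a.2
  · rw [hrange]
    rintro t ⟨t', ⟨s, hs, rfl⟩, h⟩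
    rw [← Subtype.ext h, hτφ]
    exact ⟨_, ⟨s, hs, rfl⟩, rfl⟩
  · rw [hrange]
    rintro a ⟨b, ⟨s, hs, rfl⟩, h⟩
    have hb : φ s = π a := Subtype.ext h
    refine ⟨τ s, ⟨⟨_, ⟨s, hs, rfl⟩, rfl⟩, (hτφ s).trans hb⟩, ?_⟩
    rintro _ ⟨⟨_, ⟨t, ht, rfl⟩, h1⟩, h2⟩
    rw [← Subtype.ext h1] at h2 ⊢
    rw [hτφ, ← hb] at h2
    rw [hφ h2]

/-- The image of a transversal by an isomorphism of foliations onto a saturated set. -/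
theorem isTransversal_image {j : A → Y'} (hj : IsOpenEmbedding j) (hjm : MeasurableEmbedding j)
    (hjs : IsSaturated (range j)) {T : Set A}
    (hT : IsTransversal ((↑) '' T : Set Y)) : IsTransversal (j '' T) := by
  obtain ⟨𝒜⟩ := BorelFoliation.exists_boxAtlas Y'
  have hTm : MeasurableSet T := by
    rw [← preimage_image_eq T Subtype.val_injective]
    exact measurable_subtype_coe hT.measurableSet
  refine isTransversal_iff.2 ⟨hjm.measurableSet_image.2 hTm, fun y => ?_⟩
  by_cases hy : y ∈ range j
  · obtain ⟨z, rfl⟩ := hy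
    have h1 := eventually_nhdsWithin_iff.1 ((isTransversal_iff.1 hT).2 (z : Y))
    have h2 := (continuous_subtype_val (p := (· ∈ A))).continuousAt.eventually h1
    rw [eventually_nhdsWithin_iff, ← hj.map_nhds_eq, eventually_map]
    refine h2.mono fun w hw hne => ?_
    rintro ⟨w', hw', h⟩
    refine hw (fun h => hne ?_) ⟨w', hw', congrArg _ (hj.injective h)⟩
    rw [Subtype.ext h]
    rfl
  · refine eventually_nhdsWithin_of_eventually_nhds ?_
    filter_upwards [(hjs.compl.isOpen 𝒜).mem_nhds hy] with w hw h
    exact hw (image_subset_range _ _ h)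

end Collapse

end MeasuredFoliation

/-! ### The isomorphism and the homotopy -/

theorem mainTheorem6 {Y : Type*} {Y' : Type*}
    [TopologicalSpace Y] [MeasurableSpace Y] [MeasuredFoliation.BorelFoliation 1 Y]
    [TopologicalSpace Y'] [MeasurableSpace Y'] [MeasuredFoliation.BorelFoliation 1 Y']
    (ν : MeasuredFoliation.InvariantTransverseMeasure Y)
    (ν' : MeasuredFoliation.InvariantTransverseMeasure Y')
    (hν : MeasuredFoliation.IsErgodic ν) (hν' : MeasuredFoliation.IsErgodic ν')
    {A : Set Y} {A' : Set Y'} (π : A → A')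
    (hπ : MeasuredFoliation.IsCollapse ν ν' π) :
    ∃ (B : Set Y) (B' : Set Y') (hB : B ⊆ A) (hB' : B' ⊆ A')
      (hπB : ∀ b : B, (π (Set.inclusion hB b) : Y') ∈ B') (φ : B ≃ₜ B'),
      MeasuredFoliation.IsMeasuredIso ν ν' φ ∧
      MeasuredFoliation.BTHomotopic
        (fun b : B => (⟨π (Set.inclusion hB b), hπB b⟩ : B')) φ := by
  open MeasuredFoliation in
  obtain ⟨κ, κ', h⟩ := hπ.exists_isLineMap
  obtain ⟨𝒜'⟩ := BorelFoliation.exists_boxAtlas Y'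
  have hAm := hπ.total_source.measurableSet
  have hA'm := hπ.total_target.measurableSet
  have hA's := hπ.total_target.saturated
  have := hAm.standardBorel
  have := hA'm.standardBorel
  set f := straightMap κ κ' π with hf
  let j : A → Y' := (↑) ∘ f
  have hfm : Measurable f := h.measurable_straightMap
  have hj : IsOpenEmbedding j :=
    (hA's.isOpen 𝒜').isOpenEmbedding_subtypeVal.comp (.of_continuous_injective_isOpenMap
      h.continuous_straightMap h.injective_straightMap h.isOpenMap_straightMap)
  have hjm : MeasurableEmbedding j :=
    (measurable_subtype_coe.comp hfm).measurableEmbedding hj.injective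
  have hrange : range j = (↑) '' range π := by
    rw [range_comp, hf, h.range_straightMap]
  have hmem : ∀ a, ∀ y ∈ leaf (π a), (y : Y') ∈ range j := fun a y hy => by
    rw [hrange]
    exact ⟨y, h.leaf_subset_range a hy, rfl⟩
  have htot : IsTotalPart ν' (range j) := by
    rw [hrange]
    exact hπ.isTotalPart_range (hrange ▸ hjm.measurableSet_range) h.leaf_subset_range
  refine ⟨A, range j, Subset.rfl, ?_, fun b => hmem b _ (mem_leaf_self _),
    hj.isEmbedding.toHomeomorph, ⟨hπ.total_source, htot, ?_, ?_, ?_⟩, ?_⟩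
  · rintro _ ⟨a, rfl⟩; exact (f a).2
  · exact hjm.measurable.subtype_mk
  · intro C hC
    have : hj.isEmbedding.toHomeomorph.symm ⁻¹' C = (↑) ⁻¹' (j '' C) := by
      ext y
      obtain ⟨a, rfl⟩ := hj.isEmbedding.toHomeomorph.surjective y
      rw [mem_preimage, Homeomorph.symm_apply_apply]
      exact (hj.injective.mem_set_image).symm
    rw [this]
    exact measurable_subtype_coe (hjm.measurableSet_image.2 hC)
  · intro T hT
    have hS := isTransversal_image hj hjm htot.saturated hT
    have e : ((↑) '' (hj.isEmbedding.toHomeomorph '' T) : Set Y') = (↑) '' (f '' T) := by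
      rw [image_image, image_image]; rfl
    rw [image_comp] at hS
    rw [e]
    exact hπ.measure_image h.injective_straightMap h.measurable_straightLift h.map_straightLift
      h.straightLift_mem hT hS
  · refine ⟨fun p => ⟨(straightHomotopy κ κ' π p : A'), hmem p.1 _ (h.straightHomotopy_mem p)⟩, ?_, ?_,
      fun b => Subtype.ext ?_, fun b => Subtype.ext ?_⟩
    · exact (continuous_subtype_val.comp h.continuous_straightHomotopy).subtype_mk _
    · exact (measurable_subtype_coe.comp h.measurable_straightHomotopy).subtype_mk
    · exact congrArg (Subtype.val : A' → Y') (h.straightHomotopy_zero b)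
    · exact congrArg (Subtype.val : A' → Y') (IsLineMap.straightHomotopy_one κ κ' π b)
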